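/- Let $m\ge 0$, $k\ge 1$, let $A_{-1},A_0,A_1$ be real $m\times m$ matrices with nonnegative entries, and put $\varphi(z)=-z^{-1}A_{-1}+I-A_0-zA_1$ for $z\in\mathbb C\setminus\{0\}$. Write $\rho$ for the spectral radius, $\|\cdot\|_2$ for the spectral norm and $\sigma_1\ge\sigma_2\ge\dots$ for the singular values of a matrix (with $\sigma_s=0$ when $s$ exceeds its number of rows or of columns). A matrix is called $k$-quasiseparable if each of its submatrices strictly contained in the lower or in the upper triangular part has rank at most $k$. Assume that 1. $\rho(I-\varphi(z))<1$ for all $|z|=1$; 2. $A_{-1},A_0,A_1$ are $k$-quasiseparable and $\|A_i\|_2\le L$ for $i=-1,0,1$; 3. $t>1$ and $\delta>0$ are such that $\det\varphi(z)\neq0$ and $\|\varphi(z)^{-1}\|_2\le\delta$ for all $z$ in the annulus $\mathbb A=\{t^{-1}<|z|<t\}$. For $0\le p\le m$ partition, with top left blocks of size $p\times p$, $$\varphi(z)=\begin{bmatrix}I-E(z)&-B(z)\\-C(z)&I-D(z)\end{bmatrix},\qquad \varphi(z)^{-1}=\begin{bmatrix}\tilde E(z)&\tilde B(z)\\ \tilde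 C(z)&\tilde D(z)\end{bmatrix}.$$ Let $A_i^{(h)}$ be generated by cyclic reduction: $A_i^{(0)}=A_i$ and, with $S^{(h)}=(A_0^{(h)}-I)^{-1}$, $$A_{\pm1}^{(h+1)}=-A_{\pm1}^{(h)}S^{(h)}A_{\pm1}^{(h)},\qquad A_0^{(h+1)}=A_0^{(h)}-A_1^{(h)}S^{(h)}A_{-1}^{(h)}-A_{-1}^{(h)}S^{(h)}A_1^{(h)},$$ let $\varphi^{(h)}(z)=-z^{-1}A_{-1}^{(h)}+I-A_0^{(h)}-zA_1^{(h)}$ and $\psi^{(h)}=(\varphi^{(h)})^{-1}$. For an integer $N\ge1$ let $I_N$ be the operator that maps a matrix Laurent series $\sum_{n\in\mathbb Z}z^nF_n$ converging on $\mathbb A$ to $\sum_{n\in\mathbb Z}z^nF_{Nn}$. Then $\rho(I-\varphi(z))<1$ for every $z\in\mathbb A$ and, for every $p$, both $I-E(z)$ and $I-D(z)$ are invertible for every $z\in\mathbb A$. Moreover, for every $p$ and every $h\ge0$, with $N=2^h$, the matrix $A_0^{(h)}-I$ is invertible and, for every $|z|=1$, the matrix $\varphi^{(h)}(z)$ is invertible,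 the bottom left block of $\psi^{(h)}(z)$ (rows $>p$, columns $\le p$) is $\tilde C^{(h)}(z):=I_N(\tilde C)(z)$, and $$\sigma_s(\tilde C^{(h)}(z))\le 3M\,e^{-\frac{s-3k}{6k}\log t}\quad\text{for all } s\ge1,\qquad M=\frac{4L\delta^2}{(1-e^{-N\log t})(1-t^{-1})}.$$ If in addition $A_{-1},A_0,A_1$ are tridiagonal, then $$\sigma_1(\tilde C^{(h)}(z))\le M\qquad\text{and}\qquad \sigma_s(\tilde C^{(h)}(z))\le M\,e^{-\frac s2\log t}\quad\text{for all } s\ge2.$$ -/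

import Mathlib

open scoped Matrix.Norms.L2Operator

noncomputable section

/-- The three real coefficients `A₋₁, A₀, A₁` (of size `m × m`) of
`φ(z) = -z⁻¹ A₋₁ + I - A₀ - z A₁`. -/
structure CRCoeffs (m : ℕ) where
  /-- the coefficient `A₋₁` -/
  neg : Matrix (Fin m) (Fin m) ℝ
  /-- the coefficient `A₀` -/
  zero : Matrix (Fin m) (Fin m) ℝ
  /-- the coefficient `A₁` -/
  pos : Matrix (Fin m) (Fin m) ℝ

namespace CRCoeffs

variable {m : ℕ}

/-- The matrix Laurent polynomial `φ(z) = -z⁻¹ A₋₁ + I - A₀ - z A₁`. -/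
def phi (A : CRCoeffs m) (z : ℂ) : Matrix (Fin m) (Fin m) ℂ :=
  -(z⁻¹ • A.neg.map Complex.ofReal) + 1 - A.zero.map Complex.ofReal
    - z • A.pos.map Complex.ofReal

/-- One step of cyclic reduction, with `S = (A₀ - I)⁻¹`. -/
def crStep (A : CRCoeffs m) : CRCoeffs m where
  neg := -(A.neg * (A.zero - 1)⁻¹ * A.neg)
  zero := A.zero - A.pos * (A.zero - 1)⁻¹ * A.neg - A.neg * (A.zero - 1)⁻¹ * A.pos
  pos := -(A.pos * (A.zero - 1)⁻¹ * A.pos)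

/-- The coefficients `A₋₁⁽ʰ⁾, A₀⁽ʰ⁾, A₁⁽ʰ⁾` after `h` steps of cyclic reduction. -/
def cr (A : CRCoeffs m) : ℕ → CRCoeffs m
  | 0 => A
  | h + 1 => crStep (cr A h)

end CRCoeffs

/-- The `k`-quasiseparable matrices: every submatrix strictly contained in the lower or in the
upper triangular part has rank at most `k`. Every such submatrix lies in one of the maximal
ones: rows `≥ p` and columns `< p`, or rows `< p` and columns `≥ p`. -/
def IsQuasiseparable {m : ℕ} (k : ℕ) (A : Matrix (Fin m) (Fin m) ℝ) : Prop :=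
  ∀ p : ℕ,
    (A.toBlock (fun i => p ≤ i.val) (fun j => j.val < p)).rank ≤ k ∧
    (A.toBlock (fun i => i.val < p) (fun j => p ≤ j.val)).rank ≤ k

/-- Tridiagonal matrices: the entries with `|i - j| > 1` vanish. -/
def IsTridiagonal {m : ℕ} (A : Matrix (Fin m) (Fin m) ℝ) : Prop :=
  ∀ i j : Fin m, i.val + 1 < j.val ∨ j.val + 1 < i.val → A i j = 0

/-- The top left (`p × p`) block of a matrix. -/
abbrev topLeft {m : ℕ} (p : ℕ) (X : Matrix (Fin m) (Fin m) ℂ) :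
    Matrix {i : Fin m // i.val < p} {j : Fin m // j.val < p} ℂ :=
  X.toBlock (fun i => i.val < p) (fun j => j.val < p)

/-- The bottom left block (rows from `p` on, the first `p` columns) of a matrix. -/
abbrev bottomLeft {m : ℕ} (p : ℕ) (X : Matrix (Fin m) (Fin m) ℂ) :
    Matrix {i : Fin m // p ≤ i.val} {j : Fin m // j.val < p} ℂ :=
  X.toBlock (fun i => p ≤ i.val) (fun j => j.val < p)

/-- The bottom right block (rows and columns from `p` on) of a matrix. -/
abbrev bottomRight {m : ℕ} (p : ℕ) (X : Matrix (Fin m) (Fin m) ℂ) :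
    Matrix {i : Fin m // p ≤ i.val} {j : Fin m // p ≤ j.val} ℂ :=
  X.toBlock (fun i => p ≤ i.val) (fun j => p ≤ j.val)

/-- The open annulus `{z : t⁻¹ < |z| < t}`. -/
def annulus (t : ℝ) : Set ℂ := {z | t⁻¹ < ‖z‖ ∧ ‖z‖ < t}

/-- The `n`-th coefficient `Fₙ = (2πi)⁻¹ ∮_{|w| = 1} w⁻ⁿ⁻¹ F(w) dw` of the Laurent series
`F(z) = ∑ₙ zⁿ Fₙ` of a matrix function analytic on an annulus around the unit circle. -/
def laurentCoeff {r c : Type*} (F : ℂ → Matrix r c ℂ) (n : ℤ) : Matrix r c ℂ :=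
  Matrix.of fun i j =>
    (2 * (Real.pi : ℂ) * Complex.I)⁻¹ * ∮ w in C(0, 1), w ^ (-n - 1) * F w i j

/-- The operator `I_N`, which maps `F(z) = ∑ₙ zⁿ Fₙ` to `∑ₙ zⁿ F_{Nn}` (sums over `n ∈ ℤ`). -/
def decimate {r c : Type*} (N : ℕ) (F : ℂ → Matrix r c ℂ) (z : ℂ) : Matrix r c ℂ :=
  Matrix.of fun i j => ∑' n : ℤ, z ^ n * laurentCoeff F ((N : ℤ) * n) i j

/-- The `s`-th singular value `σ_s(X)`, for `s = 1, 2, …`, in non-ascending order (and `0` beyond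
the number of columns). Mathlib numbers the singular values from `0`. -/
def sigma {r c : Type*} [Fintype r] [Fintype c] [DecidableEq c] (s : ℕ)
    (X : Matrix r c ℂ) : ℝ :=
  (Matrix.toEuclideanLin X).singularValues (s - 1)

/-- The constant `M = 4 L δ² / ((1 - e^{-N log t}) (1 - t⁻¹))`. -/
def decayConst (L δ t : ℝ) (N : ℕ) : ℝ :=
  4 * L * δ ^ 2 / ((1 - Real.exp (-((N : ℝ) * Real.log t))) * (1 - t⁻¹))

end

/-! Write `φ(z) = I - W(z)` with `W(z) = z⁻¹ A₋₁ + A₀ + z A₁`. The coefficients are nonnegative, so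
`|W(z)| ≤ W(|z|)` entrywise, and each circle is controlled by its positive real point. At `r = 1`
the Neumann series of `W(r)` converges. Invertibility of `I - W(r)` on the whole interval `(t⁻¹, t)`
and a connectedness argument carry this to every such `r` (`Nonneg.inv_one_sub_iter_nonneg`). Hence
`(I - W(r))⁻¹ ≥ 0`, and by domination `ρ(W(z)) < 1`, principal blocks of `φ(z)` are invertible, and
`(I - E(z))⁻¹` inherits the bound `δ`.

Put `K = I - A₀`. One step of cyclic reduction satisfies `φ⁽¹⁾(z²) = φ(z) K⁻¹ φ(-z)`, and `φ(z) +
φ(-z) = 2K`, so `ψ⁽¹⁾(z²)` is the mean of `φ(z)⁻¹` and `φ(-z)⁻¹`. After `h` steps, `ψ⁽ʰ⁾(w^N)` is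
the mean of `φ⁻¹` over the points `ζʲ w`, where `ζ` is a primitive `N`-th root of unity
(`Subcritical.inv_phi_cr_pow`). This averaging keeps exactly the Laurent coefficients with index
divisible by `N`.

Block inversion gives `C̃ = D̃ C (I - E)⁻¹`, where `C(z)` is a Laurent polynomial with three
coefficients of small rank. Split the two outer factors into their parts with Laurent index in a
fixed class mod `N`. The average becomes a sum over `b ∈ {-1, 0, 1}` and `r` mod `N` of `D₋₍ᵣ₊ᵦ₎ Cᵦ
Gᵣ` (`average_mul_mul_eq`). The classes `r` within distance `q` of `0` form a matrix of rank at most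
`3(2q+1)k`. On the others, Parseval on the two boundary circles makes the energy of `G` of order
`t^(-2(q+1))`, and Cauchy-Schwarz bounds the norm of the remainder. A singular value is at most the
distance to a matrix of smaller rank, which gives the decay.

In the tridiagonal case all `Cᵦ` are multiples of one matrix unit, so each `r` costs rank one and `s
= 2q + 2` allows `2q + 1` classes. For `s = 2q + 3` the additional rank removes every term whose
left factor has class `0`; these share that left factor. The left energy then gains enough for the
missing `t^(-1/2)`. -/

/-! ### Nonnegative matrices, Neumann series and domination -/

section NonnegMatrices

variable {n : Type*} [Fintype n] [DecidableEq n]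

omit [DecidableEq n] in
theorem Matrix.mul_apply_nonneg {X Y : Matrix n n ℝ} (hX : ∀ i j, 0 ≤ X i j)
    (hY : ∀ i j, 0 ≤ Y i j) (i j : n) : 0 ≤ (X * Y) i j := by
  rw [Matrix.mul_apply]
  exact Finset.sum_nonneg fun l _ => mul_nonneg (hX i l) (hY l j)

theorem Matrix.geom_sum_eq_mul_one_sub_pow {R : Type*} [CommRing R] {W Y : Matrix n n R}
    (h : Y * (1 - W) = 1) (N : ℕ) :
    ∑ k ∈ Finset.range N, W ^ k = Y * (1 - W ^ N) := by
  rw [← mul_neg_geom_sum, ← mul_assoc, h, one_mul]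

/-- A nonnegative matrix `W` such that `1 - W` has a nonnegative inverse has a convergent
Neumann series. -/
theorem Matrix.hasSum_pow_apply_of_nonneg {W Y : Matrix n n ℝ} (hW : ∀ i j, 0 ≤ W i j)
    (hY : ∀ i j, 0 ≤ Y i j) (h : Y * (1 - W) = 1) (i j : n) :
    HasSum (fun k : ℕ => (W ^ k) i j) (Y i j) := by
  have hS : ∀ (N : ℕ) (a b : n), ∑ k ∈ Finset.range N, (W ^ k) a b
      = Y a b - (Y * W ^ N) a b := by
    intro N a b
    have := congrFun (congrFun (Matrix.geom_sum_eq_mul_one_sub_pow h N) a) b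
    rw [Matrix.sum_apply] at this
    rw [this, mul_sub, mul_one, Matrix.sub_apply]
  have hsum : ∀ a b, Summable fun k : ℕ => (W ^ k) a b := by
    intro a b
    refine summable_of_sum_range_le (c := Y a b) (fun k => Matrix.pow_apply_nonneg hW k a b) ?_
    intro N
    rw [hS N a b]
    have := Matrix.mul_apply_nonneg hY (Matrix.pow_apply_nonneg hW N) a b
    linarith
  refine (hsum i j).hasSum_iff_tendsto_nat.2 ?_
  simp_rw [hS]
  have : Filter.Tendsto (fun N : ℕ => (Y * W ^ N) i j) Filter.atTop (nhds 0) := by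
    simp_rw [Matrix.mul_apply]
    have h0 : (0 : ℝ) = ∑ l : n, Y i l * 0 := by simp
    rw [h0]
    exact tendsto_finsetSum _ fun l _ => ((hsum l j).tendsto_atTop_zero).const_mul _
  simpa using tendsto_const_nhds.sub this

section Dominated

variable {𝕜 : Type*} [RCLike 𝕜] {a : Type*} [Fintype a] [DecidableEq a]

theorem Matrix.norm_pow_apply_le_of_dominated {W : Matrix n n ℝ} {E : Matrix a a 𝕜} (f : a ↪ n)
    (hE : ∀ i j, ‖E i j‖ ≤ W (f i) (f j)) (hW : ∀ i j, 0 ≤ W i j) (k : ℕ) (i j : a) :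
    ‖(E ^ k) i j‖ ≤ (W ^ k) (f i) (f j) := by
  induction k generalizing i j with
  | zero =>
    rw [pow_zero, pow_zero, Matrix.one_apply, Matrix.one_apply]
    by_cases h : i = j <;> simp [h]
  | succ k ih =>
    rw [pow_succ, pow_succ, Matrix.mul_apply, Matrix.mul_apply]
    calc ‖∑ l, (E ^ k) i l * E l j‖ ≤ ∑ l, (W ^ k) (f i) (f l) * W (f l) (f j) := by
          refine norm_sum_le_of_le _ fun l _ => ?_
          rw [norm_mul]
          exact mul_le_mul (ih i l) (hE l j) (norm_nonneg _)
            (Matrix.pow_apply_nonneg hW k _ _)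
      _ = ∑ l ∈ Finset.univ.map f, (W ^ k) (f i) l * W l (f j) := by
          rw [Finset.sum_map]
      _ ≤ ∑ l, (W ^ k) (f i) l * W l (f j) :=
          Finset.sum_le_univ_sum_of_nonneg fun l =>
            mul_nonneg (Matrix.pow_apply_nonneg hW k _ _) (hW _ _)

/-- Domination of Neumann series: if `E` is dominated entrywise by (a principal submatrix of) a
nonnegative matrix `W` whose `1 - W` has the nonnegative inverse `Y`, then `1 - E` is invertible
and its inverse is dominated by `Y`. -/
theorem Matrix.isUnit_one_sub_of_dominated {W Y : Matrix n n ℝ} {E : Matrix a a 𝕜} (f : a ↪ n)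
    (hE : ∀ i j, ‖E i j‖ ≤ W (f i) (f j)) (hW : ∀ i j, 0 ≤ W i j) (hY : ∀ i j, 0 ≤ Y i j)
    (h : Y * (1 - W) = 1) :
    IsUnit (1 - E) ∧ ∀ i j, ‖(1 - E)⁻¹ i j‖ ≤ Y (f i) (f j) := by
  have hb := Matrix.norm_pow_apply_le_of_dominated f hE hW
  have hs := Matrix.hasSum_pow_apply_of_nonneg hW hY h
  have hsum : ∀ i j, Summable fun k : ℕ => (E ^ k) i j := fun i j =>
    Summable.of_norm_bounded (hs (f i) (f j)).summable fun k => hb k i j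
  set X : Matrix a a 𝕜 := Matrix.of fun i j => ∑' k : ℕ, (E ^ k) i j with hX
  have hX' : ∀ i j, HasSum (fun k : ℕ => (E ^ k) i j) (X i j) := fun i j => (hsum i j).hasSum
  have hone : (1 - E) * X = 1 := by
    ext i j
    have h1 : Filter.Tendsto (fun N : ℕ => ((1 - E) * ∑ k ∈ Finset.range N, E ^ k) i j)
        Filter.atTop (nhds (((1 - E) * X) i j)) := by
      simp_rw [Matrix.mul_apply, Matrix.sum_apply]
      exact tendsto_finsetSum _ fun l _ => ((hX' l j).tendsto_sum_nat).const_mul _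
    have h2 : Filter.Tendsto (fun N : ℕ => ((1 - E) * ∑ k ∈ Finset.range N, E ^ k) i j)
        Filter.atTop (nhds ((1 : Matrix a a 𝕜) i j)) := by
      simp_rw [mul_neg_geom_sum, Matrix.sub_apply]
      simpa using tendsto_const_nhds.sub ((hsum i j).tendsto_atTop_zero)
    exact tendsto_nhds_unique h1 h2
  refine ⟨(Matrix.isUnit_iff_isUnit_det _).2 (Matrix.isUnit_det_of_right_inverse hone), ?_⟩
  intro i j
  rw [Matrix.inv_eq_right_inv hone]
  exact tsum_of_norm_bounded (hs (f i) (f j)) fun k => hb k i j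

/-- For `‖z‖ ≥ 1` the matrix `z⁻¹ E` is still dominated by `W`, so `z - E = z (1 - z⁻¹ E)` is
invertible and `z` is not in the spectrum. -/
theorem Matrix.spectralRadius_lt_one_of_dominated {W Y : Matrix n n ℝ} {E : Matrix n n ℂ}
    (hE : ∀ i j, ‖E i j‖ ≤ W i j) (hW : ∀ i j, 0 ≤ W i j) (hY : ∀ i j, 0 ≤ Y i j)
    (h : Y * (1 - W) = 1) : spectralRadius ℂ E < 1 := by
  cases isEmpty_or_nonempty n with
  | inl h0 =>
    have : spectralRadius ℂ E = 0 := by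
      simp [spectralRadius]
    simp
  | inr h0 =>
    refine spectrum.spectralRadius_lt_of_forall_lt (r := 1) E fun z hz => ?_
    by_contra hlt
    have hz1 : 1 ≤ ‖z‖ := by
      have := not_lt.1 hlt
      exact_mod_cast this
    have hz0 : z ≠ 0 := by
      rintro rfl
      norm_num at hz1
    have := (Matrix.isUnit_one_sub_of_dominated (W := W) (E := z⁻¹ • E)
      (Function.Embedding.refl n) (fun i j => ?_) hW hY h).1
    · refine hz ?_
      rw [spectrum.mem_resolventSet_iff]
      have h3 : algebraMap ℂ (Matrix n n ℂ) z - E = algebraMap ℂ _ z * (1 - z⁻¹ • E) := by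
        rw [mul_sub, mul_one, Algebra.algebraMap_eq_smul_one, smul_mul_assoc, one_mul, smul_smul,
          mul_inv_cancel₀ hz0, one_smul]
      rw [h3]
      exact ((IsUnit.mk0 z hz0).map _).mul this
    · rw [Matrix.smul_apply, norm_smul, norm_inv]
      calc ‖z‖⁻¹ * ‖E i j‖ ≤ 1 * ‖E i j‖ := by
            gcongr
            exact inv_le_one_of_one_le₀ hz1
        _ ≤ _ := by simpa using hE i j

end Dominated

/-- If some power of the nonnegative matrix `W` has norm less than one, then a left inverse of
`1 - W` is nonnegative. -/
theorem Matrix.nonneg_of_norm_pow_lt_one {W Y : Matrix n n ℝ} (hW : ∀ i j, 0 ≤ W i j)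
    (h : Y * (1 - W) = 1) {k : ℕ} (hk : ‖W ^ k‖ < 1) (i j : n) : 0 ≤ Y i j := by
  -- `Y * (1 - W ^ (k * N))` is a partial sum of the Neumann series, hence nonnegative. Only the
  -- lengths divisible by `k` are needed, since `(W ^ k) ^ N` tends to zero.
  have h1 : Filter.Tendsto (fun N : ℕ => Y * (1 - W ^ (k * N))) Filter.atTop (nhds Y) := by
    simp_rw [pow_mul]
    have := (tendsto_pow_atTop_nhds_zero_of_norm_lt_one hk)
    have h2 := (tendsto_const_nhds (x := Y)).mul ((tendsto_const_nhds (x := (1 : Matrix n n ℝ))).sub this)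
    simpa using h2
  have h2 : Filter.Tendsto (fun N : ℕ => (Y * (1 - W ^ (k * N))) i j) Filter.atTop
      (nhds (Y i j)) :=
    ((continuous_apply_apply i j).tendsto Y).comp h1
  refine ge_of_tendsto' h2 fun N => ?_
  rw [← Matrix.geom_sum_eq_mul_one_sub_pow h, Matrix.sum_apply]
  exact Finset.sum_nonneg fun l _ => Matrix.pow_apply_nonneg hW l i j

theorem Matrix.norm_mulVec_le {𝕜 : Type*} [RCLike 𝕜] {r : Type*} [Fintype r]
    (M : Matrix r n 𝕜) (x : n → 𝕜) :
    √(∑ i, ‖M.mulVec x i‖ ^ 2) ≤ ‖M‖ * √(∑ i, ‖x i‖ ^ 2) := by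
  have := Matrix.l2_opNorm_mulVec M (WithLp.toLp 2 x)
  rw [EuclideanSpace.norm_eq, EuclideanSpace.norm_eq] at this
  simpa using this

theorem Matrix.norm_le_of_mulVec {𝕜 : Type*} [RCLike 𝕜] {r : Type*} [Fintype r]
    (M : Matrix r n 𝕜) {c : ℝ} (hc : 0 ≤ c)
    (h : ∀ x : n → 𝕜, √(∑ i, ‖M.mulVec x i‖ ^ 2) ≤ c * √(∑ i, ‖x i‖ ^ 2)) : ‖M‖ ≤ c := by
  rw [Matrix.l2_opNorm_def]
  refine ContinuousLinearMap.opNorm_le_bound _ hc fun x => ?_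
  have := h x.ofLp
  rw [EuclideanSpace.norm_eq, EuclideanSpace.norm_eq]
  simpa using this

/-- Entrywise `|M x| ≤ Y |x|`, and `|x|` has the same Euclidean length as `x`. -/
theorem Matrix.norm_le_norm_of_dominated {r : Type*} [Fintype r] {M : Matrix r n ℂ}
    {Y : Matrix r n ℝ} (h : ∀ i j, ‖M i j‖ ≤ Y i j) : ‖M‖ ≤ ‖Y‖ := by
  refine Matrix.norm_le_of_mulVec M (norm_nonneg _) fun x => ?_
  have h1 := Matrix.norm_mulVec_le Y (fun i => ‖x i‖)
  simp only [norm_norm] at h1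
  refine le_trans (Real.sqrt_le_sqrt ?_) h1
  refine Finset.sum_le_sum fun i _ => ?_
  refine pow_le_pow_left₀ (norm_nonneg _) ?_ 2
  rw [Matrix.mulVec, Matrix.mulVec, dotProduct, dotProduct]
  refine (norm_sum_le_of_le _ fun j _ => ?_).trans (le_abs_self _)
  rw [norm_mul]
  exact mul_le_mul_of_nonneg_right (h i j) (norm_nonneg _)

theorem Matrix.norm_le_norm_map_ofReal {r : Type*} [Fintype r] (Y : Matrix r n ℝ) :
    ‖Y‖ ≤ ‖Y.map Complex.ofReal‖ := by
  refine Matrix.norm_le_of_mulVec Y (norm_nonneg _) fun x => ?_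
  have h1 := Matrix.norm_mulVec_le (Y.map Complex.ofReal) (fun i => (x i : ℂ))
  have h2 : ∀ i, (Y.map Complex.ofReal).mulVec (fun i => (x i : ℂ)) i = ((Y.mulVec x i : ℝ) : ℂ) := by
    intro i
    simp [Matrix.mulVec, dotProduct]
  simpa only [h2, Complex.norm_real] using h1

/-- The norm of a submatrix is at most the norm of the matrix. -/
theorem Matrix.norm_submatrix_le {𝕜 : Type*} [RCLike 𝕜] {r a b : Type*} [Fintype r] [Fintype a]
    [Fintype b] [DecidableEq b] (M : Matrix r n 𝕜) (f : a ↪ r) (g : b ↪ n) :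
    ‖M.submatrix f g‖ ≤ ‖M‖ := by
  refine Matrix.norm_le_of_mulVec _ (norm_nonneg _) fun x => ?_
  set x' : n → 𝕜 := Function.extend g x 0 with hx'
  have hg : ∀ b, x' (g b) = x b := fun b => g.injective.extend_apply _ _ _
  have hout : ∀ i, i ∉ Set.range g → x' i = 0 := by
    intro i hi
    rw [hx', Function.extend_apply' _ _ _ (by simpa using hi)]
    rfl
  have h1 := Matrix.norm_mulVec_le M x'
  have h2 : ∑ i, ‖x' i‖ ^ 2 = ∑ i, ‖x i‖ ^ 2 := by
    symm
    refine Fintype.sum_of_injective g g.injective _ _ (fun i hi => by simp [hout i hi])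
      (fun b => by rw [hg])
  have h3 : ∀ i, (M.submatrix f g).mulVec x i = M.mulVec x' (f i) := by
    intro i
    rw [Matrix.mulVec, Matrix.mulVec, dotProduct, dotProduct]
    refine Fintype.sum_of_injective g g.injective _ _ (fun i hi => by simp [hout i hi])
      (fun b => by rw [hg]; rfl)
  rw [h2] at h1
  refine le_trans (Real.sqrt_le_sqrt ?_) h1
  simp_rw [h3]
  calc ∑ i, ‖M.mulVec x' (f i)‖ ^ 2 = ∑ i ∈ Finset.univ.map f, ‖M.mulVec x' i‖ ^ 2 := by
        rw [Finset.sum_map]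
    _ ≤ _ := Finset.sum_le_univ_sum_of_nonneg fun i => by positivity

/-- Gelfand's formula. The norm of a power is continuous in the matrix, so this form of `ρ < 1`
suits the open-closed argument. -/
theorem exists_norm_pow_lt_one_of_spectralRadius_lt_one {A : Type*} [NormedRing A]
    [NormedAlgebra ℂ A] [CompleteSpace A] {a : A} (h : spectralRadius ℂ a < 1) :
    ∃ k : ℕ, ‖a ^ k‖ < 1 := by
  have h1 := spectrum.pow_nnnorm_pow_one_div_tendsto_nhds_spectralRadius a
  have h2 := (h1.eventually (gt_mem_nhds h)).and (Filter.eventually_ge_atTop 1)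
  obtain ⟨k, hk, hk1⟩ := h2.exists
  refine ⟨k, ?_⟩
  have hk0 : (0 : ℝ) < 1 / k := by positivity
  have h3 : ((‖a ^ k‖₊ : ENNReal)) < 1 := by
    by_contra hc
    exact absurd (ENNReal.one_le_rpow (not_lt.1 hc) hk0) (not_le.2 hk)
  have h4 : ‖a ^ k‖₊ < 1 := by exact_mod_cast h3
  exact_mod_cast h4

end NonnegMatrices

section NonnegInverse

variable {n : Type*} [Fintype n] [DecidableEq n]

theorem Matrix.exists_norm_pow_lt_one_of_dominated {W Y : Matrix n n ℝ} {E : Matrix n n ℝ}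
    (hE : ∀ i j, ‖E i j‖ ≤ W i j) (hW : ∀ i j, 0 ≤ W i j) (hY : ∀ i j, 0 ≤ Y i j)
    (h : Y * (1 - W) = 1) : ∃ k : ℕ, ‖E ^ k‖ < 1 := by
  have hb := Matrix.norm_pow_apply_le_of_dominated (Function.Embedding.refl n) hE hW
  have ht : Filter.Tendsto (fun k : ℕ => E ^ k) Filter.atTop (nhds 0) := by
    refine tendsto_pi_nhds.2 fun i => tendsto_pi_nhds.2 fun j => ?_
    exact squeeze_zero_norm (fun k => hb k i j)
      (Matrix.hasSum_pow_apply_of_nonneg hW hY h i j).summable.tendsto_atTop_zero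
  have h0 := ht.norm
  rw [norm_zero] at h0
  exact (h0.eventually (gt_mem_nhds one_pos)).exists

theorem Matrix.inv_one_sub_nonneg_of_le {W Y : Matrix n n ℝ} {E : Matrix n n ℝ}
    (hE0 : ∀ i j, 0 ≤ E i j) (hE : ∀ i j, E i j ≤ W i j) (hY : ∀ i j, 0 ≤ Y i j)
    (h : Y * (1 - W) = 1) : IsUnit (1 - E) ∧ ∀ i j, 0 ≤ (1 - E)⁻¹ i j := by
  have hW : ∀ i j, 0 ≤ W i j := fun i j => (hE0 i j).trans (hE i j)
  have hE' : ∀ i j, ‖E i j‖ ≤ W i j := fun i j => by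
    rw [Real.norm_of_nonneg (hE0 i j)]; exact hE i j
  have hu := (Matrix.isUnit_one_sub_of_dominated (Function.Embedding.refl n) hE' hW hY h).1
  obtain ⟨k, hk⟩ := Matrix.exists_norm_pow_lt_one_of_dominated hE' hW hY h
  exact ⟨hu, Matrix.nonneg_of_norm_pow_lt_one hE0
    (Matrix.nonsing_inv_mul _ ((Matrix.isUnit_iff_isUnit_det _).1 hu)) hk⟩

end NonnegInverse

/-! ### The algebraic identities behind cyclic reduction -/

section CyclicReductionAlgebra

variable {F R : Type*} [Field F] [Ring R] [Algebra F R]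

/-- With `v = u a + z c` the product telescopes to `K - v k v`, and `u z = 1` makes the mixed terms
constant. For `u = z⁻¹` this factors the next symbol at `z²` through the current one at `z` and
`-z`. -/
theorem mul_inv_mul_eq_cyclicReduction {K k a c : R} (hK : K * k = 1) (hk : k * K = 1) {u z : F}
    (huz : u * z = 1) :
    (K - u • a - z • c) * k * (K + u • a + z • c)
      = K - (a * k * c + c * k * a) - u ^ 2 • (a * k * a) - z ^ 2 • (c * k * c) := by
  have h1 : ∀ v : R, (K - v) * k * (K + v) = K - v * k * v := by
    intro v
    have : (K - v) * k * (K + v) = K * k * K + K * k * v - v * (k * K) - v * k * v := by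
      noncomm_ring
    rw [this, hK, hk]
    noncomm_ring
  have hzu : z * u = 1 := by rw [mul_comm]; exact huz
  rw [sub_sub, add_assoc, h1]
  simp only [add_mul, mul_add, smul_mul_assoc, mul_smul_comm, smul_add, smul_smul, huz, hzu,
    one_smul]
  rw [pow_two, pow_two]
  abel

/-- The inverse of `P K⁻¹ Q` is `Q⁻¹ K P⁻¹ = ½ Q⁻¹ (P + Q) P⁻¹ = ½ (P⁻¹ + Q⁻¹)`. -/
theorem half_add_mul_mul_mul_eq_one {K k P Q X Y : R} (hK : K * k = 1) (hPQ : P + Q = (2 : F) • K)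
    (hX : X * P = 1) (hY : Y * Q = 1) (h2 : (2 : F) ≠ 0) :
    ((2 : F)⁻¹ • (X + Y)) * (P * k * Q) = 1 := by
  have hP : P = (2 : F) • K - Q := eq_sub_of_add_eq hPQ
  have h1 : Y * P = (2 : F) • (Y * K) - 1 := by
    rw [hP, mul_sub, hY, mul_smul_comm]
  have h3 : (X + Y) * (P * k * Q) = (2 : F) • (1 : R) := by
    calc (X + Y) * (P * k * Q) = (X * P + Y * P) * k * Q := by noncomm_ring
      _ = ((2 : F) • (Y * K)) * k * Q := by rw [hX, h1]; congr 2; abel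
      _ = (2 : F) • (Y * (K * k) * Q) := by
          simp only [smul_mul_assoc, mul_assoc]
      _ = (2 : F) • (1 : R) := by rw [hK, mul_one, hY]
  rw [smul_mul_assoc, h3, smul_smul, inv_mul_cancel₀ h2, one_smul]

end CyclicReductionAlgebra

/-! ### The symbol at positive reals, and the iterates of cyclic reduction -/

namespace CRCoeffs

variable {m : ℕ}

/-- The real matrix `r⁻¹ A₋₁ + A₀ + r A₁`. -/
noncomputable def iter (A : CRCoeffs m) (r : ℝ) : Matrix (Fin m) (Fin m) ℝ :=
  r⁻¹ • A.neg + A.zero + r • A.pos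

/-- The three coefficients have nonnegative entries. -/
structure Nonneg (A : CRCoeffs m) : Prop where
  neg : ∀ i j, 0 ≤ A.neg i j
  zero : ∀ i j, 0 ≤ A.zero i j
  pos : ∀ i j, 0 ≤ A.pos i j

theorem phi_ofReal (A : CRCoeffs m) (r : ℝ) :
    A.phi (r : ℂ) = (1 - A.iter r).map Complex.ofReal := by
  ext i j
  simp only [phi, iter, Matrix.sub_apply, Matrix.add_apply, Matrix.neg_apply, Matrix.smul_apply,
    Matrix.map_apply, Matrix.one_apply, smul_eq_mul]
  split_ifs <;> push_cast <;> ring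

theorem one_sub_phi (A : CRCoeffs m) (z : ℂ) :
    1 - A.phi z = z⁻¹ • A.neg.map Complex.ofReal + A.zero.map Complex.ofReal
      + z • A.pos.map Complex.ofReal := by
  rw [phi]
  abel

theorem Nonneg.iter_nonneg {A : CRCoeffs m} (hA : A.Nonneg) {r : ℝ} (hr : 0 ≤ r) (i j : Fin m) :
    0 ≤ A.iter r i j := by
  have h1 := hA.neg i j
  have h2 := hA.zero i j
  have h3 := hA.pos i j
  simp only [iter, Matrix.add_apply, Matrix.smul_apply, smul_eq_mul]
  positivity

theorem Nonneg.norm_one_sub_phi_le {A : CRCoeffs m} (hA : A.Nonneg) (z : ℂ) (i j : Fin m) :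
    ‖(1 - A.phi z) i j‖ ≤ A.iter ‖z‖ i j := by
  rw [one_sub_phi]
  simp only [iter, Matrix.add_apply, Matrix.smul_apply, smul_eq_mul, Matrix.map_apply]
  refine (norm_add₃_le).trans (le_of_eq ?_)
  simp [abs_of_nonneg (hA.neg i j), abs_of_nonneg (hA.zero i j), abs_of_nonneg (hA.pos i j)]

theorem det_phi_ofReal (A : CRCoeffs m) (r : ℝ) :
    (A.phi (r : ℂ)).det = (((1 - A.iter r).det : ℝ) : ℂ) := by
  rw [phi_ofReal]
  exact (RingHom.map_det Complex.ofRealHom _).symm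

theorem inv_phi_ofReal (A : CRCoeffs m) {r : ℝ} (hr : (A.phi (r : ℂ)).det ≠ 0) :
    (A.phi (r : ℂ))⁻¹ = ((1 - A.iter r)⁻¹).map Complex.ofReal := by
  have h0 : IsUnit (1 - A.iter r).det := by
    rw [det_phi_ofReal] at hr
    exact IsUnit.mk0 _ (by exact_mod_cast hr)
  refine Matrix.inv_eq_left_inv ?_
  rw [phi_ofReal]
  have h1 := congrArg (fun M => Matrix.map M Complex.ofReal) (Matrix.nonsing_inv_mul _ h0)
  rw [show (Complex.ofReal : ℝ → ℂ) = ⇑Complex.ofRealHom from rfl] at h1 ⊢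
  rw [Matrix.map_mul, Matrix.map_one _ (map_zero _) (map_one _)] at h1
  exact h1

/-- The set of `r` at which some power of `A.iter r` has norm below one is open and closed in the
interval and contains `1`. For a nonnegative matrix this property is equivalent to nonnegativity of
`(1 - A.iter r)⁻¹`: the first form is an open condition, the second a closed one. -/
theorem Nonneg.inv_one_sub_iter_nonneg {A : CRCoeffs m} (hA : A.Nonneg) {t : ℝ} (ht : 1 < t)
    (hdet : ∀ r ∈ Set.Ioo t⁻¹ t, (1 - A.iter r).det ≠ 0)
    (hrho : spectralRadius ℂ (1 - A.phi 1) < 1) :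
    ∀ r ∈ Set.Ioo t⁻¹ t, ∀ i j, 0 ≤ (1 - A.iter r)⁻¹ i j := by
  have ht0 : 0 < t := by linarith
  have hti : t⁻¹ < 1 := inv_lt_one_of_one_lt₀ ht
  have hr0 : ∀ r ∈ Set.Ioo t⁻¹ t, 0 < r := fun r hr => lt_trans (by positivity) hr.1
  have hmul : ∀ r ∈ Set.Ioo t⁻¹ t, (1 - A.iter r)⁻¹ * (1 - A.iter r) = 1 := fun r hr =>
    Matrix.nonsing_inv_mul _ (IsUnit.mk0 _ (hdet r hr))
  have hcont : ∀ r ∈ Set.Ioo t⁻¹ t, ContinuousAt A.iter r := by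
    intro r hr
    have : r ≠ 0 := (hr0 r hr).ne'
    unfold iter
    fun_prop (disch := assumption)
  set u : Set ℝ := {r | r ∈ Set.Ioo t⁻¹ t ∧ ∃ k : ℕ, ‖A.iter r ^ k‖ < 1} with hu
  have hunn : ∀ r ∈ u, ∀ i j, 0 ≤ (1 - A.iter r)⁻¹ i j := by
    rintro r ⟨hr, k, hk⟩
    exact Matrix.nonneg_of_norm_pow_lt_one (hA.iter_nonneg (hr0 r hr).le) (hmul r hr) hk
  have hsub : Set.Ioo t⁻¹ t ⊆ u := by
    refine isPreconnected_Ioo.subset_of_closure_inter_subset ?_ ?_ ?_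
    · rw [isOpen_iff_mem_nhds]
      rintro r ⟨hr, k, hk⟩
      have h1 : ContinuousAt (fun s => ‖A.iter s ^ k‖) r := ((hcont r hr).pow k).norm
      filter_upwards [isOpen_Ioo.mem_nhds hr, h1.eventually (gt_mem_nhds hk)] with s hs hs'
      exact ⟨hs, k, hs'⟩
    · refine ⟨1, ⟨hti, ht⟩, ⟨hti, ht⟩, ?_⟩
      obtain ⟨k, hk⟩ := exists_norm_pow_lt_one_of_spectralRadius_lt_one hrho
      refine ⟨k, lt_of_le_of_lt (Matrix.norm_le_norm_map_ofReal _) ?_⟩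
      have h1 : 1 - A.phi 1 = (A.iter 1).map Complex.ofReal := by
        rw [one_sub_phi]
        ext i j
        simp [iter]
      rw [h1] at hk
      rw [show (Complex.ofReal : ℝ → ℂ) = ⇑Complex.ofRealHom from rfl] at hk ⊢
      rwa [Matrix.map_pow]
    -- At a limit point the inverse still exists and, by continuity, is still nonnegative; this
    -- bounds the Neumann series and forces the powers to tend to zero.
    · rintro r ⟨hrc, hr⟩
      have hY : ∀ i j, 0 ≤ (1 - A.iter r)⁻¹ i j := by
        intro i j
        have hunit : IsUnit (1 - A.iter r) :=
          (Matrix.isUnit_iff_isUnit_det _).2 (IsUnit.mk0 _ (hdet r hr))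
        have h1 : ContinuousAt (fun s => (1 - A.iter s)⁻¹) r := by
          simp_rw [Matrix.nonsing_inv_eq_ringInverse]
          obtain ⟨v, hv⟩ := hunit
          have h2 : ContinuousAt Ring.inverse (1 - A.iter r) := by
            rw [← hv]
            exact NormedRing.inverse_continuousAt v
          exact ContinuousAt.comp (f := fun s => 1 - A.iter s) h2
            (continuousAt_const.sub (hcont r hr))
        have h2 : ContinuousAt (fun s => (1 - A.iter s)⁻¹ i j) r :=
          ContinuousAt.comp (f := fun s => (1 - A.iter s)⁻¹)
            (g := fun M : Matrix (Fin m) (Fin m) ℝ => M i j)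
            (continuous_apply_apply i j).continuousAt h1
        have h3 := h2.continuousWithinAt.mem_closure (s := u) (t := Set.Ici 0) hrc
          (fun s hs => hunn s hs i j)
        rwa [isClosed_Ici.closure_eq] at h3
      refine ⟨hr, ?_⟩
      have hW := hA.iter_nonneg (hr0 r hr).le
      exact Matrix.exists_norm_pow_lt_one_of_dominated (W := A.iter r)
        (fun i j => by rw [Real.norm_of_nonneg (hW i j)]) hW hY (hmul r hr)
  exact fun r hr => hunn r (hsub hr)

/-- The coefficients are nonnegative and `1 - (A₋₁ + A₀ + A₁)` has a nonnegative inverse. -/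
structure Subcritical (A : CRCoeffs m) : Prop extends A.Nonneg where
  exists_inv : ∃ Y : Matrix (Fin m) (Fin m) ℝ, (∀ i j, 0 ≤ Y i j) ∧ Y * (1 - A.iter 1) = 1

theorem Subcritical.isUnit_phi {A : CRCoeffs m} (hA : A.Subcritical) {z : ℂ} (hz : ‖z‖ = 1) :
    IsUnit (A.phi z) := by
  obtain ⟨Y, hY, h⟩ := hA.exists_inv
  have := (Matrix.isUnit_one_sub_of_dominated (E := 1 - A.phi z) (Function.Embedding.refl _)
    (fun i j => hz ▸ hA.norm_one_sub_phi_le z i j) (hA.iter_nonneg zero_le_one) hY h).1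
  rwa [sub_sub_cancel] at this

theorem Subcritical.isUnit_one_sub_zero {A : CRCoeffs m} (hA : A.Subcritical) :
    IsUnit (1 - A.zero) ∧ ∀ i j, 0 ≤ (1 - A.zero)⁻¹ i j := by
  obtain ⟨Y, hY, h⟩ := hA.exists_inv
  refine Matrix.inv_one_sub_nonneg_of_le hA.zero (fun i j => ?_) hY h
  have h1 := hA.neg i j
  have h3 := hA.pos i j
  simp only [iter, Matrix.add_apply, Matrix.smul_apply, smul_eq_mul]
  linarith

theorem zero_sub_one_inv {A : CRCoeffs m} (h : IsUnit (1 - A.zero)) :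
    (A.zero - 1)⁻¹ = -(1 - A.zero)⁻¹ := by
  refine Matrix.inv_eq_left_inv ?_
  rw [← neg_sub 1 A.zero, neg_mul_neg]
  exact Matrix.nonsing_inv_mul _ ((Matrix.isUnit_iff_isUnit_det _).1 h)

theorem crStep_neg_eq {A : CRCoeffs m} (h : IsUnit (1 - A.zero)) :
    A.crStep.neg = A.neg * (1 - A.zero)⁻¹ * A.neg := by
  simp [crStep, zero_sub_one_inv h]

theorem crStep_pos_eq {A : CRCoeffs m} (h : IsUnit (1 - A.zero)) :
    A.crStep.pos = A.pos * (1 - A.zero)⁻¹ * A.pos := by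
  simp [crStep, zero_sub_one_inv h]

theorem crStep_zero_eq {A : CRCoeffs m} (h : IsUnit (1 - A.zero)) :
    A.crStep.zero = A.zero + A.pos * (1 - A.zero)⁻¹ * A.neg
      + A.neg * (1 - A.zero)⁻¹ * A.pos := by
  simp [crStep, zero_sub_one_inv h]

/-- The inverse for the next step at `z = 1` is the mean of `φ(1)⁻¹` and `φ(-1)⁻¹`. The second is
dominated entrywise by the first, so the mean is nonnegative. -/
theorem Subcritical.crStep {A : CRCoeffs m} (hA : A.Subcritical) : A.crStep.Subcritical := by
  obtain ⟨hu, hk⟩ := hA.isUnit_one_sub_zero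
  have hdet := (Matrix.isUnit_iff_isUnit_det _).1 hu
  have hmm := fun {X Y : Matrix (Fin m) (Fin m) ℝ} (hX : ∀ i j, 0 ≤ X i j) (hY : ∀ i j, 0 ≤ Y i j)
    => Matrix.mul_apply_nonneg hX hY
  refine ⟨⟨?_, ?_, ?_⟩, ?_⟩
  · rw [crStep_neg_eq hu]
    exact hmm (hmm hA.neg hk) hA.neg
  · rw [crStep_zero_eq hu]
    exact fun i j => add_nonneg (add_nonneg (hA.zero i j) (hmm (hmm hA.pos hk) hA.neg i j))
      (hmm (hmm hA.neg hk) hA.pos i j)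
  · rw [crStep_pos_eq hu]
    exact hmm (hmm hA.pos hk) hA.pos
  · obtain ⟨Y, hY, h⟩ := hA.exists_inv
    have hW := hA.iter_nonneg zero_le_one
    -- `A.zero - A.neg - A.pos` is the value at `z = -1` of `1 - φ(z)`.
    obtain ⟨hQu, hQ⟩ := Matrix.isUnit_one_sub_of_dominated (E := A.zero - A.neg - A.pos)
      (Function.Embedding.refl _) (W := A.iter 1) (fun i j => by
        have h1 := hA.neg i j
        have h2 := hA.zero i j
        have h3 := hA.pos i j
        simp only [iter, Matrix.add_apply, Matrix.smul_apply, smul_eq_mul, Matrix.sub_apply,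
          Function.Embedding.refl_apply, Real.norm_eq_abs]
        rw [abs_le]
        constructor <;> linarith) hW hY h
    set Q := 1 - (A.zero - A.neg - A.pos) with hQdef
    have hQinv : Q⁻¹ * Q = 1 :=
      Matrix.nonsing_inv_mul _ ((Matrix.isUnit_iff_isUnit_det _).1 hQu)
    refine ⟨(2 : ℝ)⁻¹ • (Y + Q⁻¹), fun i j => ?_, ?_⟩
    · have := (abs_le.1 (hQ i j)).1
      simp only [Function.Embedding.refl_apply] at this
      simp only [Matrix.smul_apply, Matrix.add_apply, smul_eq_mul]
      linarith
    · have key := mul_inv_mul_eq_cyclicReduction (F := ℝ) (a := A.neg) (c := A.pos)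
        (Matrix.mul_nonsing_inv _ hdet) (Matrix.nonsing_inv_mul _ hdet) (mul_one (1 : ℝ))
      have h1 : 1 - A.crStep.iter 1 = (1 - A.iter 1) * (1 - A.zero)⁻¹ * Q := by
        rw [iter, crStep_neg_eq hu, crStep_pos_eq hu, crStep_zero_eq hu]
        simp only [one_smul, one_pow] at key
        have e1 : 1 - A.iter 1 = 1 - A.zero - A.neg - A.pos := by
          simp only [iter, inv_one, one_smul]; abel
        have e2 : Q = 1 - A.zero + A.neg + A.pos := by rw [hQdef]; abel
        rw [e1, e2, key]
        simp only [inv_one, one_smul]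
        abel
      rw [h1]
      refine half_add_mul_mul_mul_eq_one (F := ℝ) (Matrix.mul_nonsing_inv _ hdet) ?_ h hQinv
        two_ne_zero
      simp only [iter, inv_one, one_smul, hQdef, two_smul]
      abel

theorem phi_crStep_sq {A : CRCoeffs m} (hu : IsUnit (1 - A.zero)) {z : ℂ} (hz : z ≠ 0) :
    A.crStep.phi (z ^ 2)
      = A.phi z * ((1 - A.zero)⁻¹).map Complex.ofRealHom * A.phi (-z) := by
  have hdet := (Matrix.isUnit_iff_isUnit_det _).1 hu
  have hK := congrArg (fun M => Matrix.map M Complex.ofRealHom) (Matrix.mul_nonsing_inv _ hdet)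
  have hk := congrArg (fun M => Matrix.map M Complex.ofRealHom) (Matrix.nonsing_inv_mul _ hdet)
  simp only [Matrix.map_mul] at hK hk
  rw [Matrix.map_one _ (map_zero _) (map_one _)] at hK hk
  have key := mul_inv_mul_eq_cyclicReduction (a := A.neg.map Complex.ofRealHom)
    (c := A.pos.map Complex.ofRealHom) hK hk (inv_mul_cancel₀ hz)
  have hKe : (1 - A.zero).map Complex.ofRealHom = 1 - A.zero.map Complex.ofRealHom := by
    rw [Matrix.map_sub _ (map_sub Complex.ofRealHom), Matrix.map_one _ (map_zero _) (map_one _)]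
  have e1 : A.phi z = (1 - A.zero).map Complex.ofRealHom - z⁻¹ • A.neg.map Complex.ofRealHom
      - z • A.pos.map Complex.ofRealHom := by
    rw [hKe, phi]
    simp only [show (Complex.ofReal : ℝ → ℂ) = ⇑Complex.ofRealHom from rfl]
    abel
  have e2 : A.phi (-z) = (1 - A.zero).map Complex.ofRealHom + z⁻¹ • A.neg.map Complex.ofRealHom
      + z • A.pos.map Complex.ofRealHom := by
    rw [hKe, phi]
    simp only [show (Complex.ofReal : ℝ → ℂ) = ⇑Complex.ofRealHom from rfl, inv_neg, neg_smul]
    abel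
  rw [e1, e2, key, hKe, phi, crStep_neg_eq hu, crStep_pos_eq hu, crStep_zero_eq hu]
  simp only [show (Complex.ofReal : ℝ → ℂ) = ⇑Complex.ofRealHom from rfl, Matrix.map_mul,
    Matrix.map_add _ (map_add Complex.ofRealHom), inv_pow]
  abel

theorem Subcritical.inv_phi_crStep_sq {A : CRCoeffs m} (hA : A.Subcritical) {z : ℂ}
    (hz : ‖z‖ = 1) :
    (A.crStep.phi (z ^ 2))⁻¹ = (2 : ℂ)⁻¹ • ((A.phi z)⁻¹ + (A.phi (-z))⁻¹) := by
  have hu := hA.isUnit_one_sub_zero.1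
  have hdet := (Matrix.isUnit_iff_isUnit_det _).1 hu
  have hz0 : z ≠ 0 := norm_pos_iff.1 (hz ▸ one_pos)
  refine Matrix.inv_eq_left_inv ?_
  rw [phi_crStep_sq hu hz0]
  have hK := congrArg (fun M => Matrix.map M Complex.ofRealHom) (Matrix.mul_nonsing_inv _ hdet)
  simp only [Matrix.map_mul] at hK
  rw [Matrix.map_one _ (map_zero _) (map_one _)] at hK
  refine half_add_mul_mul_mul_eq_one hK ?_
    (Matrix.nonsing_inv_mul _ ((Matrix.isUnit_iff_isUnit_det _).1 (hA.isUnit_phi hz)))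
    (Matrix.nonsing_inv_mul _ ((Matrix.isUnit_iff_isUnit_det _).1
      (hA.isUnit_phi (by rwa [norm_neg])))) two_ne_zero
  rw [phi, phi, Matrix.map_sub _ (map_sub Complex.ofRealHom),
    Matrix.map_one _ (map_zero _) (map_one _)]
  simp only [show (Complex.ofReal : ℝ → ℂ) = ⇑Complex.ofRealHom from rfl, inv_neg, neg_smul,
    two_smul]
  abel

theorem Subcritical.cr {A : CRCoeffs m} (hA : A.Subcritical) (h : ℕ) : (A.cr h).Subcritical := by
  induction h with
  | zero => exact hA
  | succ h ih => exact ih.crStep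

/-- After `h` steps of cyclic reduction the inverse of the symbol is an average over the
`2 ^ h`-th roots of unity. -/
theorem Subcritical.inv_phi_cr_pow {A : CRCoeffs m} (hA : A.Subcritical) (h : ℕ) {ζ w : ℂ}
    (hζ : IsPrimitiveRoot ζ (2 ^ h)) (hw : ‖w‖ = 1) :
    ((A.cr h).phi (w ^ 2 ^ h))⁻¹
      = ((2 ^ h : ℕ) : ℂ)⁻¹ • ∑ j ∈ Finset.range (2 ^ h), (A.phi (ζ ^ j * w))⁻¹ := by
  induction h generalizing ζ w with
  | zero => simp [CRCoeffs.cr]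
  | succ h ih =>
    have hN : 0 < 2 ^ (h + 1) := by positivity
    have hζn : ‖ζ‖ = 1 := hζ.norm'_eq_one hN.ne'
    have hsq : IsPrimitiveRoot (ζ ^ 2) (2 ^ h) := hζ.pow hN (pow_succ' 2 h)
    -- Hence `-(w ^ 2 ^ h) = (ζ w) ^ 2 ^ h`: the averages over powers of `ζ ^ 2` started at `w` and
    -- at `ζ w` supply the even and the odd exponents of `ζ`.
    have hneg : ζ ^ 2 ^ h = -1 := by
      have h1 : (ζ ^ 2 ^ h) ^ 2 = 1 := by rw [← pow_mul, ← pow_succ, hζ.pow_eq_one]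
      rcases mul_self_eq_one_iff.1 ((pow_two _).symm.trans h1) with h2 | h2
      · exact absurd h2 (hζ.pow_ne_one_of_pos_of_lt (by positivity)
          (Nat.pow_lt_pow_right one_lt_two (Nat.lt_succ_self h)))
      · exact h2
    have h1 : w ^ 2 ^ (h + 1) = (w ^ 2 ^ h) ^ 2 := by rw [← pow_mul, ← pow_succ]
    have h2 : -(w ^ 2 ^ h) = (ζ * w) ^ 2 ^ h := by rw [mul_pow, hneg, neg_one_mul]
    have hrange : ∀ (N : ℕ) (g : ℕ → Matrix (Fin m) (Fin m) ℂ), ∑ j ∈ Finset.range (N * 2), g j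
        = ∑ j ∈ Finset.range N, g (2 * j) + ∑ j ∈ Finset.range N, g (2 * j + 1) := by
      intro N g
      induction N with
      | zero => simp
      | succ N ihN =>
        rw [add_mul, one_mul, Finset.sum_range_succ, Finset.sum_range_succ, ihN,
          Finset.sum_range_succ, Finset.sum_range_succ, mul_comm N 2]
        abel
    rw [h1, CRCoeffs.cr, (hA.cr h).inv_phi_crStep_sq (by rw [norm_pow, hw, one_pow]), h2,
      ih hsq hw, ih hsq (by rw [norm_mul, hζn, hw, one_mul]), pow_succ 2 h, hrange, ← smul_add,
      smul_smul]
    congr 1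
    · push_cast
      rw [mul_inv, mul_comm]
    · congr 1
      · exact Finset.sum_congr rfl fun j _ => by rw [pow_mul]
      · exact Finset.sum_congr rfl fun j _ => by
          rw [pow_succ ζ (2 * j), pow_mul, mul_assoc]

end CRCoeffs

/-! ### Laurent coefficients and Parseval's identity on an annulus -/

section Laurent

/-- The `n`-th Laurent coefficient of a scalar function on an annulus around the unit circle. -/
noncomputable def scalarLaurentCoeff (f : ℂ → ℂ) (n : ℤ) : ℂ :=
  (2 * (Real.pi : ℂ) * Complex.I)⁻¹ * ∮ w in C(0, 1), w ^ (-n - 1) * f w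

/-- Cauchy's theorem on the closed annulus between the two circles. It lets the coefficients,
defined on the unit circle, be computed on any circle in the annulus. -/
theorem circleIntegral_zpow_mul_eq {t : ℝ} (ht : 1 < t) {f : ℂ → ℂ}
    (hf : ∀ z ∈ annulus t, DifferentiableAt ℂ f z) {r : ℝ} (hr : r ∈ Set.Ioo t⁻¹ t) (k : ℤ) :
    (∮ w in C(0, r), w ^ k * f w) = ∮ w in C(0, 1), w ^ k * f w := by
  have ht0 : 0 < t := by linarith
  have hti : t⁻¹ < 1 := inv_lt_one_of_one_lt₀ ht
  have key : ∀ a b : ℝ, a ∈ Set.Ioo t⁻¹ t → b ∈ Set.Ioo t⁻¹ t → a ≤ b →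
      (∮ w in C(0, b), w ^ k * f w) = ∮ w in C(0, a), w ^ k * f w := by
    intro a b ha hb hab
    have ha0 : 0 < a := lt_trans (by positivity) ha.1
    have hd : ∀ z : ℂ, a ≤ ‖z‖ → ‖z‖ ≤ b → DifferentiableAt ℂ (fun w => w ^ k * f w) z := by
      intro z hz1 hz2
      have hz0 : z ≠ 0 := norm_pos_iff.1 (ha0.trans_le hz1)
      exact (differentiableAt_zpow.2 (Or.inl hz0)).mul
        (hf z ⟨ha.1.trans_le hz1, hz2.trans_lt hb.2⟩)
    refine Complex.circleIntegral_eq_of_differentiable_on_annulus_off_countable ha0 hab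
      Set.countable_empty ?_ ?_
    · rintro z ⟨hz1, hz2⟩
      rw [mem_closedBall_zero_iff] at hz1
      rw [mem_ball_zero_iff, not_lt] at hz2
      exact (hd z hz2 hz1).continuousAt.continuousWithinAt
    · rintro z ⟨⟨hz1, hz2⟩, -⟩
      rw [mem_ball_zero_iff] at hz1
      rw [mem_closedBall_zero_iff, not_le] at hz2
      exact hd z hz2.le hz1.le
  rcases le_total r 1 with h | h
  · exact (key r 1 hr ⟨hti, ht⟩ h).symm
  · exact key 1 r ⟨hti, ht⟩ hr h

/-- The substitution `w = r e^{iθ}`; the factor `r ^ n` is the source of the weights in Parseval's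
identity. -/
theorem fourierCoeffOn_circleMap (f : ℂ → ℂ) {r : ℝ} (hr : 0 < r) (n : ℤ) :
    fourierCoeffOn Real.two_pi_pos (fun θ => f (circleMap 0 r θ)) n
      = (r : ℂ) ^ n * ((2 * (Real.pi : ℂ) * Complex.I)⁻¹ * ∮ w in C(0, r), w ^ (-n - 1) * f w) := by
  rw [fourierCoeffOn_eq_integral, circleIntegral]
  have hr0 : (r : ℂ) ≠ 0 := by exact_mod_cast hr.ne'
  have h1 : ∀ θ : ℝ, deriv (circleMap 0 r) θ • (circleMap 0 r θ ^ (-n - 1) * f (circleMap 0 r θ))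
      = (Complex.I * (r : ℂ) ^ (-n)) *
        ((fourier (-n) (θ : AddCircle (2 * Real.pi - 0))) • f (circleMap 0 r θ)) := by
    intro θ
    have hc : circleMap 0 r θ ≠ 0 := by simpa using hr.ne'
    rw [deriv_circleMap, smul_eq_mul, smul_eq_mul, fourier_coe_apply]
    have h2 : circleMap 0 r θ * circleMap 0 r θ ^ (-n - 1) = circleMap 0 r θ ^ (-n) := by
      rw [← zpow_one_add₀ hc]
      congr 1
      ring
    have h3 : circleMap 0 r θ ^ (-n) = (r : ℂ) ^ (-n) *
        Complex.exp (2 * Real.pi * Complex.I * ((-n : ℤ) : ℂ) * θ / ((2 * Real.pi - 0 : ℝ) : ℂ)) := by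
      rw [circleMap_zero, mul_zpow, ← Complex.exp_int_mul]
      congr 2
      have : (Real.pi : ℂ) ≠ 0 := by exact_mod_cast Real.pi_ne_zero
      push_cast
      rw [sub_zero]
      field_simp
    calc _ = Complex.I * (circleMap 0 r θ * circleMap 0 r θ ^ (-n - 1)) * f (circleMap 0 r θ) := by
          ring
      _ = _ := by rw [h2, h3]; ring
  simp_rw [h1]
  rw [intervalIntegral.integral_const_mul]
  have h4 : (r : ℂ) ^ n * (r : ℂ) ^ (-n) = 1 := by
    rw [← zpow_add₀ hr0, add_neg_cancel, zpow_zero]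
  have h5 : (1 / (2 * Real.pi - 0) : ℝ) • (∫ x in (0:ℝ)..2 * Real.pi,
      (fourier (-n) (x : AddCircle (2 * Real.pi - 0))) • f (circleMap 0 r x))
      = (2 * (Real.pi : ℂ))⁻¹ * (∫ x in (0:ℝ)..2 * Real.pi,
      (fourier (-n) (x : AddCircle (2 * Real.pi - 0))) • f (circleMap 0 r x)) := by
    rw [Complex.real_smul]
    push_cast
    rw [sub_zero, one_div]
  rw [h5]
  have h6 : (2 * (Real.pi : ℂ) * Complex.I)⁻¹ * Complex.I = (2 * (Real.pi : ℂ))⁻¹ := by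
    rw [mul_inv, mul_assoc, inv_mul_cancel₀ Complex.I_ne_zero, mul_one]
  linear_combination (-(2 * (Real.pi : ℂ))⁻¹ * ((∫ x in (0:ℝ)..2 * Real.pi,
      (fourier (-n) (x : AddCircle (2 * Real.pi - 0))) • f (circleMap 0 r x)))) * h4
      - (r : ℂ) ^ n * (r : ℂ) ^ (-n) * ((∫ x in (0:ℝ)..2 * Real.pi,
      (fourier (-n) (x : AddCircle (2 * Real.pi - 0))) • f (circleMap 0 r x))) * h6

theorem continuous_comp_circleMap {t : ℝ} {f : ℂ → ℂ}
    (hf : ∀ z ∈ annulus t, DifferentiableAt ℂ f z) {r : ℝ} (hr0 : 0 < r)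
    (hr : r ∈ Set.Ioo t⁻¹ t) : Continuous fun θ : ℝ => f (circleMap 0 r θ) := by
  rw [continuous_iff_continuousAt]
  intro θ
  refine ContinuousAt.comp (g := f) (hf _ ?_).continuousAt (continuous_circleMap 0 r).continuousAt
  simpa [annulus, abs_of_pos hr0] using hr

theorem hasSum_sq_scalarLaurentCoeff {t : ℝ} (ht : 1 < t) {f : ℂ → ℂ}
    (hf : ∀ z ∈ annulus t, DifferentiableAt ℂ f z) {r : ℝ} (hr : r ∈ Set.Ioo t⁻¹ t) :
    HasSum (fun n : ℤ => (r ^ n) ^ 2 * ‖scalarLaurentCoeff f n‖ ^ 2)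
      ((2 * Real.pi)⁻¹ * ∫ θ in (0:ℝ)..2 * Real.pi, ‖f (circleMap 0 r θ)‖ ^ 2) := by
  have hr0 : 0 < r := lt_trans (by positivity) hr.1
  have hc := continuous_comp_circleMap hf hr0 hr
  obtain ⟨C, hC⟩ := isCompact_Icc.exists_bound_of_continuousOn (s := Set.Icc 0 (2 * Real.pi))
    hc.continuousOn
  have hmem : MeasureTheory.MemLp (fun θ => f (circleMap 0 r θ)) 2
      (MeasureTheory.volume.restrict (Set.Ioc 0 (2 * Real.pi))) := by
    refine MeasureTheory.MemLp.of_bound hc.aestronglyMeasurable C ?_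
    refine (MeasureTheory.ae_restrict_iff' measurableSet_Ioc).2 (Filter.Eventually.of_forall ?_)
    exact fun θ hθ => hC θ ⟨hθ.1.le, hθ.2⟩
  have h1 := hasSum_sq_fourierCoeffOn Real.two_pi_pos hmem
  rw [sub_zero, smul_eq_mul] at h1
  refine h1.congr_fun fun n => ?_
  rw [fourierCoeffOn_circleMap f hr0, circleIntegral_zpow_mul_eq ht hf hr, norm_mul, mul_pow,
    scalarLaurentCoeff, norm_zpow, Complex.norm_real, Real.norm_of_nonneg hr0.le]

/-- The weight `t ^ (2 n) + t ^ (-2 n)`. -/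
noncomputable def laurentWeight (t : ℝ) (n : ℤ) : ℝ := (t ^ n) ^ 2 + (t⁻¹ ^ n) ^ 2

theorem sum_sq_scalarLaurentCoeff_le {t : ℝ} (ht : 1 < t) {ι : Type*} [Fintype ι]
    {f : ι → ℂ → ℂ} (hf : ∀ j, ∀ z ∈ annulus t, DifferentiableAt ℂ (f j) z) {K : ℝ}
    (hK : ∀ z ∈ annulus t, ∑ j, ‖f j z‖ ^ 2 ≤ K) {r : ℝ} (hr : r ∈ Set.Ioo t⁻¹ t)
    (s : Finset ℤ) :
    ∑ n ∈ s, (r ^ n) ^ 2 * ∑ j, ‖scalarLaurentCoeff (f j) n‖ ^ 2 ≤ K := by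
  have hr0 : 0 < r := lt_trans (by have : 0 < t := by linarith
                                   positivity) hr.1
  have h1 := hasSum_sum (s := Finset.univ) fun j _ => hasSum_sq_scalarLaurentCoeff ht (hf j) hr
  simp_rw [← Finset.mul_sum] at h1
  refine (sum_le_hasSum s (fun n _ => by positivity) h1).trans ?_
  have hcont : ∀ j, Continuous fun θ : ℝ => ‖f j (circleMap 0 r θ)‖ ^ 2 := fun j =>
    (continuous_comp_circleMap (hf j) hr0 hr).norm.pow 2
  rw [← intervalIntegral.integral_finsetSum fun j _ => (hcont j).intervalIntegrable _ _]
  have h2 : ∫ θ in (0:ℝ)..2 * Real.pi, ∑ j, ‖f j (circleMap 0 r θ)‖ ^ 2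
      ≤ ∫ _ in (0:ℝ)..2 * Real.pi, K := by
    refine intervalIntegral.integral_mono_on Real.two_pi_pos.le
      ((continuous_finsetSum _ fun j _ => hcont j).intervalIntegrable _ _)
      intervalIntegrable_const fun θ _ => hK _ ?_
    simpa [annulus, abs_of_pos hr0] using hr
  rw [intervalIntegral.integral_const, sub_zero, smul_eq_mul] at h2
  calc _ ≤ (2 * Real.pi)⁻¹ * (2 * Real.pi * K) := by gcongr
    _ = K := by
      have := Real.pi_ne_zero
      field_simp

/-- Parseval's identity on the two boundary circles of an annulus. -/
theorem sum_laurentWeight_mul_sq_scalarLaurentCoeff_le {t : ℝ} (ht : 1 < t) {ι : Type*}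
    [Fintype ι] {f : ι → ℂ → ℂ} (hf : ∀ j, ∀ z ∈ annulus t, DifferentiableAt ℂ (f j) z) {K : ℝ}
    (hK : ∀ z ∈ annulus t, ∑ j, ‖f j z‖ ^ 2 ≤ K) (s : Finset ℤ) :
    ∑ n ∈ s, laurentWeight t n * ∑ j, ‖scalarLaurentCoeff (f j) n‖ ^ 2 ≤ 2 * K := by
  have ht0 : 0 < t := by linarith
  have hti : t⁻¹ < t := (inv_lt_one_of_one_lt₀ ht).trans ht
  have hcont : ContinuousAt
      (fun r : ℝ => ∑ n ∈ s, laurentWeight r n * ∑ j, ‖scalarLaurentCoeff (f j) n‖ ^ 2) t := by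
    unfold laurentWeight
    refine tendsto_finsetSum _ fun n _ => ?_
    have h1 : ContinuousAt (fun r : ℝ => r ^ n) t := continuousAt_zpow₀ t n (Or.inl ht0.ne')
    have h2 : ContinuousAt (fun r : ℝ => r⁻¹ ^ n) t :=
      (continuousAt_inv₀ ht0.ne').zpow₀ n (Or.inl (inv_ne_zero ht0.ne'))
    exact ((h1.pow 2).add (h2.pow 2)).mul continuousAt_const
  -- The boundary circles lie outside the open annulus. For finitely many terms they are reached by
  -- letting `r → t` from below, using the circles of radius `r` and `r⁻¹` together.
  refine le_of_tendsto (hcont.tendsto.mono_left (nhdsWithin_le_nhds (s := Set.Iio t))) ?_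
  filter_upwards [Ioo_mem_nhdsLT hti] with r hr
  have hr0 : 0 < r := lt_trans (by positivity) hr.1
  have hr' : r⁻¹ ∈ Set.Ioo t⁻¹ t :=
    ⟨(inv_lt_inv₀ ht0 hr0).2 hr.2, by simpa using (inv_lt_inv₀ hr0 (inv_pos.2 ht0)).2 hr.1⟩
  have h1 := sum_sq_scalarLaurentCoeff_le ht hf hK hr s
  have h2 := sum_sq_scalarLaurentCoeff_le ht hf hK hr' s
  simp only [laurentWeight, add_mul, Finset.sum_add_distrib]
  linarith

theorem norm_scalarLaurentCoeff_le {t : ℝ} (ht : 1 < t) {f : ℂ → ℂ}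
    (hf : ∀ z ∈ annulus t, DifferentiableAt ℂ f z) {K : ℝ}
    (hK : ∀ z ∈ annulus t, ‖f z‖ ^ 2 ≤ K) (n : ℤ) :
    ‖scalarLaurentCoeff f n‖ ≤ √(2 * K) * t⁻¹ ^ n.natAbs := by
  have ht0 : 0 < t := by linarith
  have h1 := sum_laurentWeight_mul_sq_scalarLaurentCoeff_le ht (ι := Unit) (f := fun _ => f)
    (fun _ => hf) (K := K) (by simpa using hK) {n}
  simp only [Finset.univ_unique, Finset.sum_const, Finset.card_singleton, one_smul,
    Finset.sum_singleton] at h1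
  have h2 : (t ^ n.natAbs) ^ 2 ≤ laurentWeight t n := by
    unfold laurentWeight
    rcases Int.natAbs_eq n with h | h
    · rw [h, Int.natAbs_natCast, zpow_natCast]
      exact le_add_of_nonneg_right (by positivity)
    · rw [h, Int.natAbs_neg, Int.natAbs_natCast, inv_zpow', neg_neg, zpow_natCast]
      exact le_add_of_nonneg_left (by positivity)
  have h3 : (t ^ n.natAbs * ‖scalarLaurentCoeff f n‖) ^ 2 ≤ 2 * K := by
    rw [mul_pow]
    exact (mul_le_mul_of_nonneg_right h2 (by positivity)).trans h1
  have h4 := Real.le_sqrt_of_sq_le h3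
  rw [inv_pow, ← div_eq_mul_inv, le_div_iff₀ (by positivity)]
  linarith

theorem summable_pow_natAbs {x : ℝ} (hx0 : 0 ≤ x) (hx : x < 1) :
    Summable fun n : ℤ => x ^ n.natAbs := by
  refine Summable.of_nat_of_neg ?_ ?_
  · simpa using summable_geometric_of_lt_one hx0 hx
  · simpa using summable_geometric_of_lt_one hx0 hx

/-- The Laurent expansion on the unit circle of a bounded analytic function on an annulus. -/
theorem hasSum_scalarLaurentCoeff {t : ℝ} (ht : 1 < t) {f : ℂ → ℂ}
    (hf : ∀ z ∈ annulus t, DifferentiableAt ℂ f z) {K : ℝ}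
    (hK : ∀ z ∈ annulus t, ‖f z‖ ^ 2 ≤ K) {w : ℂ} (hw : ‖w‖ = 1) :
    HasSum (fun n : ℤ => w ^ n * scalarLaurentCoeff f n) (f w) := by
  have ht0 : 0 < t := by linarith
  have hti : t⁻¹ < 1 := inv_lt_one_of_one_lt₀ ht
  have : Fact (0 < 2 * Real.pi) := ⟨Real.two_pi_pos⟩
  let g : C(AddCircle (2 * Real.pi), ℂ) := ⟨fun θ => f (AddCircle.toCircle θ), by
    rw [continuous_iff_continuousAt]
    intro θ
    refine ContinuousAt.comp (g := f) (hf _ ?_).continuousAt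
      (f := fun θ : AddCircle (2 * Real.pi) => ((AddCircle.toCircle θ : Circle) : ℂ))
      (continuous_subtype_val.comp AddCircle.continuous_toCircle).continuousAt
    exact ⟨by rwa [Circle.norm_coe], by rwa [Circle.norm_coe]⟩⟩
  have hg : ∀ θ : ℝ, g θ = f (circleMap 0 1 θ) := by
    intro θ
    change f _ = _
    congr 1
    rw [AddCircle.toCircle_apply_mk, Circle.coe_exp, circleMap_zero]
    have := Real.pi_ne_zero
    rw [div_self (by positivity)]
    simp
  have hcoef : ∀ n, fourierCoeff g n = scalarLaurentCoeff f n := by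
    intro n
    have h1 := fourierCoeffOn_circleMap f one_pos n
    rw [Complex.ofReal_one, one_zpow, one_mul] at h1
    rw [scalarLaurentCoeff, ← h1, fourierCoeff_eq_intervalIntegral g n 0,
      fourierCoeffOn_eq_integral]
    simp_rw [hg]
    simp only [zero_add, sub_zero, one_div]
    congr! 3
    all_goals rw [sub_zero]
  -- The coefficients decay geometrically, so the Fourier series converges pointwise to the
  -- function.
  have hsum : Summable (fourierCoeff g) := by
    refine Summable.of_norm_bounded ((summable_pow_natAbs (by positivity) hti).mul_left (√(2 * K)))
      fun n => ?_
    rw [hcoef]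
    exact norm_scalarLaurentCoeff_le ht hf hK n
  have h1 := has_pointwise_sum_fourier_series_of_summable hsum
    ((Complex.arg w : ℝ) : AddCircle (2 * Real.pi))
  have hwe : circleMap 0 1 (Complex.arg w) = w := by
    rw [circleMap_zero]
    simpa [hw] using Complex.norm_mul_exp_arg_mul_I w
  rw [hg, hwe] at h1
  refine h1.congr_fun fun n => ?_
  rw [hcoef, smul_eq_mul, mul_comm, fourier_coe_apply]
  congr 1
  conv_lhs => rw [← hwe, circleMap_zero, Complex.ofReal_one, one_mul, ← Complex.exp_int_mul]
  congr 1
  have : (Real.pi : ℂ) ≠ 0 := by exact_mod_cast Real.pi_ne_zero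
  push_cast
  field_simp

end Laurent

/-! ### Singular values, low rank approximation and rank inequalities -/

section SingularValues

/-- A singular value is at most the distance to any map of smaller rank. -/
theorem LinearMap.singularValues_le_of_finrank_range_le {𝕜 E F : Type*} [RCLike 𝕜]
    [NormedAddCommGroup E] [InnerProductSpace 𝕜 E] [FiniteDimensional 𝕜 E]
    [NormedAddCommGroup F] [InnerProductSpace 𝕜 F] [FiniteDimensional 𝕜 F]
    (T S : E →ₗ[𝕜] F) {i : ℕ} (hS : Module.finrank 𝕜 (LinearMap.range S) ≤ i) {c : ℝ}
    (hc : 0 ≤ c) (h : ∀ v, ‖T v - S v‖ ≤ c * ‖v‖) : T.singularValues i ≤ c := by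
  rcases Nat.lt_or_ge i (Module.finrank 𝕜 E) with hi | hi
  swap
  · rw [T.singularValues_of_finrank_le hi]
    exact hc
  set hT := T.isSymmetric_adjoint_comp_self
  set b := hT.eigenvectorBasis rfl with hb
  set u : Fin (i + 1) → E := fun j => b (Fin.castLE hi j) with hu
  have huo : Orthonormal 𝕜 u := b.orthonormal.comp _ (Fin.castLE_injective hi)
  set L : (Fin (i + 1) → 𝕜) →ₗ[𝕜] E := Fintype.linearCombination 𝕜 u with hL
  -- The `i + 1` leading right singular vectors of `T` span a space that `S`, of rank at most `i`,
  -- cannot map injectively. On a vector of this span killed by `S`, `T` expands by at least its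
  -- singular value number `i`.
  have hker : LinearMap.ker (S.rangeRestrict ∘ₗ L) ≠ ⊥ := by
    refine LinearMap.ker_ne_bot_of_finrank_lt ?_
    rw [Module.finrank_fin_fun]
    omega
  obtain ⟨a, ha, ha0⟩ := (Submodule.ne_bot_iff _).1 hker
  have hSa : S (L a) = 0 := by
    have := LinearMap.mem_ker.1 ha
    simpa [Subtype.ext_iff] using this
  have hLa : L a = ∑ j, a j • u j := Fintype.linearCombination_apply 𝕜 u a
  have hn1 : ‖L a‖ ^ 2 = ∑ j, ‖a j‖ ^ 2 := by
    rw [← inner_self_eq_norm_sq (𝕜 := 𝕜), hLa, huo.inner_sum, map_sum]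
    refine Finset.sum_congr rfl fun j _ => ?_
    rw [RCLike.conj_mul]
    norm_cast
  have hn2 : ‖T (L a)‖ ^ 2
      = ∑ j, hT.eigenvalues rfl (Fin.castLE hi j) * ‖a j‖ ^ 2 := by
    rw [← inner_self_eq_norm_sq (𝕜 := 𝕜), ← LinearMap.adjoint_inner_left]
    have h1 : LinearMap.adjoint T (T (L a))
        = ∑ j, ((hT.eigenvalues rfl (Fin.castLE hi j) : 𝕜) * a j) • u j := by
      change (LinearMap.adjoint T ∘ₗ T) (L a) = _
      rw [hLa, map_sum]
      refine Finset.sum_congr rfl fun j _ => ?_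
      rw [map_smul, hu, hb, hT.apply_eigenvectorBasis, smul_smul, mul_comm]
    rw [h1, hLa, huo.inner_sum, map_sum]
    refine Finset.sum_congr rfl fun j _ => ?_
    rw [map_mul (starRingEnd 𝕜), RCLike.conj_ofReal, mul_assoc, RCLike.conj_mul]
    norm_cast
  have hpos : 0 < ‖L a‖ := by
    have h1 : 0 < ‖L a‖ ^ 2 := by
      rw [hn1]
      obtain ⟨j, hj⟩ := Function.ne_iff.1 ha0
      exact Finset.sum_pos' (fun _ _ => by positivity)
        ⟨j, Finset.mem_univ _, by have := norm_pos_iff.2 hj; positivity⟩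
    exact lt_of_le_of_ne (norm_nonneg _) fun h0 => by rw [← h0] at h1; simp at h1
  have hle : T.singularValues i ^ 2 * ‖L a‖ ^ 2 ≤ ‖T (L a)‖ ^ 2 := by
    rw [hn1, hn2, T.sq_singularValues_of_lt rfl hi, Finset.mul_sum]
    refine Finset.sum_le_sum fun j _ => ?_
    refine mul_le_mul_of_nonneg_right (hT.eigenvalues_antitone rfl ?_) (by positivity)
    exact Nat.lt_succ_iff.1 j.2
  have h2 : T.singularValues i * ‖L a‖ ≤ c * ‖L a‖ := by
    have h3 := h (L a)
    rw [hSa, sub_zero] at h3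
    refine le_trans ?_ h3
    rw [← mul_pow] at hle
    exact (sq_le_sq₀ (mul_nonneg (T.singularValues_nonneg i) (norm_nonneg _)) (norm_nonneg _)).1 hle
  exact le_of_mul_le_mul_right h2 hpos

theorem Matrix.rank_eq_finrank_range_toEuclideanLin {r c : Type*} [Fintype r] [Fintype c]
    [DecidableEq c] (X : Matrix r c ℂ) :
    X.rank = Module.finrank ℂ (LinearMap.range (Matrix.toEuclideanLin X)) :=
  X.rank_eq_finrank_range_toLin (PiLp.basisFun 2 ℂ r) (PiLp.basisFun 2 ℂ c)

theorem sigma_le_of_rank_le {r c : Type*} [Fintype r] [Fintype c] [DecidableEq c] {s : ℕ}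
    {X K R : Matrix r c ℂ} (hX : X = K + R) (hK : K.rank ≤ s - 1) : sigma s X ≤ ‖R‖ := by
  refine LinearMap.singularValues_le_of_finrank_range_le _ (Matrix.toEuclideanLin K)
    (Matrix.rank_eq_finrank_range_toEuclideanLin K ▸ hK) (norm_nonneg _) fun v => ?_
  rw [hX, map_add, LinearMap.add_apply, add_sub_cancel_left]
  exact Matrix.l2_opNorm_mulVec R v

end SingularValues

section Rank

theorem Matrix.rank_add_le {r c K : Type*} [Fintype r] [Fintype c] [Field K] (X Y : Matrix r c K) :
    (X + Y).rank ≤ X.rank + Y.rank := by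
  rw [Matrix.rank, Matrix.rank, Matrix.rank, Matrix.mulVecLin_add]
  refine (Submodule.finrank_mono (LinearMap.range_add_le _ _)).trans ?_
  exact Submodule.finrank_add_le_finrank_add_finrank _ _

theorem Matrix.rank_sum_le {r c K ι : Type*} [Fintype r] [Fintype c] [Field K] (s : Finset ι)
    (X : ι → Matrix r c K) {b : ℕ} (h : ∀ i ∈ s, (X i).rank ≤ b) :
    (∑ i ∈ s, X i).rank ≤ s.card * b := by
  classical
  induction s using Finset.induction_on with
  | empty => simp
  | insert i s hi ih =>
    rw [Finset.sum_insert hi, Finset.card_insert_of_notMem hi, add_mul, one_mul, add_comm]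
    exact (Matrix.rank_add_le _ _).trans (add_le_add (ih fun j hj => h j (Finset.mem_insert_of_mem hj))
      (h i (Finset.mem_insert_self i s)))

theorem Matrix.rank_smul_le {r c K : Type*} [Fintype r] [Fintype c] [Field K] (a : K)
    (X : Matrix r c K) : (a • X).rank ≤ X.rank := by
  classical
  have : a • X = (a • (1 : Matrix r r K)) * X := by
    rw [Matrix.smul_mul, Matrix.one_mul]
  rw [this]
  exact Matrix.rank_mul_le_right _ _

theorem Matrix.exists_eq_mul_of_rank {r c K : Type*} [Fintype r] [Fintype c] [DecidableEq c]
    [Field K] (X : Matrix r c K) :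
    ∃ (U : Matrix r (Fin X.rank) K) (V : Matrix (Fin X.rank) c K), X = U * V := by
  classical
  let e : LinearMap.range X.mulVecLin ≃ₗ[K] (Fin X.rank → K) :=
    (Module.finBasis K (LinearMap.range X.mulVecLin)).equivFun
  refine ⟨LinearMap.toMatrix' ((LinearMap.range X.mulVecLin).subtype ∘ₗ e.symm.toLinearMap),
    LinearMap.toMatrix' (e.toLinearMap ∘ₗ X.mulVecLin.rangeRestrict), ?_⟩
  rw [← LinearMap.toMatrix'_comp]
  have h : ((LinearMap.range X.mulVecLin).subtype ∘ₗ e.symm.toLinearMap) ∘ₗ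
      (e.toLinearMap ∘ₗ X.mulVecLin.rangeRestrict) = Matrix.toLin' X := by
    refine LinearMap.ext fun v => ?_
    simp
  rw [h, LinearMap.toMatrix'_toLin']

end Rank

/-! ### Splitting by residue classes mod `N` -/

section ResiduePart

theorem IsPrimitiveRoot.inv_mul_sum_zpow {ζ : ℂ} {N : ℕ} (hN : 0 < N) (hζ : IsPrimitiveRoot ζ N)
    (k : ℤ) : (N : ℂ)⁻¹ * ∑ j ∈ Finset.range N, ζ ^ ((j : ℤ) * k)
      = if (N : ℤ) ∣ k then 1 else 0 := by
  have hN0 : (N : ℂ) ≠ 0 := by exact_mod_cast hN.ne'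
  have hpow : ∀ j : ℕ, ζ ^ ((j : ℤ) * k) = (ζ ^ k) ^ j := fun j => by
    rw [mul_comm, zpow_mul, zpow_natCast]
  simp_rw [hpow]
  split_ifs with h
  · rw [(hζ.zpow_eq_one_iff_dvd k).2 h]
    simp [hN0]
  · have h1 : ζ ^ k ≠ 1 := fun h' => h ((hζ.zpow_eq_one_iff_dvd k).1 h')
    have h2 : (ζ ^ k) ^ N = 1 := by
      rw [← zpow_natCast, ← zpow_mul, mul_comm, zpow_mul, zpow_natCast, hζ.pow_eq_one, one_zpow]
    rw [geom_sum_eq h1, h2, sub_self, zero_div, mul_zero]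

/-- The part of a function on the unit circle that is made up of the Fourier modes congruent to
`r` modulo `N`, as a discrete Fourier transform over the `N`-th roots of unity. -/
noncomputable def residuePart {E : Type*} [AddCommGroup E] [Module ℂ E] (N : ℕ) (ζ : ℂ)
    (F : ℂ → E) (r : ℤ) (w : ℂ) : E :=
  (N : ℂ)⁻¹ • ∑ j ∈ Finset.range N, ζ ^ (-((j : ℤ) * r)) • F (ζ ^ j * w)

variable {E E' : Type*} [AddCommGroup E] [Module ℂ E] [AddCommGroup E'] [Module ℂ E']

theorem map_residuePart (L : E →ₗ[ℂ] E') (N : ℕ) (ζ : ℂ) (F : ℂ → E) (r : ℤ) (w : ℂ) :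
    L (residuePart N ζ F r w) = residuePart N ζ (fun z => L (F z)) r w := by
  simp [residuePart]

/-- Inversion of the discrete Fourier transform. It needs no analyticity of `F`. -/
theorem sum_zpow_smul_residuePart {N : ℕ} {ζ : ℂ} (hζ : IsPrimitiveRoot ζ N) (F : ℂ → E) (w : ℂ)
    {j : ℕ} (hj : j < N) :
    ∑ r ∈ Finset.range N, ζ ^ ((j : ℤ) * r) • residuePart N ζ F r w = F (ζ ^ j * w) := by
  have hN : 0 < N := by omega
  have hζ0 : ζ ≠ 0 := hζ.ne_zero hN.ne'
  have h1 : ∀ r : ℕ, ζ ^ ((j : ℤ) * r) • residuePart N ζ F r w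
      = ∑ i ∈ Finset.range N, ((N : ℂ)⁻¹ * ζ ^ ((r : ℤ) * ((j : ℤ) - i))) • F (ζ ^ i * w) := by
    intro r
    rw [residuePart, smul_comm, Finset.smul_sum, Finset.smul_sum]
    refine Finset.sum_congr rfl fun i _ => ?_
    rw [smul_smul, smul_smul, mul_assoc, ← zpow_add₀ hζ0]
    congr 3
    ring
  simp_rw [h1]
  rw [Finset.sum_comm]
  simp_rw [← Finset.sum_smul, ← Finset.mul_sum, hζ.inv_mul_sum_zpow hN]
  rw [Finset.sum_eq_single j]
  · simp
  · intro i hi hij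
    have : ¬ (N : ℤ) ∣ (j : ℤ) - i := by
      intro hd
      rw [Finset.mem_range] at hi
      have h2 := Int.eq_zero_of_abs_lt_dvd hd (by rw [abs_lt]; constructor <;> omega)
      omega
    rw [if_neg this, zero_smul]
  · intro h
    exact absurd (Finset.mem_range.2 hj) h

theorem hasSum_residuePart {t : ℝ} (ht : 1 < t) {f : ℂ → ℂ}
    (hf : ∀ z ∈ annulus t, DifferentiableAt ℂ f z) {K : ℝ}
    (hK : ∀ z ∈ annulus t, ‖f z‖ ^ 2 ≤ K) {N : ℕ} (hN : 0 < N) {ζ : ℂ}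
    (hζ : IsPrimitiveRoot ζ N) (r : ℤ) {w : ℂ} (hw : ‖w‖ = 1) :
    HasSum (fun n : ℤ => if (N : ℤ) ∣ n - r then w ^ n * scalarLaurentCoeff f n else 0)
      (residuePart N ζ f r w) := by
  have hζ0 : ζ ≠ 0 := hζ.ne_zero hN.ne'
  have hζ1 : ‖ζ‖ = 1 := hζ.norm'_eq_one hN.ne'
  have h1 : ∀ j ∈ Finset.range N, HasSum (fun n : ℤ =>
      ζ ^ (-((j : ℤ) * r)) • ((ζ ^ j * w) ^ n * scalarLaurentCoeff f n))
      (ζ ^ (-((j : ℤ) * r)) • f (ζ ^ j * w)) := fun j _ =>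
    (hasSum_scalarLaurentCoeff ht hf hK (by simp [hζ1, hw])).const_smul _
  have h2 := (hasSum_sum h1).const_smul (N : ℂ)⁻¹
  refine h2.congr_fun fun n => ?_
  have h3 : ∀ j : ℕ, ζ ^ (-((j : ℤ) * r)) • ((ζ ^ j * w) ^ n * scalarLaurentCoeff f n)
      = ζ ^ ((j : ℤ) * (n - r)) * (w ^ n * scalarLaurentCoeff f n) := by
    intro j
    rw [smul_eq_mul, mul_zpow, ← zpow_natCast ζ j, ← zpow_mul, mul_assoc, ← mul_assoc, ←
      zpow_add₀ hζ0]
    congr 2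
    ring
  simp_rw [h3]
  rw [← Finset.sum_mul, smul_eq_mul, ← mul_assoc, hζ.inv_mul_sum_zpow hN, ite_mul, one_mul,
    zero_mul]

/-- Averaging over the `N`-th roots of unity keeps every `N`-th Laurent coefficient. -/
theorem hasSum_average {t : ℝ} (ht : 1 < t) {f : ℂ → ℂ}
    (hf : ∀ z ∈ annulus t, DifferentiableAt ℂ f z) {K : ℝ}
    (hK : ∀ z ∈ annulus t, ‖f z‖ ^ 2 ≤ K) {N : ℕ} (hN : 0 < N) {ζ : ℂ}
    (hζ : IsPrimitiveRoot ζ N) {w : ℂ} (hw : ‖w‖ = 1) :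
    HasSum (fun n : ℤ => (w ^ N) ^ n * scalarLaurentCoeff f ((N : ℤ) * n))
      ((N : ℂ)⁻¹ * ∑ j ∈ Finset.range N, f (ζ ^ j * w)) := by
  have h1 := hasSum_residuePart ht hf hK hN hζ 0 hw
  have h2 : residuePart N ζ f 0 w = (N : ℂ)⁻¹ * ∑ j ∈ Finset.range N, f (ζ ^ j * w) := by
    simp [residuePart]
  rw [h2] at h1
  have hinj : Function.Injective fun n : ℤ => (N : ℤ) * n := by
    intro a b hab
    have : (N : ℤ) ≠ 0 := by exact_mod_cast hN.ne'
    exact mul_left_cancel₀ this hab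
  rw [← hinj.hasSum_iff] at h1
  · refine h1.congr_fun fun n => ?_
    simp [zpow_mul]
  · intro n hn
    rw [if_neg]
    rintro ⟨k, hk⟩
    exact hn ⟨k, by simpa using hk.symm⟩

/-- The energy of a family of distinct residue parts, bounded through the weights. -/
theorem sum_sq_residuePart_le {t : ℝ} (ht : 1 < t) {ι κ : Type*} [Fintype ι]
    {f : ι → ℂ → ℂ} (hf : ∀ j, ∀ z ∈ annulus t, DifferentiableAt ℂ (f j) z) {K : ℝ}
    (hK : ∀ z ∈ annulus t, ∑ j, ‖f j z‖ ^ 2 ≤ K) {N : ℕ} (hN : 0 < N) {ζ : ℂ}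
    (hζ : IsPrimitiveRoot ζ N) {w : ℂ} (hw : ‖w‖ = 1) (S : Finset κ) (ρ : κ → ℤ)
    (hρ : ∀ a ∈ S, ∀ b ∈ S, (N : ℤ) ∣ ρ a - ρ b → a = b) {T : ℝ} (hT0 : 0 ≤ T)
    (hT : ∀ a ∈ S, ∀ s : Finset ℤ, ∑ n ∈ s with (N : ℤ) ∣ n - ρ a, (laurentWeight t n)⁻¹ ≤ T) :
    ∑ a ∈ S, ∑ j, ‖residuePart N ζ (f j) (ρ a) w‖ ^ 2 ≤ 2 * K * T := by
  have ht0 : 0 < t := by linarith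
  have hω : ∀ n, 0 < laurentWeight t n := fun n => by unfold laurentWeight; positivity
  have hKj : ∀ j, ∀ z ∈ annulus t, ‖f j z‖ ^ 2 ≤ K := fun j z hz =>
    (Finset.single_le_sum (f := fun j => ‖f j z‖ ^ 2) (fun _ _ => by positivity)
      (Finset.mem_univ j)).trans (hK z hz)
  have hlim : Filter.Tendsto (fun s : Finset ℤ => ∑ a ∈ S, ∑ j, ‖∑ n ∈ s,
      if (N : ℤ) ∣ n - ρ a then w ^ n * scalarLaurentCoeff (f j) n else 0‖ ^ 2) Filter.atTop
      (nhds (∑ a ∈ S, ∑ j, ‖residuePart N ζ (f j) (ρ a) w‖ ^ 2)) :=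
    tendsto_finsetSum _ fun a _ => tendsto_finsetSum _ fun j _ =>
      ((hasSum_residuePart ht (hf j) (hKj j) hN hζ (ρ a) hw).norm.pow 2)
  -- The estimate is made for finite partial sums of the Laurent series, so no summability has to be
  -- tracked inside the classes.
  refine le_of_tendsto' hlim fun s => ?_
  have hCS : ∀ a ∈ S, ∀ j, ‖∑ n ∈ s,
      if (N : ℤ) ∣ n - ρ a then w ^ n * scalarLaurentCoeff (f j) n else 0‖ ^ 2
      ≤ (∑ n ∈ s with (N : ℤ) ∣ n - ρ a, laurentWeight t n * ‖scalarLaurentCoeff (f j) n‖ ^ 2)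
        * T := by
    intro a ha j
    rw [← Finset.sum_filter]
    calc _ ≤ (∑ n ∈ s with (N : ℤ) ∣ n - ρ a, ‖scalarLaurentCoeff (f j) n‖) ^ 2 := by
          refine pow_le_pow_left₀ (norm_nonneg _) (norm_sum_le_of_le _ fun n _ => ?_) 2
          rw [norm_mul, norm_zpow, hw, one_zpow, one_mul]
      _ ≤ (∑ n ∈ s with (N : ℤ) ∣ n - ρ a, laurentWeight t n * ‖scalarLaurentCoeff (f j) n‖ ^ 2)
          * (∑ n ∈ s with (N : ℤ) ∣ n - ρ a, (laurentWeight t n)⁻¹) := by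
          refine Finset.sum_sq_le_sum_mul_sum_of_sq_le_mul _
            (fun n _ => mul_nonneg (hω n).le (by positivity))
            (fun n _ => (inv_pos.2 (hω n)).le) fun n _ => le_of_eq ?_
          have := (hω n).ne'
          field_simp
      _ ≤ _ := by
          refine mul_le_mul_of_nonneg_left (hT a ha s) (Finset.sum_nonneg fun n _ => ?_)
          exact mul_nonneg (hω n).le (by positivity)
  calc _ ≤ ∑ a ∈ S, ∑ j, (∑ n ∈ s with (N : ℤ) ∣ n - ρ a,
        laurentWeight t n * ‖scalarLaurentCoeff (f j) n‖ ^ 2) * T :=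
        Finset.sum_le_sum fun a ha => Finset.sum_le_sum fun j _ => hCS a ha j
    _ = (∑ a ∈ S, ∑ n ∈ s with (N : ℤ) ∣ n - ρ a,
        laurentWeight t n * ∑ j, ‖scalarLaurentCoeff (f j) n‖ ^ 2) * T := by
        rw [Finset.sum_mul]
        refine Finset.sum_congr rfl fun a _ => ?_
        rw [← Finset.sum_mul, Finset.sum_comm]
        simp_rw [Finset.mul_sum]
    _ ≤ (2 * K) * T := by
        refine mul_le_mul_of_nonneg_right ?_ hT0
        -- Distinct residues give disjoint sets of indices, so the weighted Parseval bound is spent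
        -- only once for all classes together.
        rw [← Finset.sum_biUnion]
        · exact sum_laurentWeight_mul_sq_scalarLaurentCoeff_le ht hf hK _
        · intro a ha b hb hab
          refine Finset.disjoint_left.2 fun n hn hn' => hab (hρ a ha b hb ?_)
          have h1 := (Finset.mem_filter.1 hn).2
          have h2 := (Finset.mem_filter.1 hn').2
          have h3 := dvd_sub h2 h1
          have h4 : n - ρ b - (n - ρ a) = ρ a - ρ b := by ring
          rwa [h4] at h3

end ResiduePart

/-! ### Sums of inverse weights over a residue class -/

section WeightSums

/-- The two summands of the weight have product one, so their sum is at least two. -/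
theorem inv_laurentWeight_le_half {t : ℝ} (ht : 0 < t) (n : ℤ) : (laurentWeight t n)⁻¹ ≤ 1 / 2 := by
  rw [one_div]
  refine inv_anti₀ two_pos ?_
  unfold laurentWeight
  have h : t ^ n * t⁻¹ ^ n = 1 := by
    rw [← mul_zpow, mul_inv_cancel₀ ht.ne', one_zpow]
  nlinarith [sq_nonneg (t ^ n - t⁻¹ ^ n)]

theorem inv_laurentWeight_le_pow {t : ℝ} (ht : 0 < t) (n : ℤ) :
    (laurentWeight t n)⁻¹ ≤ (t⁻¹ ^ n.natAbs) ^ 2 := by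
  have h2 : (t ^ n.natAbs) ^ 2 ≤ laurentWeight t n := by
    unfold laurentWeight
    rcases Int.natAbs_eq n with h | h
    · rw [h, Int.natAbs_natCast, zpow_natCast]
      exact le_add_of_nonneg_right (by positivity)
    · rw [h, Int.natAbs_neg, Int.natAbs_natCast, inv_zpow', neg_neg, zpow_natCast]
      exact le_add_of_nonneg_left (by positivity)
  rw [inv_pow, inv_pow]
  exact inv_anti₀ (by positivity) h2

theorem sum_filter_dvd_sub_le {N : ℕ} (hN : 0 < N) {φ : ℤ → ℝ} {g : ℤ → ℝ} {G : ℝ} {d r : ℤ}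
    (hd : (N : ℤ) ∣ d - r) (hg0 : ∀ l, 0 ≤ g l) (hg : HasSum g G)
    (h : ∀ l : ℤ, φ (d + N * l) ≤ g l) (s : Finset ℤ) :
    ∑ n ∈ s with (N : ℤ) ∣ n - r, φ n ≤ G := by
  have hN0 : (N : ℤ) ≠ 0 := by exact_mod_cast hN.ne'
  have hdiv : ∀ n ∈ s.filter (fun n => (N : ℤ) ∣ n - r), d + N * ((n - d) / N) = n := by
    intro n hn
    have h1 := (Finset.mem_filter.1 hn).2
    have h2 : (N : ℤ) ∣ n - d := by
      have := dvd_sub h1 hd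
      rwa [sub_sub_sub_cancel_right] at this
    rw [Int.mul_ediv_cancel' h2]
    ring
  calc ∑ n ∈ s with (N : ℤ) ∣ n - r, φ n
      ≤ ∑ n ∈ s with (N : ℤ) ∣ n - r, g ((n - d) / N) := by
        refine Finset.sum_le_sum fun n hn => ?_
        have := h ((n - d) / N)
        rwa [hdiv n hn] at this
    _ = ∑ l ∈ (s.filter fun n => (N : ℤ) ∣ n - r).image (fun n => (n - d) / N), g l := by
        rw [Finset.sum_image]
        intro a ha b hb hab
        simp only at hab
        rw [← hdiv a ha, ← hdiv b hb, hab]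
    _ ≤ G := sum_le_hasSum _ (fun l _ => hg0 l) hg

theorem hasSum_int_two_sided_geometric {y : ℝ} (hy0 : 0 ≤ y) (hy : y < 1) (a b : ℝ) :
    HasSum (fun l : ℤ => match l with
      | .ofNat k => a * y ^ k
      | .negSucc k => b * y ^ k) ((a + b) / (1 - y)) := by
  have h := hasSum_geometric_of_lt_one hy0 hy
  rw [add_div, div_eq_mul_inv, div_eq_mul_inv]
  exact HasSum.of_nat_of_neg_add_one (f := fun l : ℤ => match l with
      | .ofNat k => a * y ^ k
      | .negSucc k => b * y ^ k) (h.mul_left a) (by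
        refine (h.mul_left b).congr_fun fun k => ?_
        rw [← Int.negSucc_eq])

/-- The weights over a nonzero residue class. -/
theorem sum_inv_laurentWeight_le {t : ℝ} (ht : 1 < t) {N : ℕ} (hN : 0 < N) {d : ℕ}
    (hdN : d ≤ N) {r : ℤ} (hd : (N : ℤ) ∣ d - r) (s : Finset ℤ) :
    ∑ n ∈ s with (N : ℤ) ∣ n - r, (laurentWeight t n)⁻¹
      ≤ ((t⁻¹ ^ d) ^ 2 + (t⁻¹ ^ (N - d)) ^ 2) / (1 - (t⁻¹ ^ N) ^ 2) := by
  have ht0 : 0 < t := by linarith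
  have hti : t⁻¹ < 1 := inv_lt_one_of_one_lt₀ ht
  have hti0 : 0 < t⁻¹ := inv_pos.2 ht0
  have hy : (t⁻¹ ^ N) ^ 2 < 1 :=
    pow_lt_one₀ (by positivity) (pow_lt_one₀ hti0.le hti hN.ne') two_ne_zero
  refine sum_filter_dvd_sub_le hN hd ?_ (hasSum_int_two_sided_geometric (by positivity) hy _ _)
    (fun l => ?_) s
  · rintro (k | k) <;> positivity
  -- The absolute values in the class are `d + N k` and `(N - d) + N k` for `k ≥ 0`, giving two
  -- geometric series of ratio `t⁻¹ ^ (2N)`.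
  · refine (inv_laurentWeight_le_pow ht0 _).trans (le_of_eq ?_)
    rcases l with k | k
    · have : ((d : ℤ) + N * Int.ofNat k).natAbs = d + N * k := by
        rw [Int.ofNat_eq_natCast]
        exact_mod_cast Int.natAbs_natCast (d + N * k)
      simp only [this]
      ring
    · have : ((d : ℤ) + N * Int.negSucc k).natAbs = (N - d) + N * k := by
        rw [Int.negSucc_eq, ← Int.natAbs_neg]
        have h1 : -((d : ℤ) + N * -((k : ℤ) + 1)) = (((N - d) + N * k : ℕ) : ℤ) := by
          push_cast [Nat.cast_sub hdN]
          ring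
        rw [h1, Int.natAbs_natCast]
      simp only [this]
      ring

/-- The centred representative contributes at most `1 / 2`. The other indices start at `N + d` and
`N - d` in absolute value; one of these is at least `N`, the other at least `N / 2`. With `y = t⁻¹ ^
N` the sum is at most `1/2 + (y + y²)/(1 - y²)`, which is the stated constant. -/
theorem sum_inv_laurentWeight_le_of_two_mul_abs_le {t : ℝ} (ht : 1 < t) {N : ℕ} (hN : 0 < N)
    {d r : ℤ} (hdN : 2 * |d| ≤ N) (hd : (N : ℤ) ∣ d - r) (s : Finset ℤ) :
    ∑ n ∈ s with (N : ℤ) ∣ n - r, (laurentWeight t n)⁻¹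
      ≤ (1 + t⁻¹ ^ N) / (2 * (1 - t⁻¹ ^ N)) := by
  have ht0 : 0 < t := by linarith
  have hti : t⁻¹ < 1 := inv_lt_one_of_one_lt₀ ht
  have hti0 : 0 < t⁻¹ := inv_pos.2 ht0
  set y := t⁻¹ ^ N with hy
  have hy0 : 0 < y := by positivity
  have hy1 : y < 1 := pow_lt_one₀ hti0.le hti hN.ne'
  have hy2 : y ^ 2 < 1 := pow_lt_one₀ hy0.le hy1 two_ne_zero
  obtain ⟨hd1, hd2⟩ := abs_le.1 (show |d| ≤ |d| from le_rfl)
  set p := (N + d).toNat with hp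
  set q := (N - d).toNat with hq
  have hpz : (p : ℤ) = N + d := Int.toNat_of_nonneg (by omega)
  have hqz : (q : ℤ) = N - d := Int.toNat_of_nonneg (by omega)
  set A := (t⁻¹ ^ p) ^ 2 with hA
  set B := (t⁻¹ ^ q) ^ 2 with hB
  have hle : ∀ {k : ℕ}, N ≤ 2 * k → (t⁻¹ ^ k) ^ 2 ≤ y := by
    intro k hk
    rw [← pow_mul]
    exact pow_le_pow_of_le_one hti0.le hti.le (by omega)
  have hle' : ∀ {k : ℕ}, N ≤ k → (t⁻¹ ^ k) ^ 2 ≤ y ^ 2 := fun {k} hk =>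
    pow_le_pow_left₀ (by positivity) (pow_le_pow_of_le_one hti0.le hti.le hk) 2
  have hAB : A + B ≤ y + y ^ 2 := by
    rcases le_total 0 d with h | h
    · rw [add_comm]
      exact add_le_add (hle (by omega)) (hle' (by omega))
    · exact add_le_add (hle (by omega)) (hle' (by omega))
  let g : ℤ → ℝ := fun l => match l with
    | .ofNat 0 => 1 / 2
    | .ofNat (k + 1) => A * (y ^ 2) ^ k
    | .negSucc k => B * (y ^ 2) ^ k
  have hgeo := hasSum_geometric_of_lt_one (by positivity) hy2
  have hg : HasSum g (1 / 2 + A * (1 - y ^ 2)⁻¹ + B * (1 - y ^ 2)⁻¹) := by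
    refine HasSum.of_nat_of_neg_add_one ?_ ?_
    · rw [← hasSum_nat_add_iff' 1, Finset.sum_range_one]
      have : (1 / 2 + A * (1 - y ^ 2)⁻¹ - g ((0 : ℕ) : ℤ)) = A * (1 - y ^ 2)⁻¹ := by
        change 1 / 2 + A * (1 - y ^ 2)⁻¹ - 1 / 2 = _
        ring
      rw [this]
      exact hgeo.mul_left A
    · refine (hgeo.mul_left B).congr_fun fun k => ?_
      rw [← Int.negSucc_eq]
  refine (sum_filter_dvd_sub_le hN hd ?_ hg (fun l => ?_) s).trans ?_
  · rintro ((_ | k) | k)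
    · change (0 : ℝ) ≤ 1 / 2
      norm_num
    · change 0 ≤ A * (y ^ 2) ^ k
      positivity
    · change 0 ≤ B * (y ^ 2) ^ k
      positivity
  · rcases l with (_ | k) | k
    · exact inv_laurentWeight_le_half ht0 _
    · refine (inv_laurentWeight_le_pow ht0 _).trans (le_of_eq ?_)
      have h1 : (d : ℤ) + N * Int.ofNat (k + 1) = ((p + N * k : ℕ) : ℤ) := by
        rw [Int.ofNat_eq_natCast]
        push_cast
        rw [hpz]
        ring
      rw [h1, Int.natAbs_natCast]
      change _ = A * (y ^ 2) ^ k
      rw [hA, hy]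
      ring
    · refine (inv_laurentWeight_le_pow ht0 _).trans (le_of_eq ?_)
      have h1 : -((d : ℤ) + N * Int.negSucc k) = ((q + N * k : ℕ) : ℤ) := by
        rw [Int.negSucc_eq]
        push_cast
        rw [hqz]
        ring
      rw [← Int.natAbs_neg, h1, Int.natAbs_natCast]
      change _ = B * (y ^ 2) ^ k
      rw [hB, hy]
      ring
  · have h1 : 0 < 1 - y := by linarith
    have h2 : 0 < 1 - y ^ 2 := by linarith
    have h3 : (1 + y) / (2 * (1 - y)) = 1 / 2 + (y + y ^ 2) * (1 - y ^ 2)⁻¹ := by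
      rw [← div_eq_mul_inv]
      have : (1 - y ^ 2) = (1 - y) * (1 + y) := by ring
      rw [this]
      field_simp
      ring
    rw [h3, add_assoc, ← add_mul]
    gcongr

/-- The weights over any residue class. -/
theorem sum_inv_laurentWeight_le_of_residue {t : ℝ} (ht : 1 < t) {N : ℕ} (hN : 0 < N) (r : ℤ)
    (s : Finset ℤ) :
    ∑ n ∈ s with (N : ℤ) ∣ n - r, (laurentWeight t n)⁻¹
      ≤ (1 + t⁻¹ ^ N) / (2 * (1 - t⁻¹ ^ N)) := by
  have h1 := Int.emod_nonneg r (show (N : ℤ) ≠ 0 by omega)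
  have h2 := Int.emod_lt_of_pos r (show (0 : ℤ) < N by omega)
  have h3 := Int.emod_add_mul_ediv r N
  rcases le_total (2 * (r % N)) N with h | h
  · refine sum_inv_laurentWeight_le_of_two_mul_abs_le ht hN (d := r % N) ?_ ?_ s
    · rw [abs_of_nonneg h1]
      exact h
    · exact ⟨-(r / N), by linarith⟩
  · refine sum_inv_laurentWeight_le_of_two_mul_abs_le ht hN (d := r % N - N) ?_ ?_ s
    · rw [abs_of_nonpos (by linarith)]
      linarith
    · exact ⟨-(r / N) - 1, by linarith⟩

end WeightSums

/-! ### Operator norms tested with the bilinear dot product -/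

section BilinearNorm

variable {n : Type*} [Fintype n] [DecidableEq n]

/-- The Euclidean norm of a vector given by its coordinates. -/
noncomputable def l2norm {n : Type*} [Fintype n] (v : n → ℂ) : ℝ := √(∑ i, ‖v i‖ ^ 2)

omit [DecidableEq n] in
theorem l2norm_nonneg (v : n → ℂ) : 0 ≤ l2norm v := Real.sqrt_nonneg _

omit [DecidableEq n] in
theorem sq_l2norm (v : n → ℂ) : l2norm v ^ 2 = ∑ i, ‖v i‖ ^ 2 :=
  Real.sq_sqrt (Finset.sum_nonneg fun _ _ => by positivity)

omit [DecidableEq n] in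
theorem norm_dotProduct_le (x y : n → ℂ) : ‖x ⬝ᵥ y‖ ≤ l2norm x * l2norm y := by
  refine (norm_sum_le _ _).trans ?_
  simp_rw [norm_mul]
  exact Real.sum_mul_le_sqrt_mul_sqrt _ _ _

omit [DecidableEq n] in
theorem dotProduct_star_self (x : n → ℂ) : x ⬝ᵥ star x = ((l2norm x ^ 2 : ℝ) : ℂ) := by
  rw [sq_l2norm, dotProduct]
  push_cast
  refine Finset.sum_congr rfl fun i _ => ?_
  rw [Pi.star_apply, RCLike.star_def, Complex.mul_conj, Complex.normSq_eq_norm_sq]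
  push_cast
  rfl

omit [DecidableEq n] in
theorem l2norm_star (x : n → ℂ) : l2norm (star x) = l2norm x := by
  simp [l2norm]

theorem l2norm_mulVec_le (M : Matrix n n ℂ) (v : n → ℂ) :
    l2norm (M.mulVec v) ≤ ‖M‖ * l2norm v := Matrix.norm_mulVec_le M v

theorem norm_dotProduct_mulVec_le (M : Matrix n n ℂ) (x y : n → ℂ) :
    ‖x ⬝ᵥ M.mulVec y‖ ≤ l2norm x * (‖M‖ * l2norm y) :=
  (norm_dotProduct_le _ _).trans
    (mul_le_mul_of_nonneg_left (l2norm_mulVec_le M y) (l2norm_nonneg x))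

theorem le_of_sq_le_mul_self {a b : ℝ} (ha : 0 ≤ a) (hb : 0 ≤ b) (h : a ^ 2 ≤ b * a) : a ≤ b := by
  rcases ha.eq_or_lt with h0 | h0
  · exact h0 ▸ hb
  · rw [pow_two] at h
    exact le_of_mul_le_mul_right h h0

theorem l2norm_vecMul_le (M : Matrix n n ℂ) (y : n → ℂ) :
    l2norm (Matrix.vecMul y M) ≤ ‖M‖ * l2norm y := by
  refine le_of_sq_le_mul_self (l2norm_nonneg _) (mul_nonneg (norm_nonneg _) (l2norm_nonneg _)) ?_
  have h1 := dotProduct_star_self (Matrix.vecMul y M)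
  rw [← Matrix.dotProduct_mulVec] at h1
  have h2 := norm_dotProduct_mulVec_le M y (star (Matrix.vecMul y M))
  rw [h1, Complex.norm_real, Real.norm_of_nonneg (by positivity), l2norm_star] at h2
  linarith

theorem Matrix.norm_le_of_dotProduct_mulVec (M : Matrix n n ℂ) {c : ℝ} (hc : 0 ≤ c)
    (h : ∀ x y, ‖x ⬝ᵥ M.mulVec y‖ ≤ c * l2norm x * l2norm y) : ‖M‖ ≤ c := by
  refine Matrix.norm_le_of_mulVec M hc fun v => ?_
  change l2norm _ ≤ c * l2norm v
  refine le_of_sq_le_mul_self (l2norm_nonneg _) (mul_nonneg hc (l2norm_nonneg _)) ?_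
  have h1 := dotProduct_star_self (M.mulVec v)
  have h2 := h (star (M.mulVec v)) v
  rw [dotProduct_comm, h1, Complex.norm_real, Real.norm_of_nonneg (by positivity),
    l2norm_star] at h2
  linarith

end BilinearNorm

/-! ### Averages of products, decomposed by residue classes -/

section ProductDecomposition

variable {n : Type*} [Fintype n] [DecidableEq n]

/-- The average over the roots of unity of a product `D(z) C(z) G(z)` in which `C` is a Laurent
polynomial, in terms of the residue parts of `D` and `G`. -/
theorem average_mul_mul_eq {ι : Type*} [Fintype ι] {N : ℕ} {ζ : ℂ} (hN : 0 < N)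
    (hζ : IsPrimitiveRoot ζ N) (D G : ℂ → Matrix n n ℂ) (C : ι → Matrix n n ℂ) (b : ι → ℤ) (w : ℂ) :
    (N : ℂ)⁻¹ • ∑ j ∈ Finset.range N,
        D (ζ ^ j * w) * (∑ i, (ζ ^ j * w) ^ b i • C i) * G (ζ ^ j * w)
      = ∑ i, w ^ b i • ∑ r ∈ Finset.range N,
        residuePart N ζ D (-(r + b i)) w * C i * residuePart N ζ G r w := by
  have hζ0 : ζ ≠ 0 := hζ.ne_zero hN.ne'
  have h1 : ∀ i, ∑ r ∈ Finset.range N,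
      residuePart N ζ D (-(r + b i)) w * C i * residuePart N ζ G r w
      -- Only the left residue part is expanded into its discrete transform; summing over `r` then
      -- inverts the transform of `G` and restores `G (ζ ^ j * w)`.
      = (N : ℂ)⁻¹ • ∑ j ∈ Finset.range N, ζ ^ ((j : ℤ) * b i) •
        (D (ζ ^ j * w) * C i * G (ζ ^ j * w)) := by
    intro i
    have h2 : ∀ r : ℕ, residuePart N ζ D (-(r + b i)) w * C i * residuePart N ζ G r w
        = (N : ℂ)⁻¹ • ∑ j ∈ Finset.range N, ζ ^ ((j : ℤ) * b i) •
          (D (ζ ^ j * w) * C i * (ζ ^ ((j : ℤ) * r) • residuePart N ζ G r w)) := by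
      intro r
      conv_lhs => rw [residuePart]
      rw [smul_mul_assoc, smul_mul_assoc, Finset.sum_mul, Finset.sum_mul]
      congr 1
      refine Finset.sum_congr rfl fun j _ => ?_
      rw [smul_mul_assoc, smul_mul_assoc, mul_smul_comm, smul_smul, ← zpow_add₀ hζ0]
      congr 2
      ring
    simp_rw [h2]
    rw [← Finset.smul_sum, Finset.sum_comm]
    congr 1
    refine Finset.sum_congr rfl fun j hj => ?_
    rw [← Finset.smul_sum, ← Finset.mul_sum,
      sum_zpow_smul_residuePart hζ G w (Finset.mem_range.1 hj)]
  simp_rw [h1, smul_comm _ (N : ℂ)⁻¹]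
  rw [← Finset.smul_sum]
  congr 1
  simp_rw [Finset.smul_sum]
  rw [Finset.sum_comm]
  refine Finset.sum_congr rfl fun j _ => ?_
  rw [Finset.mul_sum, Finset.sum_mul]
  refine Finset.sum_congr rfl fun i _ => ?_
  rw [mul_smul_comm, smul_mul_assoc, smul_smul]
  congr 1
  rw [mul_zpow, ← zpow_natCast ζ j, ← zpow_mul, mul_comm]

/-- The residues `ρ a`, `a ∈ S`, are distinct modulo `N`, and the sum of the inverse weights over
each of these residue classes is at most `β² / 2`. -/
structure ResidueBound (t : ℝ) (N : ℕ) (S : Finset ℕ) (ρ : ℕ → ℤ) (β : ℝ) : Prop where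
  nonneg : 0 ≤ β
  inj : ∀ a ∈ S, ∀ b ∈ S, (N : ℤ) ∣ ρ a - ρ b → a = b
  sum_le : ∀ a ∈ S, ∀ s : Finset ℤ,
    ∑ n ∈ s with (N : ℤ) ∣ n - ρ a, (laurentWeight t n)⁻¹ ≤ β ^ 2 / 2

/-- A matrix function with analytic entries and norm at most `δ` on the annulus. -/
structure AnalyticBounded (t δ : ℝ) (G : ℂ → Matrix n n ℂ) : Prop where
  differentiableAt : ∀ i j, ∀ z ∈ annulus t, DifferentiableAt ℂ (fun z => G z i j) z
  norm_le : ∀ z ∈ annulus t, ‖G z‖ ≤ δ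

variable {t δ : ℝ} {D G : ℂ → Matrix n n ℂ} {N : ℕ} {ζ w : ℂ} {S : Finset ℕ} {ρ : ℕ → ℤ} {β : ℝ}

/-- Parseval applied to the vector function `G(z) v`, of length at most `δ ‖v‖`, instead of to
entries, so that no dimension factor appears. The bound `β² / 2` in `ResidueBound` absorbs the
factor `2` of the two circles. -/
theorem AnalyticBounded.sum_sq_mulVec_le (hG : AnalyticBounded t δ G) (ht : 1 < t)
    (hN : 0 < N) (hζ : IsPrimitiveRoot ζ N) (hw : ‖w‖ = 1) (hS : ResidueBound t N S ρ β)
    (v : n → ℂ) :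
    ∑ a ∈ S, l2norm ((residuePart N ζ G (ρ a) w).mulVec v) ^ 2 ≤ (δ * l2norm v * β) ^ 2 := by
  have h1 : ∀ (a : ℕ) (j : n), (residuePart N ζ G (ρ a) w).mulVec v j
      = residuePart N ζ (fun z => (G z).mulVec v j) (ρ a) w := fun a j =>
    map_residuePart ((LinearMap.proj j : (n → ℂ) →ₗ[ℂ] ℂ) ∘ₗ (Matrix.mulVecBilin ℂ ℂ).flip v)
      N ζ G (ρ a) w
  simp_rw [sq_l2norm, h1]
  refine (sum_sq_residuePart_le ht (f := fun j z => (G z).mulVec v j) ?_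
    (K := (δ * l2norm v) ^ 2) ?_ hN hζ hw S ρ hS.inj (by positivity) hS.sum_le).trans
    (le_of_eq (by ring))
  · intro j z hz
    simp only [Matrix.mulVec, dotProduct]
    exact DifferentiableAt.fun_sum fun i _ => (hG.differentiableAt j i z hz).mul_const _
  · intro z hz
    rw [← sq_l2norm]
    refine pow_le_pow_left₀ (l2norm_nonneg _) ((l2norm_mulVec_le _ _).trans ?_) 2
    exact mul_le_mul_of_nonneg_right (hG.norm_le z hz) (l2norm_nonneg _)

theorem AnalyticBounded.sum_sq_vecMul_le (hD : AnalyticBounded t δ D) (ht : 1 < t)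
    (hN : 0 < N) (hζ : IsPrimitiveRoot ζ N) (hw : ‖w‖ = 1) (hS : ResidueBound t N S ρ β)
    (y : n → ℂ) :
    ∑ a ∈ S, l2norm (Matrix.vecMul y (residuePart N ζ D (ρ a) w)) ^ 2
      ≤ (δ * l2norm y * β) ^ 2 := by
  have h1 : ∀ (a : ℕ) (j : n), Matrix.vecMul y (residuePart N ζ D (ρ a) w) j
      = residuePart N ζ (fun z => Matrix.vecMul y (D z) j) (ρ a) w := fun a j =>
    map_residuePart ((LinearMap.proj j : (n → ℂ) →ₗ[ℂ] ℂ) ∘ₗ (Matrix.vecMulBilin ℂ ℂ) y)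
      N ζ D (ρ a) w
  simp_rw [sq_l2norm, h1]
  refine (sum_sq_residuePart_le ht (f := fun j z => Matrix.vecMul y (D z) j) ?_
    (K := (δ * l2norm y) ^ 2) ?_ hN hζ hw S ρ hS.inj (by positivity) hS.sum_le).trans
    (le_of_eq (by ring))
  · intro j z hz
    simp only [Matrix.vecMul, dotProduct]
    exact DifferentiableAt.fun_sum fun i _ => (hD.differentiableAt i j z hz).const_mul _
  · intro z hz
    rw [← sq_l2norm]
    refine pow_le_pow_left₀ (l2norm_nonneg _) ((l2norm_vecMul_le _ _).trans ?_) 2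
    exact mul_le_mul_of_nonneg_right (hD.norm_le z hz) (l2norm_nonneg _)

/-- In the bilinear form `xᵀ(·)y`, Cauchy-Schwarz over the classes `r` separates the energies of `xᵀ
D` and of `G y`; the middle factor costs only `L`. -/
theorem norm_sum_residuePart_mul_mul_le {ι : Type*} [Fintype ι] (hD : AnalyticBounded t δ D)
    (hG : AnalyticBounded t δ G) (ht : 1 < t) (hδ : 0 ≤ δ) (hN : 0 < N) (hζ : IsPrimitiveRoot ζ N)
    (hw : ‖w‖ = 1) {L : ℝ} (hL : 0 ≤ L) (C : ι → Matrix n n ℂ) (hC : ∀ i, ‖C i‖ ≤ L) (b : ι → ℤ)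
    (T : ι → Finset ℕ) {β : ι → ℝ} {τ : ℝ}
    (hβ : ∀ i, ResidueBound t N (T i) (fun r => -(r + b i)) (β i))
    (hτ : ∀ i, ResidueBound t N (T i) (fun r => r) τ) (hτ0 : 0 ≤ τ) :
    ‖∑ i, w ^ b i • ∑ r ∈ T i, residuePart N ζ D (-(r + b i)) w * C i * residuePart N ζ G r w‖
      ≤ L * δ ^ 2 * (∑ i, β i) * τ := by
  have hβ0 : 0 ≤ ∑ i, β i := Finset.sum_nonneg fun i _ => (hβ i).nonneg
  refine Matrix.norm_le_of_dotProduct_mulVec _ (by positivity) fun x y => ?_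
  have hx := l2norm_nonneg x
  have hy := l2norm_nonneg y
  have h1 : x ⬝ᵥ (∑ i, w ^ b i • ∑ r ∈ T i,
      residuePart N ζ D (-(r + b i)) w * C i * residuePart N ζ G r w).mulVec y
      = ∑ i, w ^ b i * ∑ r ∈ T i, Matrix.vecMul x (residuePart N ζ D (-(r + b i)) w) ⬝ᵥ
        (C i).mulVec ((residuePart N ζ G r w).mulVec y) := by
    simp_rw [Matrix.sum_mulVec, Matrix.smul_mulVec, Matrix.sum_mulVec, dotProduct_sum,
      dotProduct_smul, dotProduct_sum, smul_eq_mul]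
    refine Finset.sum_congr rfl fun i _ => ?_
    congr 1
    refine Finset.sum_congr rfl fun r _ => ?_
    rw [← Matrix.dotProduct_mulVec, Matrix.mulVec_mulVec, Matrix.mulVec_mulVec, mul_assoc]
  rw [h1]
  have h2 : ∀ i, ‖w ^ b i * ∑ r ∈ T i, Matrix.vecMul x (residuePart N ζ D (-(r + b i)) w) ⬝ᵥ
      (C i).mulVec ((residuePart N ζ G r w).mulVec y)‖
      ≤ L * ((δ * l2norm x * β i) * (δ * l2norm y * τ)) := by
    intro i
    have hβi := (hβ i).nonneg
    rw [norm_mul, norm_zpow, hw, one_zpow, one_mul]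
    calc _ ≤ ∑ r ∈ T i, L * (l2norm (Matrix.vecMul x (residuePart N ζ D (-(r + b i)) w))
          * l2norm ((residuePart N ζ G r w).mulVec y)) := by
          refine norm_sum_le_of_le _ fun r _ => (norm_dotProduct_mulVec_le _ _ _).trans ?_
          have h3 := l2norm_nonneg (Matrix.vecMul x (residuePart N ζ D (-(r + b i)) w))
          have h4 := l2norm_nonneg ((residuePart N ζ G r w).mulVec y)
          calc _ ≤ l2norm (Matrix.vecMul x (residuePart N ζ D (-(r + b i)) w)) *
                (L * l2norm ((residuePart N ζ G r w).mulVec y)) := by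
                gcongr
                exact hC i
            _ = _ := by ring
      _ ≤ L * (√(∑ r ∈ T i, l2norm (Matrix.vecMul x (residuePart N ζ D (-(r + b i)) w)) ^ 2)
          * √(∑ r ∈ T i, l2norm ((residuePart N ζ G r w).mulVec y) ^ 2)) := by
          rw [← Finset.mul_sum]
          gcongr
          exact Real.sum_mul_le_sqrt_mul_sqrt _ _ _
      _ ≤ _ := by
          gcongr
          · exact Real.sqrt_le_iff.2 ⟨by positivity, hD.sum_sq_vecMul_le ht hN hζ hw (hβ i) x⟩
          · exact Real.sqrt_le_iff.2 ⟨by positivity, hG.sum_sq_mulVec_le ht hN hζ hw (hτ i) y⟩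
  refine (norm_sum_le_of_le _ fun i _ => h2 i).trans (le_of_eq ?_)
  rw [← Finset.mul_sum, ← Finset.sum_mul]
  simp_rw [← Finset.mul_sum]
  ring

end ProductDecomposition

/-! ### Off-diagonal corners -/

section Corner

variable {m : ℕ}

/-- The projection onto the first `p` coordinates. -/
def headProj (m p : ℕ) : Matrix (Fin m) (Fin m) ℂ :=
  Matrix.diagonal fun i => if i.val < p then 1 else 0

theorem headProj_mul_self (p : ℕ) : headProj m p * headProj m p = headProj m p := by
  rw [headProj, Matrix.diagonal_mul_diagonal]
  congr 1
  ext i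
  split_ifs <;> simp

theorem headProj_mul_apply (p : ℕ) (X : Matrix (Fin m) (Fin m) ℂ) (i j : Fin m) :
    (headProj m p * X) i j = if i.val < p then X i j else 0 := by
  rw [headProj, Matrix.diagonal_mul]
  split_ifs <;> simp

theorem mul_headProj_apply (p : ℕ) (X : Matrix (Fin m) (Fin m) ℂ) (i j : Fin m) :
    (X * headProj m p) i j = if j.val < p then X i j else 0 := by
  rw [headProj, Matrix.mul_diagonal]
  split_ifs <;> simp

theorem bottomLeft_mul_headProj (p : ℕ) (X : Matrix (Fin m) (Fin m) ℂ) :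
    bottomLeft p (X * headProj m p) = bottomLeft p X := by
  ext i j
  rw [bottomLeft, Matrix.toBlock_apply, mul_headProj_apply, if_pos j.2]
  rfl

theorem bottomLeft_one_sub_headProj_mul (p : ℕ) (X : Matrix (Fin m) (Fin m) ℂ) :
    bottomLeft p ((1 - headProj m p) * X) = bottomLeft p X := by
  ext i j
  rw [bottomLeft, Matrix.toBlock_apply, sub_mul, one_mul, Matrix.sub_apply, headProj_mul_apply,
    if_neg (not_lt.2 i.2), sub_zero]
  rfl

/-- The block identity `C̃ = D̃ C (I - E)⁻¹`, written with the projection `P` so that all matrices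
keep their full size. -/
theorem one_sub_mul_mul_eq_of_inverse {R : Type*} [Ring R] {P W g ψ : R} (hP : P * P = P)
    (hψ : ψ * (1 - W) = 1) (hg : (1 - P * W * P) * g = 1) :
    (1 - P) * ψ * P = (1 - P) * (ψ * ((1 - P) * W * P) * g) := by
  have h1 : P * (1 - P * W * P) = (1 - W) * P + (1 - P) * W * P := by
    calc P * (1 - P * W * P) = P - (P * P) * W * P := by noncomm_ring
      _ = (1 - W) * P + (1 - P) * W * P := by rw [hP]; noncomm_ring
  have h2 : ψ * P = P * g + ψ * ((1 - P) * W * P) * g := by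
    calc ψ * P = ψ * P * ((1 - P * W * P) * g) := by rw [hg, mul_one]
      _ = ψ * (P * (1 - P * W * P)) * g := by noncomm_ring
      _ = (ψ * (1 - W)) * P * g + ψ * ((1 - P) * W * P) * g := by rw [h1]; noncomm_ring
      _ = _ := by rw [hψ, one_mul]
  calc (1 - P) * ψ * P = (1 - P) * (ψ * P) := by rw [mul_assoc]
    _ = (P - P * P) * g + (1 - P) * (ψ * ((1 - P) * W * P) * g) := by rw [h2]; noncomm_ring
    _ = _ := by rw [hP, sub_self, zero_mul, zero_add]

/-- The bottom left block of a real matrix, as a complex matrix of full size. -/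
def lowerCorner (p : ℕ) (A : Matrix (Fin m) (Fin m) ℝ) : Matrix (Fin m) (Fin m) ℂ :=
  (1 - headProj m p) * A.map Complex.ofReal * headProj m p

theorem lowerCorner_apply (p : ℕ) (A : Matrix (Fin m) (Fin m) ℝ) (i j : Fin m) :
    lowerCorner p A i j = if p ≤ i.val ∧ j.val < p then (A i j : ℂ) else 0 := by
  rw [lowerCorner, mul_headProj_apply, sub_mul, one_mul, Matrix.sub_apply, headProj_mul_apply]
  by_cases h1 : j.val < p <;> by_cases h2 : i.val < p <;> simp [h1, h2, not_le.2, not_lt.1]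

theorem norm_lowerCorner_le {A : Matrix (Fin m) (Fin m) ℝ} (hA : ∀ i j, 0 ≤ A i j) (p : ℕ) :
    ‖lowerCorner p A‖ ≤ ‖A‖ := by
  refine Matrix.norm_le_norm_of_dominated fun i j => ?_
  rw [lowerCorner_apply]
  split_ifs
  · rw [Complex.norm_real, Real.norm_of_nonneg (hA i j)]
  · rw [norm_zero]
    exact hA i j

/-- A real rank factorization of the block, padded with zeros, is a complex factorization of the
corner through the same inner dimension. -/
theorem rank_lowerCorner_le (p : ℕ) (A : Matrix (Fin m) (Fin m) ℝ) :
    (lowerCorner p A).rank ≤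
      (A.toBlock (fun i => p ≤ i.val) (fun j => j.val < p)).rank := by
  obtain ⟨U, V, h⟩ :=
    (A.toBlock (fun i : Fin m => p ≤ i.val) (fun j : Fin m => j.val < p)).exists_eq_mul_of_rank
  let U' : Matrix (Fin m) (Fin _) ℂ := Matrix.of fun i l =>
    if hi : p ≤ i.val then (U ⟨i, hi⟩ l : ℂ) else 0
  let V' : Matrix (Fin _) (Fin m) ℂ := Matrix.of fun l j =>
    if hj : j.val < p then (V l ⟨j, hj⟩ : ℂ) else 0
  have h1 : lowerCorner p A = U' * V' := by
    ext i j
    rw [lowerCorner_apply, Matrix.mul_apply]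
    by_cases hi : p ≤ i.val
    · by_cases hj : j.val < p
      · have h2 := congrFun (congrFun h ⟨i, hi⟩) ⟨j, hj⟩
        rw [Matrix.toBlock_apply, Matrix.mul_apply] at h2
        rw [if_pos ⟨hi, hj⟩, h2]
        simp [U', V', hi, hj]
      · simp [V', hj]
    · simp [U', hi]
  rw [h1]
  exact (Matrix.rank_mul_le_left _ _).trans (by simpa using Matrix.rank_le_card_width U')

/-- The matrix unit in the row `p` and the column `p - 1`. -/
def cornerUnit (m p : ℕ) : Matrix (Fin m) (Fin m) ℂ :=
  Matrix.vecMulVec (fun i => if i.val = p then 1 else 0) (fun j => if j.val + 1 = p then 1 else 0)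

/-- The unit does not depend on `A`, so the three corners of the symbol are proportional. -/
theorem exists_lowerCorner_eq_smul {A : Matrix (Fin m) (Fin m) ℝ} (hA : IsTridiagonal A) (p : ℕ) :
    ∃ c : ℂ, lowerCorner p A = c • cornerUnit m p := by
  by_cases hp : 0 < p ∧ p < m
  · refine ⟨A ⟨p, hp.2⟩ ⟨p - 1, by omega⟩, ?_⟩
    ext i j
    rw [lowerCorner_apply, Matrix.smul_apply, cornerUnit, Matrix.vecMulVec_apply]
    by_cases h : p ≤ i.val ∧ j.val < p
    · rw [if_pos h]
      by_cases h1 : i.val = p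
      · by_cases h2 : j.val + 1 = p
        · have e1 : i = ⟨p, hp.2⟩ := Fin.ext h1
          have e2 : j = ⟨p - 1, by omega⟩ := Fin.ext (by simp only; omega)
          rw [if_pos h1, if_pos h2, ← e1, ← e2]
          simp
        · rw [hA i j (Or.inr (by omega)), if_neg h2]
          simp
      · rw [hA i j (Or.inr (by omega)), if_neg h1]
        simp
    · rw [if_neg h]
      by_cases h1 : i.val = p
      · have h2 : ¬ j.val + 1 = p := by omega
        simp [h2]
      · simp [h1]
  · refine ⟨0, ?_⟩
    ext i j
    rw [lowerCorner_apply, zero_smul, if_neg (by omega)]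
    rfl

end Corner

/-! ### The corner of the inverse symbol, and its bounds on the annulus -/

namespace CRCoeffs

variable {m : ℕ}

theorem differentiableAt_phi (A : CRCoeffs m) {z : ℂ} (hz : z ≠ 0) :
    DifferentiableAt ℂ A.phi z := by
  unfold phi
  fun_prop (disch := assumption)

theorem differentiableAt_inv_apply {n : Type*} [Fintype n] [DecidableEq n]
    {F : ℂ → Matrix n n ℂ} {z : ℂ} (hF : DifferentiableAt ℂ F z) (hu : IsUnit (F z)) (i j : n) :
    DifferentiableAt ℂ (fun w => (F w)⁻¹ i j) z := by
  have h1 : DifferentiableAt ℂ (fun w => (F w)⁻¹) z := by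
    simp_rw [Matrix.nonsing_inv_eq_ringInverse]
    exact DifferentiableAt.comp z (differentiableAt_inverse hu) hF
  let e : Matrix n n ℂ →L[ℂ] ℂ := LinearMap.toContinuousLinearMap (Matrix.entryLinearMap ℂ ℂ i j)
  exact e.differentiableAt.comp z h1

/-- The inverse of `I - E(z)` bordered by an identity matrix. -/
noncomputable def headInv (A : CRCoeffs m) (p : ℕ) (z : ℂ) : Matrix (Fin m) (Fin m) ℂ :=
  (1 - headProj m p * (1 - A.phi z) * headProj m p)⁻¹

theorem bottomLeft_inv_phi {A : CRCoeffs m} {p : ℕ} {z : ℂ} (hu : IsUnit (A.phi z))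
    (hg : IsUnit (1 - headProj m p * (1 - A.phi z) * headProj m p)) :
    bottomLeft p (A.phi z)⁻¹ = bottomLeft p ((A.phi z)⁻¹ *
      (∑ i : Fin 3, z ^ (![-1, 0, 1] : Fin 3 → ℤ) i •
        (![lowerCorner p A.neg, lowerCorner p A.zero, lowerCorner p A.pos] :
          Fin 3 → Matrix (Fin m) (Fin m) ℂ) i) * A.headInv p z) := by
  have h1 := one_sub_mul_mul_eq_of_inverse (W := 1 - A.phi z) (headProj_mul_self (m := m) p)
    (ψ := (A.phi z)⁻¹) (g := A.headInv p z)
    (by rw [sub_sub_cancel]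
        exact Matrix.nonsing_inv_mul _ ((Matrix.isUnit_iff_isUnit_det _).1 hu))
    (Matrix.mul_nonsing_inv _ ((Matrix.isUnit_iff_isUnit_det _).1 hg))
  have h2 : (1 - headProj m p) * (1 - A.phi z) * headProj m p
      = ∑ i : Fin 3, z ^ (![-1, 0, 1] : Fin 3 → ℤ) i •
        (![lowerCorner p A.neg, lowerCorner p A.zero, lowerCorner p A.pos] :
          Fin 3 → Matrix (Fin m) (Fin m) ℂ) i := by
    rw [Fin.sum_univ_three, one_sub_phi]
    simp only [lowerCorner, Matrix.cons_val, zpow_neg_one, zpow_zero, zpow_one, one_smul]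
    rw [mul_add, mul_add, add_mul, add_mul, mul_smul_comm, mul_smul_comm, smul_mul_assoc,
      smul_mul_assoc]
  rw [h2] at h1
  rw [← bottomLeft_one_sub_headProj_mul, ← bottomLeft_mul_headProj, h1,
    bottomLeft_one_sub_headProj_mul]

variable {A : CRCoeffs m} {t δ : ℝ}

theorem Nonneg.analyticBounded_inv_phi
    (ht : 1 < t) (hinv : ∀ z ∈ annulus t, (A.phi z).det ≠ 0 ∧ ‖(A.phi z)⁻¹‖ ≤ δ) :
    AnalyticBounded t δ fun z => (A.phi z)⁻¹ where
  differentiableAt i j z hz := by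
    have hz0 : z ≠ 0 := norm_pos_iff.1 (lt_trans (inv_pos.2 (by linarith)) hz.1)
    exact differentiableAt_inv_apply (A.differentiableAt_phi hz0)
      ((Matrix.isUnit_iff_isUnit_det _).2 (IsUnit.mk0 _ (hinv z hz).1)) i j
  norm_le z hz := (hinv z hz).2

theorem isUnit_one_sub_head_of_dominated {W Y : Matrix (Fin m) (Fin m) ℝ} {E : Matrix (Fin m) (Fin m) ℂ}
    (p : ℕ) (hE : ∀ i j, ‖E i j‖ ≤ W i j) (hW : ∀ i j, 0 ≤ W i j) (hY : ∀ i j, 0 ≤ Y i j)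
    (h : Y * (1 - W) = 1) :
    IsUnit (1 - headProj m p * E * headProj m p) ∧
      ∀ i j, ‖(1 - headProj m p * E * headProj m p)⁻¹ i j‖ ≤ Y i j := by
  refine Matrix.isUnit_one_sub_of_dominated (Function.Embedding.refl _) (fun i j => ?_) hW hY h
  rw [mul_headProj_apply, headProj_mul_apply]
  split_ifs
  · exact hE i j
  · rw [norm_zero]
    exact hW i j
  · rw [norm_zero]
    exact hW i j

end CRCoeffs

/-- The hypotheses of the decay theorem on the annulus. -/
structure CRCoeffs.AnnulusBound {m : ℕ} (A : CRCoeffs m) (t δ : ℝ) : Prop extends A.Nonneg where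
  one_lt : 1 < t
  spectralRadius_lt : spectralRadius ℂ (1 - A.phi 1) < 1
  inv_le : ∀ z ∈ annulus t, (A.phi z).det ≠ 0 ∧ ‖(A.phi z)⁻¹‖ ≤ δ

namespace CRCoeffs.AnnulusBound

variable {m : ℕ} {A : CRCoeffs m} {t δ : ℝ}

/-- Collects what is known at the positive real point of a circle; domination transfers it to the
whole circle. -/
theorem inv_iter (hA : A.AnnulusBound t δ) {r : ℝ} (hr : r ∈ Set.Ioo t⁻¹ t) :
    (∀ i j, 0 ≤ (1 - A.iter r)⁻¹ i j) ∧ (1 - A.iter r)⁻¹ * (1 - A.iter r) = 1 ∧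
      ‖(1 - A.iter r)⁻¹‖ ≤ δ := by
  have ht0 : 0 < t := lt_trans one_pos hA.one_lt
  have hmem : ∀ r ∈ Set.Ioo t⁻¹ t, (r : ℂ) ∈ annulus t := by
    intro r hr
    have hr0 : 0 < r := lt_trans (inv_pos.2 ht0) hr.1
    have h1 : ‖(r : ℂ)‖ = r := by rw [Complex.norm_real, Real.norm_of_nonneg hr0.le]
    exact ⟨by rw [h1]; exact hr.1, by rw [h1]; exact hr.2⟩
  have hdet : ∀ r ∈ Set.Ioo t⁻¹ t, (1 - A.iter r).det ≠ 0 := by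
    intro r hr h0
    refine (hA.inv_le r (hmem r hr)).1 ?_
    rw [det_phi_ofReal, h0, Complex.ofReal_zero]
  refine ⟨hA.toNonneg.inv_one_sub_iter_nonneg hA.one_lt hdet hA.spectralRadius_lt r hr,
    Matrix.nonsing_inv_mul _ (IsUnit.mk0 _ (hdet r hr)), ?_⟩
  have h1 := hA.inv_le r (hmem r hr)
  rw [inv_phi_ofReal A h1.1] at h1
  exact (Matrix.norm_le_norm_map_ofReal _).trans h1.2

theorem norm_mem {z : ℂ} (hz : z ∈ annulus t) : ‖z‖ ∈ Set.Ioo t⁻¹ t := hz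

theorem subcritical (hA : A.AnnulusBound t δ) : A.Subcritical := by
  obtain ⟨h1, h2, -⟩ := hA.inv_iter (r := 1) ⟨inv_lt_one_of_one_lt₀ hA.one_lt, hA.one_lt⟩
  exact ⟨hA.toNonneg, _, h1, h2⟩

theorem spectralRadius_lt_one (hA : A.AnnulusBound t δ) {z : ℂ} (hz : z ∈ annulus t) :
    spectralRadius ℂ (1 - A.phi z) < 1 := by
  obtain ⟨h1, h2, -⟩ := hA.inv_iter (norm_mem hz)
  exact Matrix.spectralRadius_lt_one_of_dominated (hA.norm_one_sub_phi_le z)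
    (hA.iter_nonneg (norm_nonneg z)) h1 h2

theorem isUnit_toBlock (hA : A.AnnulusBound t δ) {z : ℂ} (hz : z ∈ annulus t) (q : Fin m → Prop)
    [DecidablePred q] : IsUnit ((A.phi z).toBlock q q) := by
  obtain ⟨h1, h2, -⟩ := hA.inv_iter (norm_mem hz)
  have h3 := (Matrix.isUnit_one_sub_of_dominated (E := (1 - A.phi z).toBlock q q)
    (Function.Embedding.subtype q) (fun i j => hA.norm_one_sub_phi_le z i j)
    (hA.iter_nonneg (norm_nonneg z)) h1 h2).1
  have h4 : 1 - (1 - A.phi z).toBlock q q = (A.phi z).toBlock q q := by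
    ext i j
    simp [Matrix.one_apply, Subtype.ext_iff]
  rwa [h4] at h3

theorem isUnit_head (hA : A.AnnulusBound t δ) (p : ℕ) {z : ℂ} (hz : z ∈ annulus t) :
    IsUnit (1 - headProj m p * (1 - A.phi z) * headProj m p) := by
  obtain ⟨h1, h2, -⟩ := hA.inv_iter (norm_mem hz)
  exact (isUnit_one_sub_head_of_dominated p (hA.norm_one_sub_phi_le z)
    (hA.iter_nonneg (norm_nonneg z)) h1 h2).1

/-- The given bound concerns `φ⁻¹` only. The bordered inverse of `I - E(z)` obeys the same bound
because it is dominated entrywise by `(1 - A.iter ‖z‖)⁻¹`, whose norm is at most `δ`. -/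
theorem analyticBounded_headInv (hA : A.AnnulusBound t δ) (p : ℕ) :
    AnalyticBounded t δ (A.headInv p) where
  differentiableAt i j z hz := by
    have hz0 : z ≠ 0 :=
      norm_pos_iff.1 (lt_trans (inv_pos.2 (lt_trans one_pos hA.one_lt)) hz.1)
    refine differentiableAt_inv_apply
      (F := fun z => 1 - headProj m p * (1 - A.phi z) * headProj m p) ?_ (hA.isUnit_head p hz) i j
    exact ((((A.differentiableAt_phi hz0).const_sub 1).const_mul _).mul_const _).const_sub 1
  norm_le z hz := by
    obtain ⟨h1, h2, h3⟩ := hA.inv_iter (norm_mem hz)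
    refine (Matrix.norm_le_norm_of_dominated ?_).trans h3
    exact (isUnit_one_sub_head_of_dominated p (hA.norm_one_sub_phi_le z)
      (hA.iter_nonneg (norm_nonneg z)) h1 h2).2

/-- The bottom left block after `h` steps of cyclic reduction, in terms of residue parts. -/
theorem bottomLeft_inv_phi_cr (hA : A.AnnulusBound t δ) (p h : ℕ) {ζ w : ℂ}
    (hζ : IsPrimitiveRoot ζ (2 ^ h)) (hw : ‖w‖ = 1) :
    bottomLeft p ((A.cr h).phi (w ^ 2 ^ h))⁻¹ = bottomLeft p
      (∑ i : Fin 3, w ^ (![-1, 0, 1] : Fin 3 → ℤ) i • ∑ r ∈ Finset.range (2 ^ h),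
        residuePart (2 ^ h) ζ (fun z => (A.phi z)⁻¹) (-(r + (![-1, 0, 1] : Fin 3 → ℤ) i)) w *
        (![lowerCorner p A.neg, lowerCorner p A.zero, lowerCorner p A.pos] :
          Fin 3 → Matrix (Fin m) (Fin m) ℂ) i * residuePart (2 ^ h) ζ (A.headInv p) r w) := by
  have hN : 0 < 2 ^ h := by positivity
  have hti : t⁻¹ < 1 := inv_lt_one_of_one_lt₀ hA.one_lt
  have hmem : ∀ j : ℕ, ζ ^ j * w ∈ annulus t := by
    intro j
    have h1 : ‖ζ ^ j * w‖ = 1 := by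
      rw [norm_mul, norm_pow, hζ.norm'_eq_one hN.ne', one_pow, hw, one_mul]
    exact ⟨by rwa [h1], by rw [h1]; exact hA.one_lt⟩
  rw [← average_mul_mul_eq hN hζ, hA.subcritical.inv_phi_cr_pow h hζ hw]
  have key : ∀ (a : ℂ) (X Y : ℕ → Matrix (Fin m) (Fin m) ℂ),
      (∀ j, bottomLeft p (X j) = bottomLeft p (Y j)) →
      bottomLeft p (a • ∑ j ∈ Finset.range (2 ^ h), X j)
        = bottomLeft p (a • ∑ j ∈ Finset.range (2 ^ h), Y j) := by
    intro a X Y hXY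
    ext i k
    have h1 : ∀ j, X j i k = Y j i k := fun j => congrFun (congrFun (hXY j) i) k
    simp only [bottomLeft, Matrix.toBlock_apply, Matrix.smul_apply, Matrix.sum_apply, h1]
  exact key _ _ _ fun j => bottomLeft_inv_phi ((Matrix.isUnit_iff_isUnit_det _).2
    (IsUnit.mk0 _ (hA.inv_le _ (hmem j)).1)) (hA.isUnit_head p (hmem j))

/-- Decimation of the Laurent series of the bottom left block is what cyclic reduction computes. -/
theorem decimate_eq (hA : A.AnnulusBound t δ) (p h : ℕ) {ζ w : ℂ}
    (hζ : IsPrimitiveRoot ζ (2 ^ h)) (hw : ‖w‖ = 1) :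
    decimate (2 ^ h) (fun w => bottomLeft p (A.phi w)⁻¹) (w ^ 2 ^ h)
      = bottomLeft p ((A.cr h).phi (w ^ 2 ^ h))⁻¹ := by
  have hB := Nonneg.analyticBounded_inv_phi hA.one_lt hA.inv_le
  rw [hA.subcritical.inv_phi_cr_pow h hζ hw]
  ext i j
  have hent : ∀ z ∈ annulus t, ‖(A.phi z)⁻¹ i j‖ ^ 2 ≤ δ ^ 2 := by
    intro z hz
    refine pow_le_pow_left₀ (norm_nonneg _) (le_trans ?_ (hB.norm_le z hz)) 2
    have h1 := norm_dotProduct_mulVec_le (A.phi z)⁻¹ (Pi.single (i : Fin m) 1)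
      (Pi.single (j : Fin m) 1)
    have h2 : ∀ k : Fin m, l2norm (Pi.single k (1 : ℂ)) = 1 := by
      intro k
      rw [l2norm, Finset.sum_eq_single k]
      · simp
      · intro b _ hb
        simp [hb]
      · simp
    rw [h2, h2] at h1
    simpa using h1
  have h1 := (hasSum_average hA.one_lt (hB.differentiableAt i j) hent
    (by positivity : 0 < 2 ^ h) hζ hw).tsum_eq
  have h2 : decimate (2 ^ h) (fun w => bottomLeft p (A.phi w)⁻¹) (w ^ 2 ^ h) i j
      = ∑' n : ℤ, (w ^ 2 ^ h) ^ n * scalarLaurentCoeff (fun z => (A.phi z)⁻¹ i j)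
        (((2 ^ h : ℕ) : ℤ) * n) := rfl
  rw [h2, h1]
  simp only [bottomLeft, Matrix.toBlock_apply, Matrix.smul_apply, Matrix.sum_apply, smul_eq_mul]

end CRCoeffs.AnnulusBound

/-! ### Energy bounds for families of residue classes -/

section ResidueBounds

variable {t : ℝ} {N : ℕ} {S : Finset ℕ} {ρ : ℕ → ℤ}

theorem one_sub_sq_pow_pos {x : ℝ} (hx0 : 0 < x) (hx1 : x < 1) (hN : 0 < N) :
    0 < 1 - (x ^ N) ^ 2 := by
  have h1 : x ^ N < 1 := pow_lt_one₀ hx0.le hx1 hN.ne'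
  have h2 : (x ^ N) ^ 2 < 1 := pow_lt_one₀ (by positivity) h1 two_ne_zero
  linarith

theorem eq_of_dvd_sub_of_lt {a b : ℕ} (ha : a < N) (hb : b < N) (h : (N : ℤ) ∣ (a : ℤ) - b) :
    a = b := by
  have := Int.eq_zero_of_abs_lt_dvd h (by rw [abs_lt]; constructor <;> omega)
  omega

theorem residueBound_all (ht : 1 < t) (hN : 0 < N) (hS : S ⊆ Finset.range N)
    (hρ : ∀ a b : ℕ, (N : ℤ) ∣ ρ a - ρ b → (N : ℤ) ∣ (a : ℤ) - b) :
    ResidueBound t N S ρ ((1 + t⁻¹ ^ N) / √(1 - (t⁻¹ ^ N) ^ 2)) := by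
  have hx0 : 0 < t⁻¹ := inv_pos.2 (lt_trans one_pos ht)
  have hx1 : t⁻¹ < 1 := inv_lt_one_of_one_lt₀ ht
  have h1 := one_sub_sq_pow_pos hx0 hx1 hN
  refine ⟨by positivity, fun a ha b hb h => eq_of_dvd_sub_of_lt (Finset.mem_range.1 (hS ha))
    (Finset.mem_range.1 (hS hb)) (hρ a b h), fun a _ s => ?_⟩
  refine (sum_inv_laurentWeight_le_of_residue ht hN (ρ a) s).trans (le_of_eq ?_)
  have hy1 : t⁻¹ ^ N < 1 := pow_lt_one₀ hx0.le hx1 hN.ne'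
  rw [div_pow, Real.sq_sqrt h1.le]
  set y := t⁻¹ ^ N with hy
  have hy0 : 0 < y := by positivity
  have h2 : 0 < 1 - y := by linarith
  have h3 : 1 - y ^ 2 = (1 - y) * (1 + y) := by ring
  rw [h3]
  field_simp

theorem residueBound_tail (ht : 1 < t) (hN : 0 < N) (hS : S ⊆ Finset.range N)
    (hρ : ∀ a b : ℕ, (N : ℤ) ∣ ρ a - ρ b → (N : ℤ) ∣ (a : ℤ) - b) {q : ℕ}
    (hq : ∀ a ∈ S, ∃ d : ℕ, q < d ∧ d + q < N ∧ (N : ℤ) ∣ d - ρ a) :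
    ResidueBound t N S ρ (2 * t⁻¹ ^ (q + 1) / √(1 - (t⁻¹ ^ N) ^ 2)) := by
  have hx0 : 0 < t⁻¹ := inv_pos.2 (lt_trans one_pos ht)
  have hx1 : t⁻¹ < 1 := inv_lt_one_of_one_lt₀ ht
  have h1 := one_sub_sq_pow_pos hx0 hx1 hN
  refine ⟨by positivity, fun a ha b hb h => eq_of_dvd_sub_of_lt (Finset.mem_range.1 (hS ha))
    (Finset.mem_range.1 (hS hb)) (hρ a b h), fun a ha s => ?_⟩
  obtain ⟨d, hd1, hd2, hd3⟩ := hq a ha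
  refine (sum_inv_laurentWeight_le ht hN (by omega : d ≤ N) hd3 s).trans ?_
  rw [div_pow, Real.sq_sqrt h1.le, div_div, mul_comm _ (2 : ℝ), ← div_div]
  refine div_le_div_of_nonneg_right ?_ h1.le
  have h2 : t⁻¹ ^ d ≤ t⁻¹ ^ (q + 1) := pow_le_pow_of_le_one hx0.le hx1.le (by omega)
  have h3 : t⁻¹ ^ (N - d) ≤ t⁻¹ ^ (q + 1) := pow_le_pow_of_le_one hx0.le hx1.le (by omega)
  have h4 := pow_le_pow_left₀ (by positivity) h2 2
  have h5 := pow_le_pow_left₀ (by positivity) h3 2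
  rw [mul_pow]
  linarith

theorem exists_residue_pos (hN : 0 < N) {r : ℤ} (hr : ¬ (N : ℤ) ∣ r) :
    ∃ d : ℕ, 0 < d ∧ d < N ∧ (N : ℤ) ∣ d - r := by
  have h1 := Int.emod_nonneg r (show (N : ℤ) ≠ 0 by omega)
  have h2 := Int.emod_lt_of_pos r (show (0 : ℤ) < N by omega)
  have h3 := Int.emod_add_mul_ediv r N
  have h4 : r % N ≠ 0 := fun h => hr (Int.dvd_of_emod_eq_zero h)
  refine ⟨(r % N).toNat, by omega, by omega, ⟨-(r / N), ?_⟩⟩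
  rw [Int.toNat_of_nonneg h1]
  linarith

theorem residueBound_nonzero (ht : 1 < t) (hN : 0 < N) (hS : S ⊆ Finset.range N)
    (hρ : ∀ a b : ℕ, (N : ℤ) ∣ ρ a - ρ b → (N : ℤ) ∣ (a : ℤ) - b)
    (hnz : ∀ a ∈ S, ¬ (N : ℤ) ∣ ρ a) :
    ResidueBound t N S ρ (2 * t⁻¹ / √(1 - (t⁻¹ ^ N) ^ 2)) := by
  have h := residueBound_tail ht hN hS hρ (q := 0) fun a ha => by
    simpa using exists_residue_pos hN (hnz a ha)
  simpa using h

/-- For `N ≥ 4` and `0 < d < N` one of `d`, `N - d` is at least `3`, or both are at least `2`. So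
the worst numerator is `x² + x⁶` instead of `2x²`, where `x = t⁻¹`; the odd tridiagonal case needs
this gain. -/
theorem residueBound_nonzero_of_four_le (ht : 1 < t) (hN : 4 ≤ N) (hS : S ⊆ Finset.range N)
    (hρ : ∀ a b : ℕ, (N : ℤ) ∣ ρ a - ρ b → (N : ℤ) ∣ (a : ℤ) - b)
    (hnz : ∀ a ∈ S, ¬ (N : ℤ) ∣ ρ a) :
    ResidueBound t N S ρ (√(2 * t⁻¹ ^ 2 * (1 + t⁻¹ ^ 4)) / √(1 - (t⁻¹ ^ N) ^ 2)) := by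
  have hx0 : 0 < t⁻¹ := inv_pos.2 (lt_trans one_pos ht)
  have hx1 : t⁻¹ < 1 := inv_lt_one_of_one_lt₀ ht
  have h1 := one_sub_sq_pow_pos hx0 hx1 (by omega : 0 < N)
  refine ⟨by positivity, fun a ha b hb h => eq_of_dvd_sub_of_lt (Finset.mem_range.1 (hS ha))
    (Finset.mem_range.1 (hS hb)) (hρ a b h), fun a ha s => ?_⟩
  obtain ⟨d, hd1, hd2, hd3⟩ := exists_residue_pos (by omega : 0 < N) (hnz a ha)
  refine (sum_inv_laurentWeight_le ht (by omega) hd2.le hd3 s).trans ?_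
  rw [div_pow, Real.sq_sqrt h1.le, Real.sq_sqrt (by positivity), div_div, mul_comm _ (2 : ℝ),
    ← div_div]
  refine div_le_div_of_nonneg_right ?_ h1.le
  set x := t⁻¹
  have hpow : ∀ {k l : ℕ}, l ≤ k → x ^ k ≤ x ^ l := fun {k l} h =>
    pow_le_pow_of_le_one hx0.le hx1.le h
  have hsq : ∀ {k l : ℕ}, l ≤ k → (x ^ k) ^ 2 ≤ (x ^ l) ^ 2 := fun {k l} h =>
    pow_le_pow_left₀ (by positivity) (hpow h) 2
  have h6 : 2 * x ^ 2 * (1 + x ^ 4) / 2 = (x ^ 1) ^ 2 + (x ^ 3) ^ 2 := by ring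
  rw [h6]
  rcases Nat.lt_or_ge d 3 with hd | hd
  · rcases Nat.lt_or_ge d 2 with hd' | hd'
    · exact add_le_add (hsq (by omega)) (hsq (by omega))
    · have h7 := hsq (show 2 ≤ d by omega)
      have h8 := hsq (show 2 ≤ N - d by omega)
      -- For `d ≥ 2` and `N - d ≥ 2` the numerator is at most `2x⁴ ≤ x² + x⁶`; the difference is the
      -- square `(x(1 - x²))²`.
      nlinarith [sq_nonneg (x * (1 - x ^ 2))]
  · rw [add_comm ((x ^ d) ^ 2)]
    exact add_le_add (hsq (by omega)) (hsq (by omega))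

end ResidueBounds

/-! ### Numerical inequalities, with `x = t⁻¹`, `y = t⁻¹ ^ N` and `Δ² = 1 - y²` -/

section NumericBounds

variable {x y Δ : ℝ}

theorem kappa_mul_kappa_le (hx0 : 0 < x) (hx1 : x < 1) (hy0 : 0 < y) (hy1 : y < 1)
    (hΔ : 0 < Δ) (hΔ2 : Δ ^ 2 = 1 - y ^ 2) :
    3 * ((1 + y) / Δ) * ((1 + y) / Δ) ≤ 3 * (4 / ((1 - y) * (1 - x))) := by
  have h1 : 0 < 1 - x := by linarith
  have h2 : 0 < 1 - y := by linarith
  have h3 : 3 * ((1 + y) / Δ) * ((1 + y) / Δ) = 3 * ((1 + y) / (1 - y)) := by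
    have : Δ ^ 2 = (1 - y) * (1 + y) := by rw [hΔ2]; ring
    field_simp
    rw [this]
    field_simp
  rw [h3]
  refine mul_le_mul_of_nonneg_left ?_ (by norm_num)
  rw [div_le_div_iff₀ h2 (by positivity)]
  nlinarith [mul_pos h2 h1, mul_pos h2 hx0, mul_pos hy0 h2]

theorem kappa_mul_kappa_le_of_le (hx1 : x < 1) (hy0 : 0 < y) (hyx : y ≤ x)
    (hΔ : 0 < Δ) (hΔ2 : Δ ^ 2 = 1 - y ^ 2) :
    3 * ((1 + y) / Δ) * ((1 + y) / Δ) ≤ 4 / ((1 - y) * (1 - x)) := by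
  have h1 : 0 < 1 - x := by linarith
  have h2 : 0 < 1 - y := by linarith
  have h3 : 3 * ((1 + y) / Δ) * ((1 + y) / Δ) = 3 * ((1 + y) / (1 - y)) := by
    have : Δ ^ 2 = (1 - y) * (1 + y) := by rw [hΔ2]; ring
    field_simp
    rw [this]
    field_simp
  rw [h3, ← mul_div_assoc, div_le_div_iff₀ h2 (by positivity)]
  have h4 : 3 * (1 + y) * (1 - x) ≤ 4 := by nlinarith
  nlinarith

theorem kappa_mul_tail_le (hx0 : 0 < x) (hx1 : x < 1) (hy0 : 0 < y) (hy1 : y < 1)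
    (hΔ : 0 < Δ) (hΔ2 : Δ ^ 2 = 1 - y ^ 2) {a : ℝ} (ha : 0 ≤ a) :
    3 * ((1 + y) / Δ) * (2 * a / Δ) ≤ 3 * (4 / ((1 - y) * (1 - x))) * a := by
  have h1 : 0 < 1 - x := by linarith
  have h2 : 0 < 1 - y := by linarith
  have h3 : 3 * ((1 + y) / Δ) * (2 * a / Δ) = 3 * (2 / (1 - y)) * a := by
    have : Δ ^ 2 = (1 - y) * (1 + y) := by rw [hΔ2]; ring
    field_simp
    rw [this]
    field_simp
  rw [h3]
  refine mul_le_mul_of_nonneg_right ?_ ha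
  refine mul_le_mul_of_nonneg_left ?_ (by norm_num)
  rw [div_le_div_iff₀ h2 (by positivity)]
  nlinarith [mul_pos h2 h1, mul_pos h2 hx0]

theorem kappa_add_tail_mul_tail_le (hx0 : 0 < x) (hx1 : x < 1) (hy0 : 0 < y) (hy1 : y < 1)
    (hΔ : 0 < Δ) (hΔ2 : Δ ^ 2 = 1 - y ^ 2) :
    ((1 + y) / Δ + 2 * x / Δ + (1 + y) / Δ) * (2 * x / Δ) ≤ 4 / ((1 - y) * (1 - x)) * x := by
  have h1 : 0 < 1 - x := by linarith
  have h2 : 0 < 1 - y := by linarith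
  have h3 : ((1 + y) / Δ + 2 * x / Δ + (1 + y) / Δ) * (2 * x / Δ)
      = 4 * (1 + y + x) / (1 - y ^ 2) * x := by
    rw [← hΔ2]
    field_simp
    ring
  rw [h3]
  refine mul_le_mul_of_nonneg_right ?_ hx0.le
  have h4 : 1 - y ^ 2 = (1 - y) * (1 + y) := by ring
  rw [h4, div_le_div_iff₀ (by positivity) (by positivity)]
  have h5 : (1 + y + x) * (1 - x) ≤ 1 + y := by nlinarith [mul_pos hx0 hy0]
  nlinarith

theorem tail_mul_tail_le (hx0 : 0 < x) (hx1 : x < 1) (hy0 : 0 < y) (hy1 : y < 1)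
    (hΔ : 0 < Δ) (hΔ2 : Δ ^ 2 = 1 - y ^ 2) {a : ℝ} (ha : 0 ≤ a) :
    (2 * x / Δ + 2 * x / Δ + 2 * x / Δ) * (2 * a / Δ) ≤ 4 / ((1 - y) * (1 - x)) * a := by
  have h1 : 0 < 1 - x := by linarith
  have h2 : 0 < 1 - y := by linarith
  have h3 : (2 * x / Δ + 2 * x / Δ + 2 * x / Δ) * (2 * a / Δ)
      = 12 * x / (1 - y ^ 2) * a := by
    rw [← hΔ2]
    field_simp
    ring
  rw [h3]
  refine mul_le_mul_of_nonneg_right ?_ ha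
  have h4 : 1 - y ^ 2 = (1 - y) * (1 + y) := by ring
  rw [h4, div_le_div_iff₀ (by positivity) (by positivity)]
  have h5 : 3 * x * (1 - x) ≤ 1 + y := by nlinarith [sq_nonneg (2 * x - 1)]
  nlinarith

theorem nonzero_mul_tail_le (hx0 : 0 < x) (hx1 : x < 1) (hy0 : 0 < y) (hy1 : y < 1)
    (hΔ : 0 < Δ) (hΔ2 : Δ ^ 2 = 1 - y ^ 2) {a : ℝ} (ha : 0 ≤ a) :
    3 * (√(2 * x ^ 2 * (1 + x ^ 4)) / Δ) * (2 * a / Δ)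
      ≤ 4 / ((1 - y) * (1 - x)) * (a * √x) := by
  have h1 : 0 < 1 - x := by linarith
  have h2 : 0 < 1 - y := by linarith
  set u := √(2 * x ^ 2 * (1 + x ^ 4)) with hu
  have hu2 : u ^ 2 = 2 * x ^ 2 * (1 + x ^ 4) := Real.sq_sqrt (by positivity)
  have hu0 : 0 ≤ u := Real.sqrt_nonneg _
  have hv2 : √x ^ 2 = x := Real.sq_sqrt hx0.le
  have hv0 : 0 ≤ √x := Real.sqrt_nonneg _
  have h5 : 3 * u * (1 - x) ≤ 2 * √x := by
    refine (sq_le_sq₀ (by positivity) (by positivity)).1 ?_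
    rw [mul_pow, mul_pow, mul_pow, hu2, hv2]
    -- The maximum, attained at `x = 1/3`. It leaves exactly `2 / 27` of the `2 / 9` allowed in
    -- `h11`.
    have h6 : x * (1 - x) ^ 2 ≤ 4 / 27 := by nlinarith [sq_nonneg (3 * x - 1)]
    have h7 : x ^ 5 * (1 - x) ^ 2 ≤ 2 / 27 := by
      have h8 : x * (1 - x) ≤ 1 / 4 := by nlinarith [sq_nonneg (2 * x - 1)]
      have h9 : (x * (1 - x)) ^ 2 ≤ (1 / 4) ^ 2 :=
        pow_le_pow_left₀ (by positivity) h8 2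
      have h10 : x ^ 3 ≤ 1 := pow_le_one₀ hx0.le hx1.le
      calc x ^ 5 * (1 - x) ^ 2 = x ^ 3 * (x * (1 - x)) ^ 2 := by ring
        _ ≤ 1 * (1 / 4) ^ 2 := mul_le_mul h10 h9 (by positivity) zero_le_one
        _ ≤ 2 / 27 := by norm_num
    have h11 : 9 * (x * (1 - x) ^ 2 + x ^ 5 * (1 - x) ^ 2) ≤ 2 := by linarith
    calc 3 ^ 2 * (2 * x ^ 2 * (1 + x ^ 4)) * (1 - x) ^ 2
        = 2 * x * (9 * (x * (1 - x) ^ 2 + x ^ 5 * (1 - x) ^ 2)) := by ring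
      _ ≤ 2 * x * 2 := by gcongr
      _ = 2 ^ 2 * x := by ring
  have h3 : 3 * (u / Δ) * (2 * a / Δ) = 6 * u / (1 - y ^ 2) * a := by
    rw [← hΔ2]
    field_simp
    ring
  have h4 : 4 / ((1 - y) * (1 - x)) * (a * √x) = 4 * √x / ((1 - y) * (1 - x)) * a := by ring
  rw [h3, h4]
  refine mul_le_mul_of_nonneg_right ?_ ha
  have h6 : 1 - y ^ 2 = (1 - y) * (1 + y) := by ring
  rw [h6, div_le_div_iff₀ (by positivity) (by positivity)]
  have h7 : 6 * u * (1 - x) ≤ 4 * √x * (1 + y) := by nlinarith [mul_nonneg hv0 hy0.le]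
  nlinarith

end NumericBounds

/-! ### Ranks of the discarded terms -/

section RankBounds

variable {n ι : Type*} [Fintype n] [DecidableEq n] [Fintype ι]

omit [DecidableEq n] in
theorem rank_sum_smul_sum_mul_mul_le (c : ι → ℂ) (S : Finset ℕ)
    (D : ι → ℕ → Matrix n n ℂ) (C : ι → Matrix n n ℂ) (G : ℕ → Matrix n n ℂ) {k : ℕ}
    (hC : ∀ i, (C i).rank ≤ k) :
    (∑ i, c i • ∑ r ∈ S, D i r * C i * G r).rank ≤ Fintype.card ι * (S.card * k) := by
  refine Matrix.rank_sum_le _ _ fun i _ => (Matrix.rank_smul_le _ _).trans ?_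
  refine Matrix.rank_sum_le _ _ fun r _ => ?_
  exact (Matrix.rank_mul_le_left _ _).trans ((Matrix.rank_mul_le_right _ _).trans (hC i))

/-- For fixed `r` the terms share `E` and `G r`, so they merge into one product through `E`: rank
one per class. -/
theorem rank_sum_smul_sum_mul_mul_le_card (c : ι → ℂ) (S : Finset ℕ)
    (D : ι → ℕ → Matrix n n ℂ) (C : ι → Matrix n n ℂ) (G : ℕ → Matrix n n ℂ) {E : Matrix n n ℂ}
    (hE : E.rank ≤ 1) {a : ι → ℂ} (hC : ∀ i, C i = a i • E) :
    (∑ i, c i • ∑ r ∈ S, D i r * C i * G r).rank ≤ S.card := by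
  have h1 : ∑ i, c i • ∑ r ∈ S, D i r * C i * G r
      = ∑ r ∈ S, (∑ i, (c i * a i) • D i r) * E * G r := by
    simp_rw [Finset.smul_sum]
    rw [Finset.sum_comm]
    refine Finset.sum_congr rfl fun r _ => ?_
    rw [Finset.sum_mul, Finset.sum_mul]
    refine Finset.sum_congr rfl fun i _ => ?_
    rw [hC i, mul_smul_comm, smul_mul_assoc, smul_smul, smul_mul_assoc, smul_mul_assoc]
  rw [h1, ← mul_one S.card]
  refine Matrix.rank_sum_le _ _ fun r _ => ?_
  exact (Matrix.rank_mul_le_left _ _).trans ((Matrix.rank_mul_le_right _ _).trans hE)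

/-- With equal left factors, `D0 * E` can be pulled out of the whole sum, whatever the right factors
are. -/
theorem rank_sum_smul_sum_const_mul_mul_le_one (c : ι → ℂ) (S : ι → Finset ℕ)
    (D : ι → ℕ → Matrix n n ℂ) {D0 : Matrix n n ℂ} (hD : ∀ i, ∀ r ∈ S i, D i r = D0)
    (C : ι → Matrix n n ℂ) (G : ℕ → Matrix n n ℂ) {E : Matrix n n ℂ}
    (hE : E.rank ≤ 1) {a : ι → ℂ} (hC : ∀ i, C i = a i • E) :
    (∑ i, c i • ∑ r ∈ S i, D i r * C i * G r).rank ≤ 1 := by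
  have h1 : ∑ i, c i • ∑ r ∈ S i, D i r * C i * G r
      = D0 * E * ∑ i, ((c i * a i) • ∑ r ∈ S i, G r : Matrix n n ℂ) := by
    rw [Finset.mul_sum]
    refine Finset.sum_congr rfl fun i _ => ?_
    rw [mul_smul_comm, ← smul_smul, Finset.mul_sum, Finset.smul_sum (r := a i)]
    refine congrArg (c i • ·) (Finset.sum_congr rfl fun r hr => ?_)
    rw [hD i r hr, hC i, mul_smul_comm, smul_mul_assoc]
  rw [h1]
  exact (Matrix.rank_mul_le_left _ _).trans ((Matrix.rank_mul_le_right _ _).trans hE)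

end RankBounds

/-! ### Residue classes far from zero, and exponential forms of the constants -/

section TailRange

/-- The residues modulo `N` at distance more than `q` from `0`. -/
def tailRange (N q : ℕ) : Finset ℕ := (Finset.range N).filter fun r => q < r ∧ r + q < N

theorem tailRange_subset (N q : ℕ) : tailRange N q ⊆ Finset.range N := Finset.filter_subset _ _

theorem card_sdiff_tailRange_le (N q : ℕ) :
    (Finset.range N \ tailRange N q).card ≤ 2 * q + 1 := by
  have h1 : Finset.range N \ tailRange N q ⊆ Finset.range (q + 1) ∪ Finset.Ico (N - q) N := by
    intro r hr
    simp only [tailRange, Finset.mem_sdiff, Finset.mem_filter, Finset.mem_range, Finset.mem_union,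
      Finset.mem_Ico] at hr ⊢
    omega
  refine (Finset.card_le_card h1).trans ((Finset.card_union_le _ _).trans ?_)
  rw [Finset.card_range, Nat.card_Ico]
  omega

theorem dvd_sub_of_dvd_neg_add_sub {N : ℕ} (c : ℤ) (a b : ℕ)
    (h : (N : ℤ) ∣ -((a : ℤ) + c) - -((b : ℤ) + c)) : (N : ℤ) ∣ (a : ℤ) - b := by
  have h1 : -((a : ℤ) + c) - -((b : ℤ) + c) = -((a : ℤ) - b) := by ring
  rwa [h1, dvd_neg] at h

theorem residueBound_tailRange {t : ℝ} (ht : 1 < t) {N : ℕ} (hN : 0 < N) (q : ℕ) {S : Finset ℕ}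
    (hS : S ⊆ tailRange N q) :
    ResidueBound t N S (fun r => r) (2 * t⁻¹ ^ (q + 1) / √(1 - (t⁻¹ ^ N) ^ 2)) := by
  refine residueBound_tail ht hN (hS.trans (tailRange_subset N q)) (fun a b h => h) fun a ha => ?_
  have h1 := (Finset.mem_filter.1 (hS ha)).2
  exact ⟨a, h1.1, h1.2, by simp⟩

theorem not_dvd_neg_add {N q r : ℕ} (hr : r ∈ tailRange N q) {c : ℤ} (hc : |c| ≤ q) :
    ¬ (N : ℤ) ∣ -((r : ℤ) + c) := by
  have h1 := (Finset.mem_filter.1 hr).2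
  rw [abs_le] at hc
  intro h
  rw [dvd_neg] at h
  have h2 := Int.eq_zero_of_abs_lt_dvd h (by rw [abs_lt]; constructor <;> omega)
  omega

theorem residuePart_eq_of_dvd {E : Type*} [AddCommGroup E] [Module ℂ E] {N : ℕ} {ζ : ℂ}
    (hζ : IsPrimitiveRoot ζ N) (F : ℂ → E) {r : ℤ} (hr : (N : ℤ) ∣ r) (w : ℂ) :
    residuePart N ζ F r w = residuePart N ζ F 0 w := by
  rw [residuePart, residuePart]
  congr 1
  refine Finset.sum_congr rfl fun j _ => ?_
  congr 1
  rw [mul_zero, neg_zero, zpow_zero]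
  exact (hζ.zpow_eq_one_iff_dvd _).2 ((dvd_neg).2 (hr.mul_left _))

end TailRange

section DecayConst

theorem inv_pow_eq_exp {t : ℝ} (ht : 0 < t) (k : ℕ) :
    t⁻¹ ^ k = Real.exp (-((k : ℝ) * Real.log t)) := by
  rw [Real.exp_neg, Real.exp_nat_mul, Real.exp_log ht, inv_pow]

theorem sqrt_inv_eq_exp {t : ℝ} (ht : 0 < t) : √t⁻¹ = Real.exp (-(1 / 2 * Real.log t)) := by
  rw [show -(1 / 2 * Real.log t) = -Real.log t / 2 by ring, Real.exp_half, Real.exp_neg,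
    Real.exp_log ht]

theorem decayConst_eq {t : ℝ} (ht : 0 < t) (L δ : ℝ) (N : ℕ) :
    decayConst L δ t N = L * δ ^ 2 * (4 / ((1 - t⁻¹ ^ N) * (1 - t⁻¹))) := by
  rw [decayConst, ← inv_pow_eq_exp ht]
  ring

end DecayConst

/-! ### Decay of the singular values, quasiseparable case -/

namespace CRCoeffs.AnnulusBound

variable {m : ℕ} {A : CRCoeffs m} {t δ L : ℝ}

/-- A singular value of the bottom left block, after some of the residue classes have been put
into a matrix of small rank. -/
theorem sigma_le (hA : A.AnnulusBound t δ) (hδ : 0 ≤ δ) (hneg : ‖A.neg‖ ≤ L) (hzero : ‖A.zero‖ ≤ L)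
    (hpos : ‖A.pos‖ ≤ L) (p h : ℕ) {ζ w : ℂ} (hζ : IsPrimitiveRoot ζ (2 ^ h)) (hw : ‖w‖ = 1)
    (T : Fin 3 → Finset ℕ) (hT : ∀ i, T i ⊆ Finset.range (2 ^ h)) {β : Fin 3 → ℝ} {τ : ℝ}
    (hβ : ∀ i, ResidueBound t (2 ^ h) (T i) (fun r => -(r + (![-1, 0, 1] : Fin 3 → ℤ) i)) (β i))
    (hτ : ∀ i, ResidueBound t (2 ^ h) (T i) (fun r => r) τ) {s : ℕ}
    (hrank : (∑ i : Fin 3, w ^ (![-1, 0, 1] : Fin 3 → ℤ) i • ∑ r ∈ Finset.range (2 ^ h) \ T i,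
        residuePart (2 ^ h) ζ (fun z => (A.phi z)⁻¹) (-(r + (![-1, 0, 1] : Fin 3 → ℤ) i)) w *
        (![lowerCorner p A.neg, lowerCorner p A.zero, lowerCorner p A.pos] :
          Fin 3 → Matrix (Fin m) (Fin m) ℂ) i * residuePart (2 ^ h) ζ (A.headInv p) r w).rank
      ≤ s - 1) :
    sigma s (bottomLeft p ((A.cr h).phi (w ^ 2 ^ h))⁻¹) ≤ L * δ ^ 2 * ((∑ i, β i) * τ) := by
  have hN : 0 < 2 ^ h := by positivity
  have hL : 0 ≤ L := (norm_nonneg _).trans hneg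
  rw [hA.bottomLeft_inv_phi_cr p h hζ hw]
  have hsplit (i : Fin 3) := Finset.sum_sdiff (hT i) (f := fun r : ℕ =>
        residuePart (2 ^ h) ζ (fun z => (A.phi z)⁻¹) (-(r + (![-1, 0, 1] : Fin 3 → ℤ) i)) w *
        (![lowerCorner p A.neg, lowerCorner p A.zero, lowerCorner p A.pos] :
          Fin 3 → Matrix (Fin m) (Fin m) ℂ) i * residuePart (2 ^ h) ζ (A.headInv p) r w)
  simp_rw [← hsplit, smul_add, Finset.sum_add_distrib]
  refine (sigma_le_of_rank_le (s := s) rfl ((Matrix.rank_submatrix_le _ _ _).trans hrank)).trans ?_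
  refine (Matrix.norm_submatrix_le _ (Function.Embedding.subtype _)
    (Function.Embedding.subtype _)).trans ?_
  rw [← mul_assoc (L * δ ^ 2)]
  refine norm_sum_residuePart_mul_mul_le (Nonneg.analyticBounded_inv_phi hA.one_lt hA.inv_le)
    (hA.analyticBounded_headInv p) hA.one_lt hδ hN hζ hw hL _ ?_ _ T hβ hτ (hτ 0).nonneg
  intro i
  fin_cases i
  · exact (norm_lowerCorner_le hA.neg p).trans hneg
  · exact (norm_lowerCorner_le hA.zero p).trans hzero
  · exact (norm_lowerCorner_le hA.pos p).trans hpos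

theorem sigma_le_of_isQuasiseparable (hA : A.AnnulusBound t δ) (hδ : 0 ≤ δ) (hneg : ‖A.neg‖ ≤ L)
    (hzero : ‖A.zero‖ ≤ L) (hpos : ‖A.pos‖ ≤ L) {k : ℕ} (hk : 1 ≤ k)
    (hneg_qs : IsQuasiseparable k A.neg) (hzero_qs : IsQuasiseparable k A.zero)
    (hpos_qs : IsQuasiseparable k A.pos) (p h : ℕ) {ζ w : ℂ} (hζ : IsPrimitiveRoot ζ (2 ^ h))
    (hw : ‖w‖ = 1) {s : ℕ} (hs : 1 ≤ s) :
    sigma s (bottomLeft p ((A.cr h).phi (w ^ 2 ^ h))⁻¹) ≤ 3 * decayConst L δ t (2 ^ h)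
      * Real.exp (-(((s : ℝ) - 3 * k) / (6 * k) * Real.log t)) := by
  have hN : 0 < 2 ^ h := by positivity
  have hL : 0 ≤ L := (norm_nonneg _).trans hneg
  have ht := hA.one_lt
  have ht0 : 0 < t := lt_trans one_pos ht
  have hlog : 0 < Real.log t := Real.log_pos ht
  have hx0 : 0 < t⁻¹ := inv_pos.2 ht0
  have hx1 : t⁻¹ < 1 := inv_lt_one_of_one_lt₀ ht
  have hy0 : 0 < t⁻¹ ^ 2 ^ h := by positivity
  have hy1 : t⁻¹ ^ 2 ^ h < 1 := pow_lt_one₀ hx0.le hx1 hN.ne'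
  have hΔp := one_sub_sq_pow_pos hx0 hx1 hN
  have hΔ := Real.sqrt_pos.2 hΔp
  have hΔ2 := Real.sq_sqrt hΔp.le
  have hk0 : (0 : ℝ) < k := by exact_mod_cast hk
  have hM : 0 ≤ 4 / ((1 - t⁻¹ ^ 2 ^ h) * (1 - t⁻¹)) :=
    div_nonneg (by norm_num) (mul_nonneg (by linarith) (by linarith))
  have hLδ : 0 ≤ L * δ ^ 2 := by positivity
  have hC : ∀ i, ((![lowerCorner p A.neg, lowerCorner p A.zero, lowerCorner p A.pos] :
      Fin 3 → Matrix (Fin m) (Fin m) ℂ) i).rank ≤ k := by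
    intro i
    fin_cases i
    · exact (rank_lowerCorner_le p A.neg).trans (hneg_qs p).1
    · exact (rank_lowerCorner_le p A.zero).trans (hzero_qs p).1
    · exact (rank_lowerCorner_le p A.pos).trans (hpos_qs p).1
  rw [decayConst_eq ht0]
  rcases Nat.lt_or_ge (3 * k) s with hsk | hsk
  -- The largest `q` with `3(2q + 1)k ≤ s - 1`, the rank available. Maximality gives `(s - 3k)/(6k)
  -- ≤ q + 1`, the exponent of the tail bound.
  · set q := (s - 1 - 3 * k) / (6 * k) with hq
    have hq1 : q * (6 * k) ≤ s - 1 - 3 * k := Nat.div_mul_le_self _ _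
    have hq2 : s - 1 - 3 * k < (q + 1) * (6 * k) :=
      Nat.lt_mul_of_div_lt (Nat.lt_succ_self _) (by omega)
    have hrank : 3 * ((2 * q + 1) * k) ≤ s - 1 := by
      have : 3 * ((2 * q + 1) * k) = q * (6 * k) + 3 * k := by ring
      omega
    refine (hA.sigma_le hδ hneg hzero hpos p h hζ hw (fun _ => tailRange (2 ^ h) q)
      (fun _ => tailRange_subset _ _)
      (fun i => residueBound_all ht hN (tailRange_subset _ _) (dvd_sub_of_dvd_neg_add_sub _))
      (fun i => residueBound_tailRange ht hN q subset_rfl) (s := s) ?_).trans ?_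
    · refine (rank_sum_smul_sum_mul_mul_le (fun i : Fin 3 => w ^ (![-1, 0, 1] : Fin 3 → ℤ) i)
        (Finset.range (2 ^ h) \ tailRange (2 ^ h) q) (fun i r => residuePart (2 ^ h) ζ
          (fun z => (A.phi z)⁻¹) (-(r + (![-1, 0, 1] : Fin 3 → ℤ) i)) w)
        _ (fun r => residuePart (2 ^ h) ζ (A.headInv p) r w) hC).trans (le_trans ?_ hrank)
      rw [Fintype.card_fin]
      have := card_sdiff_tailRange_le (2 ^ h) q
      gcongr
    · have h1 := kappa_mul_tail_le hx0 hx1 hy0 hy1 hΔ hΔ2 (pow_nonneg hx0.le (q + 1))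
      have h2 : t⁻¹ ^ (q + 1) ≤ Real.exp (-(((s : ℝ) - 3 * k) / (6 * k) * Real.log t)) := by
        rw [inv_pow_eq_exp ht0]
        refine Real.exp_le_exp.2 (neg_le_neg (mul_le_mul_of_nonneg_right ?_ hlog.le))
        rw [div_le_iff₀ (by positivity)]
        have h3 : s ≤ (q + 1) * (6 * k) + 3 * k := by omega
        have h4 : (s : ℝ) ≤ (q + 1) * (6 * k) + 3 * k := by exact_mod_cast h3
        push_cast
        linarith
      rw [Fin.sum_univ_three]
      calc _ = L * δ ^ 2 * (3 * ((1 + t⁻¹ ^ 2 ^ h) / √(1 - (t⁻¹ ^ 2 ^ h) ^ 2))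
            * (2 * t⁻¹ ^ (q + 1) / √(1 - (t⁻¹ ^ 2 ^ h) ^ 2))) := by ring
        _ ≤ L * δ ^ 2 * (3 * (4 / ((1 - t⁻¹ ^ 2 ^ h) * (1 - t⁻¹))) * t⁻¹ ^ (q + 1)) := by gcongr
        _ ≤ L * δ ^ 2 * (3 * (4 / ((1 - t⁻¹ ^ 2 ^ h) * (1 - t⁻¹)))
            * Real.exp (-(((s : ℝ) - 3 * k) / (6 * k) * Real.log t))) := by gcongr
        _ = _ := by ring
  -- For `s ≤ 3k` the exponential is at least one, so the bound on the norm of the whole corner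
  -- suffices.
  · refine (hA.sigma_le hδ hneg hzero hpos p h hζ hw (fun _ => Finset.range (2 ^ h))
      (fun _ => subset_rfl)
      (fun i => residueBound_all ht hN subset_rfl (dvd_sub_of_dvd_neg_add_sub _))
      (fun i => residueBound_all ht hN subset_rfl (fun a b h => h)) (s := s) (by simp)).trans ?_
    have h1 := kappa_mul_kappa_le hx0 hx1 hy0 hy1 hΔ hΔ2
    have h2 : 1 ≤ Real.exp (-(((s : ℝ) - 3 * k) / (6 * k) * Real.log t)) := by
      refine Real.one_le_exp ?_
      have h3 : (s : ℝ) ≤ 3 * k := by exact_mod_cast hsk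
      have h4 : ((s : ℝ) - 3 * k) / (6 * k) ≤ 0 := div_nonpos_of_nonpos_of_nonneg
        (by linarith) (by positivity)
      rw [← neg_mul]
      exact mul_nonneg (neg_nonneg.2 h4) hlog.le
    rw [Fin.sum_univ_three]
    calc _ = L * δ ^ 2 * (3 * ((1 + t⁻¹ ^ 2 ^ h) / √(1 - (t⁻¹ ^ 2 ^ h) ^ 2))
          * ((1 + t⁻¹ ^ 2 ^ h) / √(1 - (t⁻¹ ^ 2 ^ h) ^ 2))) := by ring
      _ ≤ L * δ ^ 2 * (3 * (4 / ((1 - t⁻¹ ^ 2 ^ h) * (1 - t⁻¹)))) := by gcongr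
      _ = 3 * (L * δ ^ 2 * (4 / ((1 - t⁻¹ ^ 2 ^ h) * (1 - t⁻¹)))) * 1 := by ring
      _ ≤ _ := by gcongr

end CRCoeffs.AnnulusBound

/-! ### Decay of the singular values, tridiagonal case -/

theorem rank_cornerUnit_le (m p : ℕ) : (cornerUnit m p).rank ≤ 1 := Matrix.rank_vecMulVec_le _ _

namespace CRCoeffs.AnnulusBound

variable {m : ℕ} {A : CRCoeffs m} {t δ L : ℝ}

theorem exists_lowerCorner_eq_smul (hneg : IsTridiagonal A.neg) (hzero : IsTridiagonal A.zero)
    (hpos : IsTridiagonal A.pos) (p : ℕ) : ∃ a : Fin 3 → ℂ, ∀ i,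
      (![lowerCorner p A.neg, lowerCorner p A.zero, lowerCorner p A.pos] :
        Fin 3 → Matrix (Fin m) (Fin m) ℂ) i = a i • cornerUnit m p := by
  obtain ⟨a, ha⟩ := _root_.exists_lowerCorner_eq_smul hneg p
  obtain ⟨b, hb⟩ := _root_.exists_lowerCorner_eq_smul hzero p
  obtain ⟨c, hc⟩ := _root_.exists_lowerCorner_eq_smul hpos p
  refine ⟨![a, b, c], fun i => ?_⟩
  fin_cases i
  · exact ha
  · exact hb
  · exact hc

theorem sigma_one_le (hA : A.AnnulusBound t δ) (hδ : 0 ≤ δ) (hneg : ‖A.neg‖ ≤ L)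
    (hzero : ‖A.zero‖ ≤ L) (hpos : ‖A.pos‖ ≤ L) (p h : ℕ) {ζ w : ℂ}
    (hζ : IsPrimitiveRoot ζ (2 ^ h)) (hw : ‖w‖ = 1) :
    sigma 1 (bottomLeft p ((A.cr h).phi (w ^ 2 ^ h))⁻¹) ≤ decayConst L δ t (2 ^ h) := by
  have hN : 0 < 2 ^ h := by positivity
  have hL : 0 ≤ L := (norm_nonneg _).trans hneg
  have ht := hA.one_lt
  have ht0 : 0 < t := lt_trans one_pos ht
  have hx0 : 0 < t⁻¹ := inv_pos.2 ht0
  have hx1 : t⁻¹ < 1 := inv_lt_one_of_one_lt₀ ht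
  have hΔp := one_sub_sq_pow_pos hx0 hx1 hN
  rw [decayConst_eq ht0]
  refine (hA.sigma_le hδ hneg hzero hpos p h hζ hw (fun _ => Finset.range (2 ^ h))
    (fun _ => subset_rfl)
    (fun i => residueBound_all ht hN subset_rfl (dvd_sub_of_dvd_neg_add_sub _))
    (fun i => residueBound_all ht hN subset_rfl (fun a b h => h)) (s := 1) (by simp)).trans ?_
  refine mul_le_mul_of_nonneg_left ?_ (by positivity)
  rw [Fin.sum_const, nsmul_eq_mul]
  exact kappa_mul_kappa_le_of_le hx1 (by positivity) (pow_le_of_le_one hx0.le hx1.le hN.ne')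
    (Real.sqrt_pos.2 hΔp) (Real.sq_sqrt hΔp.le)

theorem sigma_even_le_of_isTridiagonal (hA : A.AnnulusBound t δ) (hδ : 0 ≤ δ)
    (hneg : ‖A.neg‖ ≤ L) (hzero : ‖A.zero‖ ≤ L) (hpos : ‖A.pos‖ ≤ L)
    (hneg_tri : IsTridiagonal A.neg) (hzero_tri : IsTridiagonal A.zero)
    (hpos_tri : IsTridiagonal A.pos) (p h : ℕ) {ζ w : ℂ}
    (hζ : IsPrimitiveRoot ζ (2 ^ h)) (hw : ‖w‖ = 1) (q : ℕ) :
    sigma (2 * q + 2) (bottomLeft p ((A.cr h).phi (w ^ 2 ^ h))⁻¹)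
      ≤ decayConst L δ t (2 ^ h) * t⁻¹ ^ (q + 1) := by
  have hN : 0 < 2 ^ h := by positivity
  have hL : 0 ≤ L := (norm_nonneg _).trans hneg
  have ht := hA.one_lt
  have ht0 : 0 < t := lt_trans one_pos ht
  have hx0 : 0 < t⁻¹ := inv_pos.2 ht0
  have hx1 : t⁻¹ < 1 := inv_lt_one_of_one_lt₀ ht
  have hy0 : 0 < t⁻¹ ^ 2 ^ h := by positivity
  have hy1 : t⁻¹ ^ 2 ^ h < 1 := pow_lt_one₀ hx0.le hx1 hN.ne'
  have hΔp := one_sub_sq_pow_pos hx0 hx1 hN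
  have hΔ := Real.sqrt_pos.2 hΔp
  have hΔ2 := Real.sq_sqrt hΔp.le
  obtain ⟨a, ha⟩ := exists_lowerCorner_eq_smul hneg_tri hzero_tri hpos_tri p
  have hrank := (rank_sum_smul_sum_mul_mul_le_card (fun i : Fin 3 => w ^ (![-1, 0, 1] : Fin 3 → ℤ) i)
    (Finset.range (2 ^ h) \ tailRange (2 ^ h) q) (fun i r => residuePart (2 ^ h) ζ
      (fun z => (A.phi z)⁻¹) (-(r + (![-1, 0, 1] : Fin 3 → ℤ) i)) w)
    _ (fun r => residuePart (2 ^ h) ζ (A.headInv p) r w) (rank_cornerUnit_le m p) ha).trans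
      (card_sdiff_tailRange_le (2 ^ h) q)
  have hmid : ∀ c : ℤ, |c| ≤ q → ResidueBound t (2 ^ h) (tailRange (2 ^ h) q)
      (fun r => -(r + c)) (2 * t⁻¹ / √(1 - (t⁻¹ ^ 2 ^ h) ^ 2)) := fun c hc =>
    residueBound_nonzero ht hN (tailRange_subset _ _) (dvd_sub_of_dvd_neg_add_sub _)
      fun r hr => not_dvd_neg_add hr hc
  have hout : ∀ c : ℤ, ResidueBound t (2 ^ h) (tailRange (2 ^ h) q)
      (fun r => -(r + c)) ((1 + t⁻¹ ^ 2 ^ h) / √(1 - (t⁻¹ ^ 2 ^ h) ^ 2)) := fun c =>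
    residueBound_all ht hN (tailRange_subset _ _) (dvd_sub_of_dvd_neg_add_sub _)
  rw [decayConst_eq ht0, mul_assoc (L * δ ^ 2)]
  -- For `q ≥ 1` a shift of `r` by `±1` cannot reach class `0`, so every left energy is small. For
  -- `q = 0` the outer two coefficients can reach it and take the general bound.
  rcases Nat.eq_zero_or_pos q with rfl | hq
  · refine (hA.sigma_le hδ hneg hzero hpos p h hζ hw (fun _ => tailRange (2 ^ h) 0)
      (fun _ => tailRange_subset _ _)
      (β := ![(1 + t⁻¹ ^ 2 ^ h) / √(1 - (t⁻¹ ^ 2 ^ h) ^ 2), 2 * t⁻¹ / √(1 - (t⁻¹ ^ 2 ^ h) ^ 2),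
        (1 + t⁻¹ ^ 2 ^ h) / √(1 - (t⁻¹ ^ 2 ^ h) ^ 2)]) (fun i => ?_)
      (fun i => residueBound_tailRange ht hN 0 subset_rfl) hrank).trans ?_
    · fin_cases i
      · exact hout _
      · exact hmid _ (by simp)
      · exact hout _
    · refine mul_le_mul_of_nonneg_left ?_ (by positivity)
      rw [Fin.sum_univ_three, zero_add, pow_one]
      exact kappa_add_tail_mul_tail_le hx0 hx1 hy0 hy1 hΔ hΔ2
  · refine (hA.sigma_le hδ hneg hzero hpos p h hζ hw (fun _ => tailRange (2 ^ h) q)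
      (fun _ => tailRange_subset _ _) (fun i => hmid _ ?_)
      (fun i => residueBound_tailRange ht hN q subset_rfl) hrank).trans ?_
    · have : (1 : ℤ) ≤ q := by exact_mod_cast hq
      fin_cases i <;> simp <;> omega
    · refine mul_le_mul_of_nonneg_left ?_ (by positivity)
      rw [Fin.sum_univ_three]
      exact tail_mul_tail_le hx0 hx1 hy0 hy1 hΔ hΔ2 (by positivity)

theorem sigma_odd_le_of_isTridiagonal (hA : A.AnnulusBound t δ) (hδ : 0 ≤ δ)
    (hneg : ‖A.neg‖ ≤ L) (hzero : ‖A.zero‖ ≤ L) (hpos : ‖A.pos‖ ≤ L)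
    (hneg_tri : IsTridiagonal A.neg) (hzero_tri : IsTridiagonal A.zero)
    (hpos_tri : IsTridiagonal A.pos) (p h : ℕ) {ζ w : ℂ}
    (hζ : IsPrimitiveRoot ζ (2 ^ h)) (hw : ‖w‖ = 1) (q : ℕ) :
    sigma (2 * q + 3) (bottomLeft p ((A.cr h).phi (w ^ 2 ^ h))⁻¹)
      ≤ decayConst L δ t (2 ^ h) * (t⁻¹ ^ (q + 1) * √t⁻¹) := by
  have hN : 0 < 2 ^ h := by positivity
  have hL : 0 ≤ L := (norm_nonneg _).trans hneg
  have ht := hA.one_lt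
  have ht0 : 0 < t := lt_trans one_pos ht
  have hx0 : 0 < t⁻¹ := inv_pos.2 ht0
  have hx1 : t⁻¹ < 1 := inv_lt_one_of_one_lt₀ ht
  have hy0 : 0 < t⁻¹ ^ 2 ^ h := by positivity
  have hy1 : t⁻¹ ^ 2 ^ h < 1 := pow_lt_one₀ hx0.le hx1 hN.ne'
  have hΔp := one_sub_sq_pow_pos hx0 hx1 hN
  have hΔ := Real.sqrt_pos.2 hΔp
  have hΔ2 := Real.sq_sqrt hΔp.le
  have hM : 0 ≤ 4 / ((1 - t⁻¹ ^ 2 ^ h) * (1 - t⁻¹)) :=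
    div_nonneg (by norm_num) (mul_nonneg (by linarith) (by linarith))
  obtain ⟨a, ha⟩ := exists_lowerCorner_eq_smul hneg_tri hzero_tri hpos_tri p
  have hrank : ∀ S : Finset ℕ, _ := fun S =>
    rank_sum_smul_sum_mul_mul_le_card (fun i : Fin 3 => w ^ (![-1, 0, 1] : Fin 3 → ℤ) i)
      S (fun i r => residuePart (2 ^ h) ζ
      (fun z => (A.phi z)⁻¹) (-(r + (![-1, 0, 1] : Fin 3 → ℤ) i)) w)
      _ (fun r => residuePart (2 ^ h) ζ (A.headInv p) r w) (rank_cornerUnit_le m p) ha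
  rw [decayConst_eq ht0, mul_assoc (L * δ ^ 2)]
  rcases Nat.lt_or_ge h 2 with hh | hh
  -- At most two classes exist, so the whole sum has rank at most `2 ≤ s - 1` and the remainder is
  -- zero.
  · have hN2 : 2 ^ h ≤ 2 := by interval_cases h <;> norm_num
    have hempty : ∀ ρ : ℕ → ℤ, ResidueBound t (2 ^ h) ∅ ρ 0 := fun ρ =>
      ⟨le_rfl, by simp, by simp⟩
    refine (hA.sigma_le hδ hneg hzero hpos p h hζ hw (fun _ => ∅)
      (fun _ => Finset.empty_subset _) (fun i => hempty _) (fun i => hempty _)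
      ((hrank (Finset.range (2 ^ h) \ ∅)).trans ?_)).trans ?_
    · rw [Finset.sdiff_empty, Finset.card_range]
      omega
    · rw [mul_zero, mul_zero]
      positivity
  · have hN4 : 4 ≤ 2 ^ h := le_trans (by norm_num) (Nat.pow_le_pow_right (by norm_num) hh)
    set T : Fin 3 → Finset ℕ := fun i => (tailRange (2 ^ h) q).filter fun r : ℕ =>
      ¬ ((2 ^ h : ℕ) : ℤ) ∣ -((r : ℤ) + (![-1, 0, 1] : Fin 3 → ℤ) i) with hT
    -- The tail terms whose left factor has class `0`. They add rank at most one in total, so the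
    -- discarded rank is at most `(2q + 1) + 1 = s - 1`.
    set U : Fin 3 → Finset ℕ := fun i => (tailRange (2 ^ h) q).filter fun r : ℕ =>
      ((2 ^ h : ℕ) : ℤ) ∣ -((r : ℤ) + (![-1, 0, 1] : Fin 3 → ℤ) i) with hU
    have hTsub : ∀ i, T i ⊆ tailRange (2 ^ h) q := fun i => Finset.filter_subset _ _
    have hsplit : ∀ i, Finset.range (2 ^ h) \ T i
        = (Finset.range (2 ^ h) \ tailRange (2 ^ h) q) ∪ U i := by
      intro i
      ext r
      have hr : r ∈ tailRange (2 ^ h) q → r ∈ Finset.range (2 ^ h) := fun h =>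
        tailRange_subset _ _ h
      simp only [hT, hU, Finset.mem_sdiff, Finset.mem_filter, Finset.mem_union]
      tauto
    have hdisj : ∀ i, Disjoint (Finset.range (2 ^ h) \ tailRange (2 ^ h) q) (U i) := fun i =>
      Finset.disjoint_of_subset_right (Finset.filter_subset _ _) Finset.sdiff_disjoint
    refine (hA.sigma_le hδ hneg hzero hpos p h hζ hw T
      (fun i => (hTsub i).trans (tailRange_subset _ _))
      (fun i => residueBound_nonzero_of_four_le ht hN4 ((hTsub i).trans (tailRange_subset _ _))
        (dvd_sub_of_dvd_neg_add_sub _) fun r hr => (Finset.mem_filter.1 hr).2)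
      (fun i => residueBound_tailRange ht hN q (hTsub i)) ?_).trans ?_
    · simp_rw [hsplit, Finset.sum_union (hdisj _), smul_add, Finset.sum_add_distrib]
      refine (Matrix.rank_add_le _ _).trans ?_
      have h1 := (hrank (Finset.range (2 ^ h) \ tailRange (2 ^ h) q)).trans
        (card_sdiff_tailRange_le (2 ^ h) q)
      have h2 := rank_sum_smul_sum_const_mul_mul_le_one
        (fun i : Fin 3 => w ^ (![-1, 0, 1] : Fin 3 → ℤ) i) U (fun i r => residuePart (2 ^ h) ζ
          (fun z => (A.phi z)⁻¹) (-(r + (![-1, 0, 1] : Fin 3 → ℤ) i)) w)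
        (fun i r hr => residuePart_eq_of_dvd hζ _ (Finset.mem_filter.1 hr).2 w)
        _ (fun r => residuePart (2 ^ h) ζ (A.headInv p) r w) (rank_cornerUnit_le m p) ha
      exact (add_le_add h1 h2).trans_eq (by omega)
    · refine mul_le_mul_of_nonneg_left ?_ (by positivity)
      rw [Fin.sum_const, nsmul_eq_mul]
      exact nonzero_mul_tail_le hx0 hx1 hy0 hy1 hΔ hΔ2 (by positivity)

theorem sigma_le_of_isTridiagonal (hA : A.AnnulusBound t δ) (hδ : 0 ≤ δ)
    (hneg : ‖A.neg‖ ≤ L) (hzero : ‖A.zero‖ ≤ L) (hpos : ‖A.pos‖ ≤ L)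
    (hneg_tri : IsTridiagonal A.neg) (hzero_tri : IsTridiagonal A.zero)
    (hpos_tri : IsTridiagonal A.pos) (p h : ℕ) {ζ w : ℂ}
    (hζ : IsPrimitiveRoot ζ (2 ^ h)) (hw : ‖w‖ = 1) {s : ℕ} (hs : 2 ≤ s) :
    sigma s (bottomLeft p ((A.cr h).phi (w ^ 2 ^ h))⁻¹)
      ≤ decayConst L δ t (2 ^ h) * Real.exp (-((s : ℝ) / 2 * Real.log t)) := by
  have ht0 : 0 < t := lt_trans one_pos hA.one_lt
  rcases Nat.even_or_odd' (s - 2) with ⟨q, hq | hq⟩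
  · obtain rfl : s = 2 * q + 2 := by omega
    refine (hA.sigma_even_le_of_isTridiagonal hδ hneg hzero hpos hneg_tri hzero_tri hpos_tri p h
      hζ hw q).trans_eq ?_
    rw [inv_pow_eq_exp ht0]
    push_cast
    ring_nf
  · obtain rfl : s = 2 * q + 3 := by omega
    refine (hA.sigma_odd_le_of_isTridiagonal hδ hneg hzero hpos hneg_tri hzero_tri hpos_tri p h
      hζ hw q).trans_eq ?_
    rw [inv_pow_eq_exp ht0, sqrt_inv_eq_exp ht0, ← Real.exp_add]
    push_cast
    ring_nf

end CRCoeffs.AnnulusBound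

/-! ### The main theorem -/

theorem mainTheorem1 (m k : ℕ) (hk : 1 ≤ k) (A : CRCoeffs m) (L t δ : ℝ)
    (hneg : ∀ i j, 0 ≤ A.neg i j) (hzero : ∀ i j, 0 ≤ A.zero i j) (hpos : ∀ i j, 0 ≤ A.pos i j)
    (hrho : ∀ z : ℂ, ‖z‖ = 1 → spectralRadius ℂ (1 - A.phi z) < 1)
    (hneg_qs : IsQuasiseparable k A.neg) (hzero_qs : IsQuasiseparable k A.zero)
    (hpos_qs : IsQuasiseparable k A.pos)
    (hneg_norm : ‖A.neg‖ ≤ L) (hzero_norm : ‖A.zero‖ ≤ L) (hpos_norm : ‖A.pos‖ ≤ L)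
    (ht : 1 < t) (hδ : 0 < δ)
    (hinv : ∀ z ∈ annulus t, (A.phi z).det ≠ 0 ∧ ‖(A.phi z)⁻¹‖ ≤ δ) :
    (∀ z ∈ annulus t, spectralRadius ℂ (1 - A.phi z) < 1) ∧
    ∀ p : ℕ,
      (∀ z ∈ annulus t, IsUnit (topLeft p (A.phi z)) ∧ IsUnit (bottomRight p (A.phi z))) ∧
      ∀ h : ℕ, IsUnit ((A.cr h).zero - 1) ∧
        ∀ z : ℂ, ‖z‖ = 1 →
          IsUnit ((A.cr h).phi z) ∧
          decimate (2 ^ h) (fun w => bottomLeft p (A.phi w)⁻¹) z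
            = bottomLeft p ((A.cr h).phi z)⁻¹ ∧
          (∀ s : ℕ, 1 ≤ s →
            sigma s (decimate (2 ^ h) (fun w => bottomLeft p (A.phi w)⁻¹) z)
              ≤ 3 * decayConst L δ t (2 ^ h)
                * Real.exp (-(((s : ℝ) - 3 * k) / (6 * k) * Real.log t))) ∧
          (IsTridiagonal A.neg → IsTridiagonal A.zero → IsTridiagonal A.pos →
            sigma 1 (decimate (2 ^ h) (fun w => bottomLeft p (A.phi w)⁻¹) z)
              ≤ decayConst L δ t (2 ^ h) ∧
            ∀ s : ℕ, 2 ≤ s →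
              sigma s (decimate (2 ^ h) (fun w => bottomLeft p (A.phi w)⁻¹) z)
                ≤ decayConst L δ t (2 ^ h) * Real.exp (-((s : ℝ) / 2 * Real.log t))) := by
  have hA : A.AnnulusBound t δ :=
    { neg := hneg, zero := hzero, pos := hpos, one_lt := ht
      spectralRadius_lt := hrho 1 norm_one, inv_le := hinv }
  refine ⟨fun z hz => hA.spectralRadius_lt_one hz, fun p => ⟨fun z hz =>
    ⟨hA.isUnit_toBlock hz _, hA.isUnit_toBlock hz _⟩, fun h => ⟨?_, fun z hz => ?_⟩⟩⟩
  · rw [← neg_sub]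
    exact (hA.subcritical.cr h).isUnit_one_sub_zero.1.neg
  have hN : 0 < 2 ^ h := by positivity
  -- The averaging formulas hold at `N`-th powers, and every point of the unit circle is the `N`-th
  -- power of another one.
  obtain ⟨w, rfl⟩ := IsAlgClosed.exists_pow_nat_eq z hN
  have hw : ‖w‖ = 1 := by
    rw [norm_pow] at hz
    exact (pow_eq_one_iff_of_nonneg (norm_nonneg w) hN.ne').1 hz
  have hζ := Complex.isPrimitiveRoot_exp (2 ^ h) hN.ne'
  rw [hA.decimate_eq p h hζ hw]
  refine ⟨(hA.subcritical.cr h).isUnit_phi hz, rfl, fun s hs =>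
    hA.sigma_le_of_isQuasiseparable hδ.le hneg_norm hzero_norm hpos_norm hk hneg_qs hzero_qs
      hpos_qs p h hζ hw hs, fun hneg_tri hzero_tri hpos_tri =>
    ⟨hA.sigma_one_le hδ.le hneg_norm hzero_norm hpos_norm p h hζ hw, fun s hs =>
      hA.sigma_le_of_isTridiagonal hδ.le hneg_norm hzero_norm hpos_norm hneg_tri hzero_tri
        hpos_tri p h hζ hw hs⟩⟩
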